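/- A \emph{positive non-increasing pure-jump process} is a process $M=(M_t)_{t\ge 0}$ whose paths are positive, non-increasing, right-continuous and satisfy $M_0-M_t=\sum_{0<s\le t}(M_{s-}-M_s)$ for all $t\ge 0$. \textbf{Fragmenters.} Let $\Lambda$ be a measure on $(0,1)$ with $\int(1-u)\,\Lambda(du)<\infty$. A \emph{fragmenter with splitting measure $\Lambda$} is a positive non-increasing pure-jump process with the law of $\big(\prod_{0<s\le t}F_s\big)_{t\ge 0}$, where the $(s,F_s)$ are the points of a Poisson random measure on $(0,\infty)\times(0,1)$ with intensity $ds\,\Lambda(du)$. \textbf{Switching.} Let $p:(0,1)\to[0,1]$ be measurable with $\int p\,d\Lambda<\infty$. Mark each point $(s,F_s)$ independently by $m_s=1$ with probability $p(F_s)$ and by $m_s=0$ otherwise; that is, let $(s,F_s,m_s)$ be the points of a Poisson random measure with intensity $ds\,\Lambda(du)\,K(u,dm)$, where $K(u,\{1\})=p(u)=1-K(u,\{0\})$. Put $M^\circ_t=\prod_{0<s\le t}F_s$; the fragmenter derived from it by switching is $M^{\mathrm{sw}}_t=\prod_{0<s\le t}F^{\mathrm{sw}}_s$ with $F^{\mathrm{sw}}_s=1-F_s$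 if $m_s=1$ and $F^{\mathrm{sw}}_s=F_s$ if $m_s=0$; the first switching time is $\tau^\circ=\inf\{s: m_s=1\}$. \textbf{Bifurcators.} A pair of fragmenters $(M,\widehat M)$ is a \emph{bifurcator with splitting time $\tau$} if for some such $\Lambda$ and $p$: $M$ is a fragmenter with splitting measure $\Lambda$; $(M,\tau)$ has the same law as $(M^\circ,\tau^\circ)$; almost surely $\widehat M_t=M_t$ for $t<\tau$ and $\widehat M_\tau=M_{\tau-}-M_\tau$; and $(\widehat M_{\tau+v}/\widehat M_\tau)_{v\ge 0}$ has the law of $M^{\mathrm{sw}}$ and is independent of $(M,\tau)$. \textbf{Asymmetric Markov branching property.} $(M,\widehat M)$ has this property relative to $\tau$ if for all $t\ge 0$ (whenever the conditioning event has positive probability): (i) conditionally given $\tau>t$, the process $\big((M_{t+v}/M_t,\widehat M_{t+v}/\widehat M_t)\big)_{v\ge 0}$ is a copy of $(M,\widehat M)$, independent of $\big((M_s,\widehat M_s)\big)_{0\le s\le t}$; (ii) conditionally given $\tau\le t$, the processes $(M_{t+v}/M_t)_{v\ge 0}$ and $(\widehat M_{t+v}/\widehat M_t)_{v\ge 0}$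 are independent copies of $M$ and $\widehat M$ respectively, jointly independent of $\big((M_s,\widehat M_s)\big)_{0\le s\le t}$. \textbf{Binary junction conditions at $\tau$.} Almost surely, $M_t=\widehat M_t$ for $0\le t<\tau$, $M_{\tau-}-M_\tau=\widehat M_\tau$ and $\widehat M_{\tau-}-\widehat M_\tau=M_\tau$. \textbf{Proposition.} Let $M$ and $\widehat M$ be positive non-increasing pure-jump processes on a common probability space such that $\tau=\inf\{t\ge 0: M_t\ne\widehat M_t\}\in(0,\infty)$ almost surely. Then $(M,\widehat M)$ is a bifurcator with splitting time $\tau$ if and only if $(M,\widehat M)$ has the asymmetric Markov branching property relative to $\tau$ and satisfies the binary junction conditions at $\tau$. -/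

import Mathlib

open MeasureTheory ProbabilityTheory Filter Topology Set
open scoped NNReal ENNReal

noncomputable section

/-- `f` is a positive, non-increasing, right-continuous path on `[0, ∞)` which decreases only
by jumps: its total decrease on `[0, t]` is the sum of its jumps. (The left limit at time `0` is
by convention `f 0`.) -/
structure IsPureJumpPath (f : ℝ≥0 → ℝ) : Prop where
  pos : ∀ t, 0 < f t
  antitone : Antitone f
  right_continuous : ∀ t, ContinuousWithinAt f (Ici t) t
  hasSum_jumps : ∀ t : ℝ≥0, HasSum (fun s : Iic t => Function.leftLim f s - f s) (f 0 - f t)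

/-- A positive non-increasing pure-jump process. -/
structure IsPureJumpProcess {Ω : Type*} [MeasurableSpace Ω] (M : ℝ≥0 → Ω → ℝ) : Prop where
  measurable : ∀ t, Measurable (M t)
  path : ∀ ω, IsPureJumpPath (fun t => M t ω)

/-- `τ = inf {t ≥ 0 : M t ≠ M' t}`, with `inf ∅ = ∞`. -/
def separationTime {Ω : Type*} (M M' : ℝ≥0 → Ω → ℝ) (ω : Ω) : ℝ≥0∞ :=
  ⨅ (t : ℝ≥0) (_ : M t ω ≠ M' t ω), (t : ℝ≥0∞)

/-- `N` is, under `P`, a Poisson random measure with intensity measure `ν`. -/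
structure IsPoissonRandomMeasure {Ω E : Type*} [MeasurableSpace Ω] [MeasurableSpace E]
    (P : Measure Ω) (N : Ω → Measure E) (ν : Measure E) : Prop where
  measurable : Measurable N
  law : ∀ A, MeasurableSet A → ν A ≠ ∞ →
    P.map (fun ω => N ω A) = (poissonMeasure (ν A).toNNReal).map (fun n : ℕ => (n : ℝ≥0∞))
  indep : ∀ (n : ℕ) (A : Fin n → Set E), (∀ i, MeasurableSet (A i)) →
    Pairwise (fun i j => Disjoint (A i) (A j)) → iIndepFun (fun i ω => N ω (A i)) P

/-- A measure on `(0, 1)` with `∫ (1 - u) Λ(du) < ∞`. -/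
structure IsSplittingMeasure (Λ : Measure ℝ) : Prop where
  support : Λ (Ioo 0 1)ᶜ = 0
  integrable : ∫⁻ u, ENNReal.ofReal (1 - u) ∂Λ < ∞

/-- For a point measure `N` with atoms `(s, F_s)`, the product `∏_{s ≤ t} F_s`, written as
`exp (- ∑_{s ≤ t} (- log F_s))`. -/
def factorProduct (N : Measure (ℝ × ℝ)) (t : ℝ≥0) : ℝ :=
  Real.exp (-(∫⁻ x in {x : ℝ × ℝ | x.1 ≤ t}, ENNReal.ofReal (-Real.log x.2) ∂N).toReal)

/-- `M` is a fragmenter (multiplicative subordinator without drift and killing) with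
splitting measure `Λ`: it has the law of `∏_{s ≤ t} F_s`, where the `(s, F_s)` are the points of
a Poisson random measure on `(0, ∞) × (0, 1)` with intensity `ds Λ(du)`. -/
structure IsFragmenter {Ω : Type*} [MeasurableSpace Ω] (μ : Measure Ω) (M : ℝ≥0 → Ω → ℝ)
    (Λ : Measure ℝ) : Prop where
  splitting : IsSplittingMeasure Λ
  path : ∀ᵐ ω ∂μ, IsPureJumpPath (fun t => M t ω)
  law : ∃ (Ω' : Type) (_ : MeasurableSpace Ω') (P : Measure Ω') (_ : IsProbabilityMeasure P)
    (N : Ω' → Measure (ℝ × ℝ)),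
    IsPoissonRandomMeasure P N ((volume.restrict (Ioi (0 : ℝ))).prod Λ) ∧
    IdentDistrib (fun ω t => M t ω) (fun ω t => factorProduct (N ω) t) μ P

/-- The measure `Λ(du) K(u, dm)` for the marking kernel `K(u, {true}) = p u`,
`K(u, {false}) = 1 - p u`. -/
def markedMeasure (Λ : Measure ℝ) (p : ℝ → ℝ) : Measure (ℝ × Bool) :=
  (Λ.withDensity fun u => ENNReal.ofReal (p u)).map (fun u => (u, true)) +
  (Λ.withDensity fun u => ENNReal.ofReal (1 - p u)).map (fun u => (u, false))

/-- The factors `(s, F_s)` of a marked point measure with atoms `(s, F_s, m_s)`. -/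
def factors (N : Measure (ℝ × ℝ × Bool)) : Measure (ℝ × ℝ) :=
  N.map fun x => (x.1, x.2.1)

/-- The switched factors: `(s, 1 - F_s)` if the mark is `true`, and `(s, F_s)` otherwise. -/
def switchedFactors (N : Measure (ℝ × ℝ × Bool)) : Measure (ℝ × ℝ) :=
  N.map fun x => (x.1, if x.2.2 = true then 1 - x.2.1 else x.2.1)

/-- The first switching time: the infimum of the times by which a point with mark `true` has
occurred. -/
def firstSwitch (N : Measure (ℝ × ℝ × Bool)) : ℝ≥0∞ :=
  ⨅ (t : ℝ≥0) (_ : N {x | x.1 ≤ t ∧ x.2.2 = true} ≠ 0), (t : ℝ≥0∞)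

/-- `(M, M')` is a bifurcator with splitting time `τ`: for some splitting measure `Λ` and some
switching probability function `p` with `∫ p dΛ < ∞`, the pair `(M, τ)` is distributed as a
fragmenter with splitting measure `Λ` together with the first switching time when its factors are
switched according to `p`, while `M'` agrees with `M` before `τ`, takes the value `M_{τ-} - M_τ`
at `τ`, and `(M'_{τ+v} / M'_τ)` is a copy, independent of `(M, τ)`, of the auxiliary fragmenter
derived from `M` by switching. -/
def IsBifurcator {Ω : Type*} [MeasurableSpace Ω] (μ : Measure Ω) (M M' : ℝ≥0 → Ω → ℝ)
    (τ : Ω → ℝ≥0∞) : Prop :=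
  ∃ (Λ : Measure ℝ) (p : ℝ → ℝ),
    IsFragmenter μ M Λ ∧ (∃ Λ', IsFragmenter μ M' Λ') ∧
    Measurable p ∧ (∀ u, p u ∈ Icc (0 : ℝ) 1) ∧
    ∫⁻ u, ENNReal.ofReal (p u) ∂Λ < ∞ ∧
    ∃ (Ω' : Type) (_ : MeasurableSpace Ω') (P : Measure Ω') (_ : IsProbabilityMeasure P)
      (N : Ω' → Measure (ℝ × ℝ × Bool)),
      IsPoissonRandomMeasure P N ((volume.restrict (Ioi (0 : ℝ))).prod (markedMeasure Λ p)) ∧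
      IdentDistrib (fun ω => ((fun t => M t ω : ℝ≥0 → ℝ), τ ω))
        (fun ω => ((fun t => factorProduct (factors (N ω)) t : ℝ≥0 → ℝ), firstSwitch (N ω))) μ P ∧
      (∀ᵐ ω ∂μ, ∀ t : ℝ≥0, (t : ℝ≥0∞) < τ ω → M' t ω = M t ω) ∧
      (∀ᵐ ω ∂μ, M' (τ ω).toNNReal ω =
        Function.leftLim (fun t => M t ω) (τ ω).toNNReal - M (τ ω).toNNReal ω) ∧
      IdentDistrib (fun ω (v : ℝ≥0) => M' ((τ ω).toNNReal + v) ω / M' (τ ω).toNNReal ω)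
        (fun ω v => factorProduct (switchedFactors (N ω)) v) μ P ∧
      IndepFun (fun ω (v : ℝ≥0) => M' ((τ ω).toNNReal + v) ω / M' (τ ω).toNNReal ω)
        (fun ω => ((fun t => M t ω : ℝ≥0 → ℝ), τ ω)) μ

/-- The evolution of `M` after time `t`, normalised: `(M_{t+v} / M_t, v ≥ 0)`. -/
def future {Ω : Type*} (M : ℝ≥0 → Ω → ℝ) (t : ℝ≥0) (ω : Ω) : ℝ≥0 → ℝ :=
  fun v => M (t + v) ω / M t ω

/-- The pair of processes up to time `t`: `((M_s, M'_s), 0 ≤ s ≤ t)`. -/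
def pastPair {Ω : Type*} (M M' : ℝ≥0 → Ω → ℝ) (t : ℝ≥0) (ω : Ω) : Iic t → ℝ × ℝ :=
  fun s => (M s ω, M' s ω)

/-- The asymmetric Markov branching property of `(M, M')` relative to `τ`. The conditions are
imposed for those `t` for which the conditioning event has positive probability. -/
structure AsymmetricMarkovBranching {Ω : Type*} [MeasurableSpace Ω] (μ : Measure Ω)
    (M M' : ℝ≥0 → Ω → ℝ) (τ : Ω → ℝ≥0∞) : Prop where
  before : ∀ t : ℝ≥0, μ {ω | (t : ℝ≥0∞) < τ ω} ≠ 0 →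
    IdentDistrib (fun ω v => (future M t ω v, future M' t ω v)) (fun ω v => (M v ω, M' v ω))
      (cond μ {ω | (t : ℝ≥0∞) < τ ω}) μ ∧
    IndepFun (fun ω v => (future M t ω v, future M' t ω v)) (pastPair M M' t)
      (cond μ {ω | (t : ℝ≥0∞) < τ ω})
  after : ∀ t : ℝ≥0, μ {ω | τ ω ≤ (t : ℝ≥0∞)} ≠ 0 →
    IdentDistrib (future M t) (fun ω v => M v ω) (cond μ {ω | τ ω ≤ (t : ℝ≥0∞)}) μ ∧
    IdentDistrib (future M' t) (fun ω v => M' v ω) (cond μ {ω | τ ω ≤ (t : ℝ≥0∞)}) μ ∧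
    IndepFun (future M t) (future M' t) (cond μ {ω | τ ω ≤ (t : ℝ≥0∞)}) ∧
    IndepFun (fun ω => (future M t ω, future M' t ω)) (pastPair M M' t)
      (cond μ {ω | τ ω ≤ (t : ℝ≥0∞)})

/-- The binary junction conditions at `τ`: the identification rule and the binary splitting
condition, almost surely. -/
structure BinaryJunction {Ω : Type*} [MeasurableSpace Ω] (μ : Measure Ω)
    (M M' : ℝ≥0 → Ω → ℝ) (τ : Ω → ℝ≥0∞) : Prop where
  identification : ∀ᵐ ω ∂μ, ∀ t : ℝ≥0, (t : ℝ≥0∞) < τ ω → M t ω = M' t ω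
  splitting : ∀ᵐ ω ∂μ,
    Function.leftLim (fun t => M t ω) (τ ω).toNNReal - M (τ ω).toNNReal ω
      = M' (τ ω).toNNReal ω ∧
    Function.leftLim (fun t => M' t ω) (τ ω).toNNReal - M' (τ ω).toNNReal ω
      = M (τ ω).toNNReal ω

end

/-! ### Laws of families of [0,1]-valued variables from mixed moments -/

section Moments

/-! Processes with values in (0,1] are handled through the mixed moments E[∏ M_{s_i}; τ > r]: these
factorise under the Markov property, and they determine joint laws (`map_eq_of_moments`).
`IsMarkovPair` is the simple Markov property of (M, τ) in this form. It reduces every mixed moment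
to the one-time moments E[M_t^k] and E[M_t^k; τ > t] (`IsMarkovPair.moments_eq`), so two Markov
pairs with equal one-time moments have the same law.

From bifurcator to branching. The Laplace functional of a Poisson random measure factorises over
disjoint time strips, hence a fragmenter with its first switching time is a Markov pair
(`isMarkovPair_poisson`). The process M̂ is a measurable functional (`glue`) of (M, τ) and of its
normalised evolution R after τ (`postSplit`), where R is independent of (M, τ). If τ > t, the future
of M̂ is the same functional of the future of M, the residual time τ - t and R; this gives (i). If τ
≤ t, the future of M̂ is that of R after time t - τ; freezing (M, τ) by Fubini makes this time
deterministic, and the Markov property of R gives (ii), with the law of R in place of that of M̂.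
The two laws agree because M̂ is itself a fragmenter: its future at n has the law of M̂, and also
that of R up to the event τ > n, whose probability vanishes (`IsSplitOff.map_post_eq`).

From branching to bifurcator. Properties (i) and (ii) make (M, τ) and (M̂, τ) Markov pairs, so the
one-time moments are exponential: E[M_t^k; τ > t] = exp(-t a_k), E[M_t^k] = exp(-t b_k), E[M̂_t^k] =
exp(-t b'_k). The splitting measure is found in two pieces. The piece Λ₀ describes the jumps of M
that do not separate the pair. A weak limit of n (1-u) P(M_{1/n} ∈ du, τ > 1/n) is a finite measure
κ on [0,1] with moments a_{m+1} - a_m. An atom of κ at 1 would be a drift, excluded by the pure-jump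
property; an atom at 0 would be killing, excluded by positivity. Then Λ₀(du) = κ(du)/(1-u). The
piece Λ₁ is the law of M_τ/M_{τ-}, given τ ≤ 1, multiplied by the rate of τ. Its moments are a_k -
b_k. The junction conditions turn u into 1-u when M and M̂ exchange roles, so that ∫ (1-u)^k dΛ₁ =
a_k - b'_k. With Λ = Λ₀ + Λ₁ and p = dΛ₁/dΛ the one-time moments are those of the Poisson
construction, both for (M, τ) and for M̂. The evolution of M̂ after τ is identified by applying (ii)
at grid times decreasing to τ (`AsymmetricMarkovBranching.postSplit_law`). -/

theorem measurable_list_prod_map {Ω ι : Type*} [MeasurableSpace Ω] {X : ι → Ω → ℝ} {l : List ι}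
    (hX : ∀ i ∈ l, Measurable (X i)) : Measurable fun ω => (l.map fun i => X i ω).prod := by
  induction l with
  | nil => simp
  | cons a l ih =>
    simp only [List.map_cons, List.prod_cons]
    exact (hX a (by simp)).mul (ih fun i hi => hX i (by simp [hi]))

theorem list_prod_map_mem_Icc {ι : Type*} {f : ι → ℝ} {l : List ι}
    (h : ∀ i ∈ l, f i ∈ Icc (0 : ℝ) 1) : (l.map f).prod ∈ Icc (0 : ℝ) 1 := by
  induction l with
  | nil => simp
  | cons a l ih =>
    simp only [List.map_cons, List.prod_cons]
    exact unitInterval.mul_mem (h a (by simp)) (ih fun i hi => h i (by simp [hi]))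

theorem integrable_of_mem_Icc {Ω : Type*} [MeasurableSpace Ω] {μ : Measure Ω} [IsFiniteMeasure μ]
    {X : Ω → ℝ} (hX : AEStronglyMeasurable X μ) (h : ∀ᵐ ω ∂μ, X ω ∈ Icc (0 : ℝ) 1) :
    Integrable X μ :=
  Integrable.of_bound hX 1 (h.mono fun ω hω => by
    rw [Real.norm_eq_abs, abs_le]; exact ⟨by linarith [hω.1], hω.2⟩)

/-- Finite measures on a finite cube are determined by their mixed moments. -/
theorem Measure.ext_of_moments_unitInterval {ι : Type*} [Finite ι]
    {P Q : Measure (ι → unitInterval)} [IsFiniteMeasure P] [IsFiniteMeasure Q]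
    (h : ∀ l : List ι, ∫ x, (l.map fun i => (x i : ℝ)).prod ∂P =
      ∫ x, (l.map fun i => (x i : ℝ)).prod ∂Q) : P = Q := by
  let c : ι → BoundedContinuousFunction (ι → unitInterval) ℝ := fun i =>
    BoundedContinuousFunction.mkOfCompact
      ⟨fun x => (x i : ℝ), continuous_subtype_val.comp (continuous_apply i)⟩
  let A : StarSubalgebra ℝ (BoundedContinuousFunction (ι → unitInterval) ℝ) :=
    { Algebra.adjoin ℝ (range c) with
      star_mem' := fun {a} ha => by
        have : star a = a := by ext x; simp
        rw [this]; exact ha }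
  have h_int : ∀ (R : Measure (ι → unitInterval)) [IsFiniteMeasure R]
      (g : BoundedContinuousFunction (ι → unitInterval) ℝ), Integrable (fun x => g x) R :=
    fun R _ g => g.integrable R
  refine ext_of_forall_mem_subalgebra_integral_eq_of_polish (𝕜 := ℝ) (A := A) ?_ ?_
  · intro x y hxy
    obtain ⟨i, hi⟩ := Function.ne_iff.mp hxy
    refine ⟨fun z => c i z, ⟨_, ⟨c i, Algebra.subset_adjoin ⟨i, rfl⟩, rfl⟩, rfl⟩, ?_⟩
    simpa [c, Subtype.ext_iff] using hi
  · intro g hg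
    -- The algebra generated by the coordinates is the linear span of the monomials, so by linearity
    -- only monomials need to be compared.
    have hg' : g ∈ Submodule.span ℝ (Submonoid.closure (range c) :
        Set (BoundedContinuousFunction (ι → unitInterval) ℝ)) := by
      rw [← Algebra.adjoin_eq_span]; exact hg
    clear hg
    induction hg' using Submodule.span_induction with
    | mem g hg =>
      obtain ⟨L, hL, rfl⟩ := Submonoid.exists_list_of_mem_closure hg
      have key : ∃ l : List ι, ∀ x, L.prod x = (l.map fun i => (x i : ℝ)).prod := by
        clear hg
        induction L with
        | nil => exact ⟨[], fun x => by simp⟩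
        | cons a L ih =>
          obtain ⟨l, hl⟩ := ih (fun y hy => hL y (List.mem_cons_of_mem _ hy))
          obtain ⟨i, rfl⟩ := hL a (List.mem_cons_self ..)
          refine ⟨i :: l, fun x => ?_⟩
          simp only [List.prod_cons, BoundedContinuousFunction.coe_mul, Pi.mul_apply, hl x,
            List.map_cons]
          rfl
      obtain ⟨l, hl⟩ := key
      simp_rw [hl]
      exact h l
    | zero => simp
    | add x y hx hy ihx ihy =>
      simp only [BoundedContinuousFunction.coe_add, Pi.add_apply]
      rw [integral_add (h_int P x) (h_int P y), integral_add (h_int Q x) (h_int Q y),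
        ihx, ihy]
    | smul a x hx ih =>
      simp only [BoundedContinuousFunction.coe_smul]
      rw [integral_smul, integral_smul, ih]

theorem coe_projIcc_zero_one {x : ℝ} (hx : x ∈ Icc (0 : ℝ) 1) :
    (projIcc (0 : ℝ) 1 zero_le_one x : ℝ) = x := by
  rw [projIcc_of_mem zero_le_one hx]

theorem map_restrict_eq_map_projIcc {Ω ι : Type*} [MeasurableSpace Ω] {μ : Measure Ω}
    {X : ι → Ω → ℝ} (hX : ∀ i, Measurable (X i)) (hX01 : ∀ i, ∀ᵐ ω ∂μ, X i ω ∈ Icc (0 : ℝ) 1)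
    (I : Finset ι) :
    μ.map (Finset.restrict I ∘ fun ω i => X i ω) =
      (μ.map (fun ω (i : I) => projIcc (0 : ℝ) 1 zero_le_one (X i ω))).map
        (fun x i => (x i : ℝ)) := by
  have hm : Measurable (fun ω (i : I) => projIcc (0 : ℝ) 1 zero_le_one (X i ω)) :=
    measurable_pi_lambda _ fun i => continuous_projIcc.measurable.comp (hX i)
  rw [Measure.map_map (by fun_prop) hm]
  refine Measure.map_congr ?_
  have : ∀ᵐ ω ∂μ, ∀ i : I, X i ω ∈ Icc (0 : ℝ) 1 := ae_all_iff.mpr fun i => hX01 i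
  filter_upwards [this] with ω hω
  funext i
  exact (coe_projIcc_zero_one (hω i)).symm

theorem integral_moment_map_projIcc {Ω ι : Type*} [MeasurableSpace Ω] {μ : Measure Ω}
    {X : ι → Ω → ℝ} (hX : ∀ i, Measurable (X i)) (hX01 : ∀ i, ∀ᵐ ω ∂μ, X i ω ∈ Icc (0 : ℝ) 1)
    (I : Finset ι) (l : List I) :
    ∫ x, (l.map fun i => (x i : ℝ)).prod
        ∂(μ.map (fun ω (i : I) => projIcc (0 : ℝ) 1 zero_le_one (X i ω))) =
      ∫ ω, ((l.map Subtype.val).map fun i => X i ω).prod ∂μ := by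
  have hm : Measurable (fun ω (i : I) => projIcc (0 : ℝ) 1 zero_le_one (X i ω)) :=
    measurable_pi_lambda _ fun i => continuous_projIcc.measurable.comp (hX i)
  rw [integral_map hm.aemeasurable
    (measurable_list_prod_map (X := fun i (x : I → unitInterval) => (x i : ℝ))
      fun i _ => by fun_prop).aestronglyMeasurable]
  refine integral_congr_ae ?_
  have : ∀ᵐ ω ∂μ, ∀ i : I, X i ω ∈ Icc (0 : ℝ) 1 := ae_all_iff.mpr fun i => hX01 i
  filter_upwards [this] with ω hω
  simp only [List.map_map, Function.comp_def]
  congr 1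
  exact List.map_congr_left fun i _ => coe_projIcc_zero_one (hω i)

/-- The law of a family of `[0,1]`-valued random variables is determined by its mixed moments. -/
theorem map_eq_of_moments {Ω Ω' ι : Type*} [MeasurableSpace Ω] [MeasurableSpace Ω']
    {μ : Measure Ω} {ν : Measure Ω'} [IsFiniteMeasure μ] [IsFiniteMeasure ν]
    {X : ι → Ω → ℝ} {Y : ι → Ω' → ℝ} (hX : ∀ i, Measurable (X i)) (hY : ∀ i, Measurable (Y i))
    (hX01 : ∀ i, ∀ᵐ ω ∂μ, X i ω ∈ Icc (0 : ℝ) 1) (hY01 : ∀ i, ∀ᵐ ω ∂ν, Y i ω ∈ Icc (0 : ℝ) 1)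
    (h : ∀ l : List ι, ∫ ω, (l.map fun i => X i ω).prod ∂μ = ∫ ω, (l.map fun i => Y i ω).prod ∂ν) :
    μ.map (fun ω i => X i ω) = ν.map (fun ω i => Y i ω) := by
  have hXm : Measurable (fun ω i => X i ω) := measurable_pi_lambda _ hX
  have hYm : Measurable (fun ω i => Y i ω) := measurable_pi_lambda _ hY
  -- The index set may be uncountable. A finite measure on the product is determined by its
  -- finite-dimensional marginals, which reduces the claim to finite cubes.
  refine IsProjectiveLimit.unique (P := fun I => (ν.map (fun ω i => Y i ω)).map
    (Finset.restrict I)) (fun I => ?_) (fun I => rfl)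
  beta_reduce
  rw [Measure.map_map (Finset.measurable_restrict I) hXm,
    Measure.map_map (Finset.measurable_restrict I) hYm,
    map_restrict_eq_map_projIcc hX hX01, map_restrict_eq_map_projIcc hY hY01]
  congr 1
  refine Measure.ext_of_moments_unitInterval fun l => ?_
  rw [integral_moment_map_projIcc hX hX01, integral_moment_map_projIcc hY hY01, h]

/-- Indexing two families by a sum type lets one moment theorem treat them jointly; typically one
family is the path and the other the indicators of τ > r. -/
theorem prod_map_sumElim {α β : Type*} (f : α → ℝ) (g : β → ℝ) (l : List (α ⊕ β)) :
    (l.map (Sum.elim f g)).prod =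
      ((l.filterMap Sum.getLeft?).map f).prod * ((l.filterMap Sum.getRight?).map g).prod := by
  induction l with
  | nil => simp
  | cons a l ih =>
    cases a <;> simp only [List.map_cons, List.prod_cons, Sum.elim_inl, Sum.elim_inr,
      List.filterMap_cons, Sum.getLeft?_inl, Sum.getLeft?_inr, Sum.getRight?_inl,
      Sum.getRight?_inr, ih] <;> ring

/-- If the mixed moments of two families of `[0,1]`-valued random variables factorise, then their
joint law is a product measure. -/
theorem map_prodMk_eq_prod_of_moments {Ω Ω₁ Ω₂ ι κ : Type*} [MeasurableSpace Ω]
    [MeasurableSpace Ω₁] [MeasurableSpace Ω₂] {μ : Measure Ω} {μ₁ : Measure Ω₁} {μ₂ : Measure Ω₂}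
    [IsFiniteMeasure μ] [IsFiniteMeasure μ₁] [IsFiniteMeasure μ₂]
    {X : ι → Ω → ℝ} {Y : κ → Ω → ℝ} {X' : ι → Ω₁ → ℝ} {Y' : κ → Ω₂ → ℝ}
    (hX : ∀ i, Measurable (X i)) (hY : ∀ i, Measurable (Y i))
    (hX' : ∀ i, Measurable (X' i)) (hY' : ∀ i, Measurable (Y' i))
    (hX01 : ∀ i, ∀ᵐ ω ∂μ, X i ω ∈ Icc (0 : ℝ) 1) (hY01 : ∀ i, ∀ᵐ ω ∂μ, Y i ω ∈ Icc (0 : ℝ) 1)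
    (hX'01 : ∀ i, ∀ᵐ ω ∂μ₁, X' i ω ∈ Icc (0 : ℝ) 1)
    (hY'01 : ∀ i, ∀ᵐ ω ∂μ₂, Y' i ω ∈ Icc (0 : ℝ) 1)
    (h : ∀ (k : List ι) (l : List κ),
      ∫ ω, (k.map fun i => X i ω).prod * (l.map fun j => Y j ω).prod ∂μ =
        (∫ ω, (k.map fun i => X' i ω).prod ∂μ₁) * ∫ ω, (l.map fun j => Y' j ω).prod ∂μ₂) :
    μ.map (fun ω => ((fun i => X i ω), (fun j => Y j ω))) =
      (μ₁.map (fun ω i => X' i ω)).prod (μ₂.map (fun ω j => Y' j ω)) := by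
  have hXm : Measurable (fun ω i => X i ω) := measurable_pi_lambda _ hX
  have hYm : Measurable (fun ω i => Y i ω) := measurable_pi_lambda _ hY
  have hX'm : Measurable (fun ω i => X' i ω) := measurable_pi_lambda _ hX'
  have hY'm : Measurable (fun ω i => Y' i ω) := measurable_pi_lambda _ hY'
  let Z : ι ⊕ κ → Ω → ℝ := Sum.elim X Y
  let Z' : ι ⊕ κ → Ω₁ × Ω₂ → ℝ :=
    Sum.elim (fun i p => X' i p.1) (fun j p => Y' j p.2)
  have hZ : ∀ i, Measurable (Z i) := by rintro (i | i); exacts [hX i, hY i]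
  have hZ' : ∀ i, Measurable (Z' i) := by
    rintro (i | i); exacts [(hX' i).comp measurable_fst, (hY' i).comp measurable_snd]
  have main : μ.map (fun ω i => Z i ω) = (μ₁.prod μ₂).map (fun p i => Z' i p) := by
    refine map_eq_of_moments hZ hZ' ?_ ?_ fun l => ?_
    · rintro (i | i); exacts [hX01 i, hY01 i]
    · rintro (i | i)
      · exact Measure.quasiMeasurePreserving_fst.ae (hX'01 i)
      · exact Measure.quasiMeasurePreserving_snd.ae (hY'01 i)
    · have e1 : ∀ ω, (l.map fun i => Z i ω).prod =
          ((l.filterMap Sum.getLeft?).map fun i => X i ω).prod *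
            ((l.filterMap Sum.getRight?).map fun i => Y i ω).prod := fun ω => by
        rw [← prod_map_sumElim]
        congr 2
        funext i
        cases i <;> rfl
      have e2 : ∀ p, (l.map fun i => Z' i p).prod =
          ((l.filterMap Sum.getLeft?).map fun i => X' i p.1).prod *
            ((l.filterMap Sum.getRight?).map fun i => Y' i p.2).prod := fun ω => by
        rw [← prod_map_sumElim]
        congr 2
        funext i
        cases i <;> rfl
      simp_rw [e1, e2]
      rw [h, ← integral_prod_mul]
  let g : (ι ⊕ κ → ℝ) → (ι → ℝ) × (κ → ℝ) := fun z => (fun i => z (.inl i), fun j => z (.inr j))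
  have hg : Measurable g := by fun_prop
  have := congrArg (Measure.map g) main
  rw [Measure.map_map hg (measurable_pi_lambda _ hZ),
    Measure.map_map hg (measurable_pi_lambda _ hZ')] at this
  rw [Measure.map_prod_map _ _ hX'm hY'm]
  exact this

/-- Random variables with values in `[0,1]` whose mixed moments factorise are independent. -/
theorem iIndepFun_of_moments {Ω : Type*} [MeasurableSpace Ω] {μ : Measure Ω}
    [IsProbabilityMeasure μ] {n : ℕ} {X : Fin n → Ω → ℝ} (hX : ∀ i, Measurable (X i))
    (hX01 : ∀ i, ∀ᵐ ω ∂μ, X i ω ∈ Icc (0 : ℝ) 1)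
    (h : ∀ k : Fin n → ℕ, ∫ ω, ∏ i, X i ω ^ k i ∂μ = ∏ i, ∫ ω, X i ω ^ k i ∂μ) :
    iIndepFun X μ := by
  rw [iIndepFun_iff_map_fun_eq_pi_map fun i => (hX i).aemeasurable]
  have : ∀ i, IsProbabilityMeasure (μ.map (X i)) := fun i =>
    Measure.isProbabilityMeasure_map (hX i).aemeasurable
  have key := map_eq_of_moments (μ := μ) (ν := Measure.pi fun i => μ.map (X i))
    (Y := fun i x => x i) hX (fun i => measurable_pi_apply i) hX01 (fun i => ?_) fun l => ?_
  · rw [key]; exact Measure.map_id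
  · have h1 : ∀ᵐ x ∂μ.map (X i), x ∈ Icc (0 : ℝ) 1 :=
      (ae_map_iff (hX i).aemeasurable measurableSet_Icc).mpr (hX01 i)
    exact (Measure.quasiMeasurePreserving_eval (μ := fun i => μ.map (X i)) i).ae h1
  · have e : ∀ x : Fin n → ℝ, (l.map fun i => x i).prod = ∏ i, x i ^ l.count i := fun x => by
      rw [Finset.prod_list_map_count]
      refine Finset.prod_subset (Finset.subset_univ _) fun i _ hi => ?_
      rw [List.count_eq_zero_of_not_mem (by simpa using hi), pow_zero]
    simp_rw [e]
    rw [h, integral_fintype_prod_eq_prod (μ := fun i => μ.map (X i))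
      (f := fun i y => y ^ l.count i)]
    refine Finset.prod_congr rfl fun i _ => ?_
    rw [integral_map (hX i).aemeasurable (by fun_prop)]

end Moments

/-! ### The exponential exp(-x) on [0, ∞] and Poisson generating functions -/

section ExpNeg

/-- The function `x ↦ exp (-x)` on `[0, ∞]`, with `exp (-∞) = 0`. -/
noncomputable def expNeg (x : ℝ≥0∞) : ℝ≥0∞ := EReal.exp (-(x : EReal))

theorem expNeg_zero : expNeg 0 = 1 := by simp [expNeg]

theorem expNeg_top : expNeg ∞ = 0 := by simp [expNeg]

theorem expNeg_of_ne_top {x : ℝ≥0∞} (hx : x ≠ ∞) :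
    expNeg x = ENNReal.ofReal (Real.exp (-x.toReal)) := by
  lift x to ℝ≥0 using hx
  have : -((x : ℝ≥0∞) : EReal) = ((-(x : ℝ) : ℝ) : EReal) := by
    rw [EReal.coe_neg]; rfl
  rw [expNeg, this, EReal.exp_coe]; rfl

theorem toReal_expNeg_of_ne_top {x : ℝ≥0∞} (hx : x ≠ ∞) :
    (expNeg x).toReal = Real.exp (-x.toReal) := by
  rw [expNeg_of_ne_top hx, ENNReal.toReal_ofReal (Real.exp_pos _).le]

theorem expNeg_le_one (x : ℝ≥0∞) : expNeg x ≤ 1 := by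
  rw [expNeg, EReal.exp_le_one_iff]
  simpa using EReal.coe_ennreal_nonneg x

theorem expNeg_ne_top (x : ℝ≥0∞) : expNeg x ≠ ∞ :=
  ((expNeg_le_one x).trans_lt ENNReal.one_lt_top).ne

theorem expNeg_add (x y : ℝ≥0∞) : expNeg (x + y) = expNeg x * expNeg y := by
  induction x with
  | top => simp [expNeg_top]
  | coe x =>
    induction y with
    | top => simp [expNeg_top]
    | coe y =>
      rw [expNeg_of_ne_top (by simp), expNeg_of_ne_top (by simp), expNeg_of_ne_top (by simp),
        ← ENNReal.ofReal_mul (Real.exp_pos _).le, ← Real.exp_add]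
      congr 2
      simp [ENNReal.toReal_add]
      ring

theorem expNeg_sum {ι : Type*} (s : Finset ι) (f : ι → ℝ≥0∞) :
    expNeg (∑ i ∈ s, f i) = ∏ i ∈ s, expNeg (f i) := by
  classical
  induction s using Finset.induction_on with
  | empty => simp [expNeg_zero]
  | insert a s ha ih => rw [Finset.sum_insert ha, Finset.prod_insert ha, expNeg_add, ih]

theorem expNeg_nat_mul (n : ℕ) (c : ℝ≥0∞) : expNeg (n * c) = expNeg c ^ n := by
  have := expNeg_sum (Finset.range n) (fun _ => c)
  simpa using this

theorem continuous_expNeg : Continuous expNeg :=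
  ENNReal.continuous_exp.comp (continuous_neg.comp continuous_coe_ennreal_ereal)

theorem measurable_expNeg : Measurable expNeg := continuous_expNeg.measurable

theorem expNeg_antitone : Antitone expNeg := fun _ _ h =>
  EReal.exp_monotone (EReal.neg_le_neg_iff.mpr (EReal.coe_ennreal_le_coe_ennreal_iff.mpr h))

/-- An inverse of `expNeg`. -/
noncomputable def negLog (y : ℝ≥0∞) : ℝ≥0∞ := (-ENNReal.log y).toENNReal

theorem measurable_negLog : Measurable negLog := by
  unfold negLog
  exact (ENNReal.measurable_log.neg).ereal_toENNReal

theorem negLog_expNeg (x : ℝ≥0∞) : negLog (expNeg x) = x := by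
  simp [negLog, expNeg]

theorem lintegral_pow_poissonMeasure (r : ℝ≥0) {z : ℝ≥0∞} (hz : z ≤ 1) :
    ∫⁻ n : ℕ, z ^ n ∂(poissonMeasure r) = expNeg ((1 - z) * r) := by
  obtain ⟨y, rfl⟩ : ∃ y : ℝ≥0, z = y :=
    ⟨_, (ENNReal.coe_toNNReal (hz.trans_lt ENNReal.one_lt_top).ne).symm⟩
  have e : ∀ n : ℕ, (y : ℝ≥0∞) ^ n = ENNReal.ofReal ((y : ℝ) ^ n) := fun n => by
    rw [ENNReal.ofReal_pow (NNReal.coe_nonneg y), ENNReal.ofReal_coe_nnreal]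
  simp_rw [e]
  rw [lintegral_countable']
  have e2 : ∀ n : ℕ, ENNReal.ofReal ((y : ℝ) ^ n) * poissonMeasure r {n} =
      ENNReal.ofReal (Real.exp (-r) * ((r * y : ℝ) ^ n / (n.factorial : ℝ))) := fun n => by
    rw [poissonMeasure_singleton, ← ENNReal.ofReal_mul (by positivity)]
    congr 1
    rw [mul_pow]; ring
  have hs := (NormedSpace.expSeries_div_hasSum_exp (r * y : ℝ)).mul_left (Real.exp (-r))
  simp_rw [e2]
  rw [← ENNReal.ofReal_tsum_of_nonneg (fun n => by positivity) hs.summable, hs.tsum_eq,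
    ← Real.exp_eq_exp_ℝ, ← Real.exp_add, expNeg_of_ne_top (by finiteness)]
  congr 2
  rw [ENNReal.toReal_mul, ENNReal.toReal_sub_of_le hz (by simp)]
  simp
  ring

theorem lintegral_expNeg_mul_poissonMeasure (r : ℝ≥0) (c : ℝ≥0∞) :
    ∫⁻ n : ℕ, expNeg (c * n) ∂(poissonMeasure r) = expNeg ((1 - expNeg c) * r) := by
  rw [← lintegral_pow_poissonMeasure r (expNeg_le_one c)]
  refine lintegral_congr fun n => ?_
  rw [mul_comm, expNeg_nat_mul]

end ExpNeg

/-! ### The Laplace functional of a Poisson random measure -/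

section Laplace

variable {Ω E : Type*} [MeasurableSpace Ω] [MeasurableSpace E] {P : Measure Ω}
  {N : Ω → Measure E} {ν : Measure E}

theorem IsPoissonRandomMeasure.measurable_eval (hN : IsPoissonRandomMeasure P N ν) {A : Set E}
    (hA : MeasurableSet A) : Measurable fun ω => N ω A :=
  (Measure.measurable_coe hA).comp hN.measurable

/-- Independence over disjoint sets leaves a product of Laplace transforms of Poisson variables. -/
theorem IsPoissonRandomMeasure.lintegral_expNeg_sum (hN : IsPoissonRandomMeasure P N ν) {n : ℕ}
    {A : Fin n → Set E} (hA : ∀ i, MeasurableSet (A i))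
    (hd : Pairwise fun i j => Disjoint (A i) (A j)) (hf : ∀ i, ν (A i) ≠ ∞) (c : Fin n → ℝ≥0∞) :
    ∫⁻ ω, expNeg (∑ i, c i * N ω (A i)) ∂P = expNeg (∑ i, (1 - expNeg (c i)) * ν (A i)) := by
  have hm : ∀ i, Measurable fun x : ℝ≥0∞ => expNeg (c i * x) := fun i =>
    measurable_expNeg.comp (measurable_const.mul measurable_id)
  simp_rw [expNeg_sum]
  have hind := (hN.indep n A hA hd).comp (fun i x => expNeg (c i * x)) hm
  rw [show (fun ω => ∏ i, expNeg (c i * N ω (A i))) =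
    fun ω => ∏ i, ((fun x : ℝ≥0∞ => expNeg (c i * x)) ∘ fun ω => N ω (A i)) ω from rfl,
    lintegral_prod_eq_prod_lintegral_of_indepFun Finset.univ _ hind
      (fun i => (hm i).comp (hN.measurable_eval (hA i)))]
  refine Finset.prod_congr rfl fun i _ => ?_
  have h1 : ∫⁻ ω, expNeg (c i * N ω (A i)) ∂P =
      ∫⁻ x, expNeg (c i * x) ∂(P.map fun ω => N ω (A i)) :=
    (lintegral_map (hm i) (hN.measurable_eval (hA i))).symm
  simp only [Function.comp_apply]
  rw [h1, hN.law _ (hA i) (hf i), lintegral_map (hm i) (by fun_prop),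
    lintegral_expNeg_mul_poissonMeasure, ENNReal.coe_toNNReal (hf i)]

/-- The Laplace functional of a Poisson random measure. -/
theorem IsPoissonRandomMeasure.lintegral_expNeg [IsProbabilityMeasure P] [SigmaFinite ν]
    (hN : IsPoissonRandomMeasure P N ν) {f : E → ℝ≥0∞} (hf : Measurable f) :
    ∫⁻ ω, expNeg (∫⁻ x, f x ∂(N ω)) ∂P = expNeg (∫⁻ x, (1 - expNeg (f x)) ∂ν) := by
  let S := spanningSets ν
  -- Simple approximations of `f`, cut to sets of finite intensity because the Poisson laws are
  -- prescribed only there. Both sides pass to the limit by monotone and dominated convergence.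
  let g : ℕ → SimpleFunc E ℝ≥0∞ := fun n =>
    (SimpleFunc.eapprox f n).restrict (S n)
  have hS : ∀ n, MeasurableSet (S n) := measurableSet_spanningSets ν
  have hgval : ∀ n x, g n x = (S n).indicator (SimpleFunc.eapprox f n) x := fun n x => by
    rw [SimpleFunc.coe_restrict _ (hS n)]
  have hgmono : ∀ x, Monotone fun n => g n x := by
    intro x m n hmn
    simp only [hgval]
    by_cases hx : x ∈ S m
    · have hx' : x ∈ S n := monotone_spanningSets ν hmn hx
      simp only [indicator_of_mem hx, indicator_of_mem hx']
      exact SimpleFunc.monotone_eapprox f hmn x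
    · simp [indicator_of_notMem hx]
  have hgsup : ∀ x, ⨆ n, g n x = f x := by
    intro x
    refine le_antisymm (iSup_le fun n => ?_) ?_
    · rw [hgval, ← SimpleFunc.iSup_eapprox_apply hf x]
      exact (indicator_le_self _ _ _).trans (le_iSup (fun k => SimpleFunc.eapprox f k x) n)
    · rw [← SimpleFunc.iSup_eapprox_apply hf x]
      refine iSup_le fun n => ?_
      obtain ⟨m, hm⟩ : ∃ m, x ∈ S m := by
        have : x ∈ ⋃ m, S m := by rw [iUnion_spanningSets]; trivial
        simpa using this
      have hx : x ∈ S (max n m) := monotone_spanningSets ν (le_max_right _ _) hm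
      refine le_trans ?_ (le_iSup (fun k => g k x) (max n m))
      simp only [hgval, indicator_of_mem hx]
      exact SimpleFunc.monotone_eapprox f (le_max_left n m) x
  have hgt : ∀ x, Tendsto (fun n => g n x) atTop (𝓝 (f x)) := fun x => by
    rw [← hgsup x]; exact tendsto_atTop_iSup (hgmono x)
  have step : ∀ n, ∫⁻ ω, expNeg (∫⁻ x, g n x ∂(N ω)) ∂P =
      expNeg (∫⁻ x, (1 - expNeg (g n x)) ∂ν) := by
    intro n
    let h := SimpleFunc.eapprox f n
    let e := h.range.equivFin.symm
    let A : Fin h.range.card → Set E := fun i => h ⁻¹' {(e i : ℝ≥0∞)} ∩ S n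
    have hA : ∀ i, MeasurableSet (A i) := fun i => (h.measurableSet_fiber _).inter (hS n)
    have hd : Pairwise fun i j => Disjoint (A i) (A j) := by
      intro i j hij
      refine Set.disjoint_left.mpr fun x hx hx' => hij ?_
      apply e.injective
      apply Subtype.ext
      rw [← hx.1, ← hx'.1]
    have hfin : ∀ i, ν (A i) ≠ ∞ := fun i =>
      ((measure_mono inter_subset_right).trans_lt (measure_spanningSets_lt_top ν n)).ne
    have hsum : ∀ (m : Measure E) (φ : ℝ≥0∞ → ℝ≥0∞), φ 0 = 0 →
        ∫⁻ x, φ (g n x) ∂m = ∑ i, φ (e i) * m (A i) := by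
      intro m φ hφ
      have : ∀ x, φ (g n x) = (S n).indicator (h.map φ) x := fun x => by
        rw [hgval]
        by_cases hx : x ∈ S n <;> simp [hx, hφ, h]
      simp_rw [this]
      rw [lintegral_indicator (hS n), SimpleFunc.lintegral_eq_lintegral,
        SimpleFunc.map_lintegral]
      rw [← Finset.sum_coe_sort, ← e.sum_comp]
      refine Finset.sum_congr rfl fun i _ => ?_
      rw [Measure.restrict_apply (h.measurableSet_fiber _)]
    have h1 := hN.lintegral_expNeg_sum hA hd hfin (fun i => (e i : ℝ≥0∞))
    have h2 : ∀ ω, ∫⁻ x, g n x ∂(N ω) = ∑ i, (e i : ℝ≥0∞) * N ω (A i) := fun ω =>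
      hsum (N ω) id rfl
    rw [hsum ν (fun y => 1 - expNeg y) (by simp [expNeg_zero]), ← h1]
    simp_rw [h2]
  have hmeas : ∀ k : E → ℝ≥0∞, Measurable k → Measurable fun ω => expNeg (∫⁻ x, k x ∂(N ω)) :=
    fun k hk => measurable_expNeg.comp ((Measure.measurable_lintegral hk).comp hN.measurable)
  have lim1 : Tendsto (fun n => ∫⁻ ω, expNeg (∫⁻ x, g n x ∂(N ω)) ∂P) atTop
      (𝓝 (∫⁻ ω, expNeg (∫⁻ x, f x ∂(N ω)) ∂P)) := by
    refine tendsto_lintegral_of_dominated_convergence (fun _ => 1)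
      (fun n => hmeas _ (g n).measurable) (fun n => ae_of_all _ fun ω => expNeg_le_one _)
      (by simp) (ae_of_all _ fun ω => ?_)
    refine (continuous_expNeg.tendsto _).comp ?_
    exact lintegral_tendsto_of_tendsto_of_monotone (fun n => (g n).measurable.aemeasurable)
      (ae_of_all _ hgmono) (ae_of_all _ hgt)
  have lim2 : Tendsto (fun n => expNeg (∫⁻ x, (1 - expNeg (g n x)) ∂ν)) atTop
      (𝓝 (expNeg (∫⁻ x, (1 - expNeg (f x)) ∂ν))) := by
    refine (continuous_expNeg.tendsto _).comp ?_
    refine lintegral_tendsto_of_tendsto_of_monotone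
      (fun n => (measurable_const.sub (measurable_expNeg.comp (g n).measurable)).aemeasurable)
      (ae_of_all _ fun x m n hmn => tsub_le_tsub_left (expNeg_antitone (hgmono x hmn)) _)
      (ae_of_all _ fun x => ?_)
    exact ENNReal.Tendsto.sub tendsto_const_nhds ((continuous_expNeg.tendsto _).comp (hgt x))
      (Or.inl ENNReal.one_ne_top)
  simp_rw [step] at lim1
  exact tendsto_nhds_unique lim1 lim2

end Laplace

/-! ### Characterisation by Laplace functionals, and existence -/

section PoissonConstruction

variable {Ω E : Type*} [MeasurableSpace Ω] [MeasurableSpace E] {P : Measure Ω}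
  {N : Ω → Measure E} {ν : Measure E}

theorem integral_toReal_expNeg {f : Ω → ℝ≥0∞} (hf : Measurable f) :
    ∫ ω, (expNeg (f ω)).toReal ∂P = (∫⁻ ω, expNeg (f ω) ∂P).toReal :=
  integral_toReal (measurable_expNeg.comp hf).aemeasurable
    (ae_of_all _ fun ω => (expNeg_ne_top (f ω)).lt_top)

theorem toReal_expNeg_mem_Icc (x : ℝ≥0∞) : (expNeg x).toReal ∈ Icc (0 : ℝ) 1 :=
  ⟨ENNReal.toReal_nonneg, by
    simpa using ENNReal.toReal_mono ENNReal.one_ne_top (expNeg_le_one x)⟩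

theorem one_sub_expNeg_sum_indicator {E : Type*} {n : ℕ} {A : Fin n → Set E}
    (hd : Pairwise fun i j => Disjoint (A i) (A j)) (c : Fin n → ℝ≥0∞) (x : E) :
    1 - expNeg (∑ i, (A i).indicator (fun _ => c i) x) =
      ∑ i, (A i).indicator (fun _ => 1 - expNeg (c i)) x := by
  by_cases hx : ∃ i, x ∈ A i
  · obtain ⟨i, hi⟩ := hx
    have hj : ∀ j, j ≠ i → x ∉ A j := fun j hji hj => Set.disjoint_left.mp (hd hji) hj hi
    rw [Finset.sum_eq_single i (fun j _ hji => indicator_of_notMem (hj j hji) _) (by simp),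
      Finset.sum_eq_single i (fun j _ hji => indicator_of_notMem (hj j hji) _) (by simp),
      indicator_of_mem hi, indicator_of_mem hi]
  · push Not at hx
    simp [indicator_of_notMem (hx _), expNeg_zero]

/-- A random measure with the Laplace functional of a Poisson random measure is one. -/
theorem IsPoissonRandomMeasure.of_laplace [IsProbabilityMeasure P] (hN : Measurable N)
    (h : ∀ f : E → ℝ≥0∞, Measurable f →
      ∫⁻ ω, expNeg (∫⁻ x, f x ∂(N ω)) ∂P = expNeg (∫⁻ x, (1 - expNeg (f x)) ∂ν)) :
    IsPoissonRandomMeasure P N ν := by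
  have hev : ∀ A, MeasurableSet A → Measurable fun ω => N ω A := fun A hA =>
    (Measure.measurable_coe hA).comp hN
  have hX : ∀ A, MeasurableSet A → Measurable fun ω => (expNeg (N ω A)).toReal := fun A hA =>
    (measurable_expNeg.comp (hev A hA)).ennreal_toReal
  have hback : ∀ x, negLog (ENNReal.ofReal (expNeg x).toReal) = x := fun x => by
    rw [ENNReal.ofReal_toReal (expNeg_ne_top x), negLog_expNeg]
  have hbm : Measurable fun z : ℝ => negLog (ENNReal.ofReal z) :=
    measurable_negLog.comp ENNReal.measurable_ofReal
  -- Joint moments of the variables exp(-N(A_i)) are values of the Laplace functional at ∑ k_i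
  -- 1_{A_i}. These variables lie in [0,1], and `negLog` recovers the counts from them, infinite
  -- ones included.
  have hmom : ∀ (n : ℕ) (A : Fin n → Set E), (∀ i, MeasurableSet (A i)) →
      Pairwise (fun i j => Disjoint (A i) (A j)) → ∀ k : Fin n → ℕ,
      ∫ ω, ∏ i, (expNeg (N ω (A i))).toReal ^ k i ∂P =
        ∏ i, (expNeg ((1 - expNeg (k i)) * ν (A i))).toReal := by
    intro n A hA hd k
    have e : ∀ ω, ∏ i, (expNeg (N ω (A i))).toReal ^ k i =
        (expNeg (∫⁻ x, ∑ i, (A i).indicator (fun _ => (k i : ℝ≥0∞)) x ∂(N ω))).toReal := by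
      intro ω
      rw [lintegral_finsetSum _ fun i _ => measurable_const.indicator (hA i), expNeg_sum,
        ENNReal.toReal_prod]
      refine Finset.prod_congr rfl fun i _ => ?_
      rw [lintegral_indicator_const (hA i), expNeg_nat_mul, ENNReal.toReal_pow]
    have hfm : Measurable fun x => ∑ i, (A i).indicator (fun _ => (k i : ℝ≥0∞)) x :=
      Finset.measurable_sum _ fun i _ => measurable_const.indicator (hA i)
    simp_rw [e]
    have hfN : Measurable fun ω =>
        ∫⁻ x, ∑ i, (A i).indicator (fun _ => (k i : ℝ≥0∞)) x ∂(N ω) :=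
      (Measure.measurable_lintegral hfm).comp hN
    rw [integral_toReal_expNeg hfN, h _ hfm]
    simp_rw [one_sub_expNeg_sum_indicator hd]
    rw [lintegral_finsetSum _ fun i _ => measurable_const.indicator (hA i), expNeg_sum,
        ENNReal.toReal_prod]
    refine Finset.prod_congr rfl fun i _ => ?_
    rw [lintegral_indicator_const (hA i)]
  have hmom1 : ∀ A, MeasurableSet A → ∀ k : ℕ, ∫ ω, (expNeg (N ω A)).toReal ^ k ∂P =
      (expNeg ((1 - expNeg k) * ν A)).toReal := by
    intro A hA k
    simpa using hmom 1 (fun _ => A) (fun _ => hA) (fun i j hij => (hij (Subsingleton.elim _ _)).elim)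
      (fun _ => k)
  refine ⟨hN, fun A hA hfin => ?_, fun n A hA hd => ?_⟩
  · have key := map_eq_of_moments (ι := Unit) (μ := P) (ν := poissonMeasure (ν A).toNNReal)
      (X := fun _ ω => (expNeg (N ω A)).toReal) (Y := fun _ n => (expNeg n).toReal)
      (fun _ => hX A hA) (fun _ => measurable_from_nat)
      (fun _ => ae_of_all _ fun ω => toReal_expNeg_mem_Icc _)
      (fun _ => ae_of_all _ fun ω => toReal_expNeg_mem_Icc _) fun l => ?_
    · have hz : Measurable fun z : Unit → ℝ => negLog (ENNReal.ofReal (z ())) :=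
        hbm.comp (measurable_pi_apply _)
      have := congrArg (Measure.map fun z : Unit → ℝ => negLog (ENNReal.ofReal (z ()))) key
      rw [Measure.map_map hz (measurable_pi_lambda _ fun _ => hX A hA),
        Measure.map_map hz (measurable_pi_lambda _ fun _ => measurable_from_nat)] at this
      simpa only [Function.comp_def, hback] using this
    · simp only [List.map_const', List.prod_replicate]
      rw [hmom1 A hA]
      have e : ∀ n : ℕ, (expNeg n).toReal ^ l.length = (expNeg (l.length * (n : ℝ≥0∞))).toReal :=
        fun n => by rw [expNeg_nat_mul, ENNReal.toReal_pow]
      simp_rw [e]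
      rw [integral_toReal_expNeg measurable_from_nat, lintegral_expNeg_mul_poissonMeasure,
        ENNReal.coe_toNNReal hfin]
  · have key := iIndepFun_of_moments (X := fun i ω => (expNeg (N ω (A i))).toReal)
      (μ := P) (fun i => hX _ (hA i)) (fun i => ae_of_all _ fun ω => toReal_expNeg_mem_Icc _)
      fun k => by
        rw [hmom n A hA hd k]
        exact Finset.prod_congr rfl fun i _ => (hmom1 _ (hA i) _).symm
    have := key.comp (fun _ z => negLog (ENNReal.ofReal z)) fun _ => hbm
    simpa only [Function.comp_def, hback] using this

/-- The zero measure is the reason for `Nonempty`: any Dirac mass serves there. -/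
theorem exists_isProbabilityMeasure_smul_eq [Nonempty E] (ν : Measure E) [IsFiniteMeasure ν] :
    ∃ ρ : Measure E, IsProbabilityMeasure ρ ∧ ν = ν univ • ρ := by
  by_cases h : ν = 0
  · exact ⟨Measure.dirac (Classical.arbitrary E), inferInstance, by simp [h]⟩
  · have h0 : ν univ ≠ 0 := by simpa using h
    refine ⟨(ν univ)⁻¹ • ν, ⟨?_⟩, ?_⟩
    · simp [ENNReal.inv_mul_cancel h0 (measure_ne_top ν univ)]
    · rw [smul_smul, ENNReal.mul_inv_cancel h0 (measure_ne_top ν univ), one_smul]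

/-- The empirical measure of the first `n` points of a sequence. -/
noncomputable def empiricalMeasure (p : ℕ × (ℕ → E)) : Measure E :=
  ∑ i ∈ Finset.range p.1, Measure.dirac (p.2 i)

theorem measurable_empiricalMeasure : Measurable (empiricalMeasure (E := E)) := by
  refine Measure.measurable_of_measurable_coe _ fun A hA => ?_
  refine measurable_from_prod_countable_right fun n => ?_
  simp only [empiricalMeasure, Measure.coe_finsetSum, Finset.sum_apply]
  refine Finset.measurable_sum _ fun i _ => ?_
  exact (Measure.measurable_coe hA).comp (Measure.measurable_dirac.comp (measurable_pi_apply i))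

/-- Given the Poisson number n of points, the independent points contribute the n-th power of ∫
exp(-f) dρ; the Poisson generating function sums these powers. -/
theorem lintegral_expNeg_empiricalMeasure (r : ℝ≥0) (ρ : Measure E) [IsProbabilityMeasure ρ]
    {f : E → ℝ≥0∞} (hf : Measurable f) :
    ∫⁻ p, expNeg (∫⁻ x, f x ∂(empiricalMeasure p))
      ∂((poissonMeasure r).prod (Measure.infinitePi fun _ : ℕ => ρ)) =
      expNeg (r * ∫⁻ x, (1 - expNeg (f x)) ∂ρ) := by
  have hm : Measurable fun p : ℕ × (ℕ → E) => expNeg (∫⁻ x, f x ∂(empiricalMeasure p)) :=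
    measurable_expNeg.comp ((Measure.measurable_lintegral hf).comp measurable_empiricalMeasure)
  have hfe : Measurable fun x => expNeg (f x) := measurable_expNeg.comp hf
  rw [lintegral_prod _ hm.aemeasurable]
  have hle : ∫⁻ x, expNeg (f x) ∂ρ ≤ 1 :=
    (lintegral_mono fun x => expNeg_le_one (f x)).trans (by simp)
  have inner : ∀ n : ℕ, ∫⁻ y : ℕ → E, expNeg (∫⁻ x, f x ∂(empiricalMeasure (n, y)))
      ∂(Measure.infinitePi fun _ : ℕ => ρ) = (∫⁻ x, expNeg (f x) ∂ρ) ^ n := by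
    intro n
    have e : ∀ y : ℕ → E, expNeg (∫⁻ x, f x ∂(empiricalMeasure (n, y))) =
        ∏ i ∈ Finset.range n, expNeg (f (y i)) := fun y => by
      rw [← expNeg_sum, empiricalMeasure, lintegral_finsetSum_measure]
      simp [lintegral_dirac' _ hf]
    simp_rw [e]
    rw [lintegral_prod_eq_prod_lintegral_of_indepFun (Finset.range n)
      (fun i (y : ℕ → E) => expNeg (f (y i)))
      (iIndepFun_infinitePi (X := fun _ x => expNeg (f x)) fun _ => hfe)
      (fun i => hfe.comp (measurable_pi_apply i))]
    have : ∀ i : ℕ, ∫⁻ y : ℕ → E, expNeg (f (y i)) ∂(Measure.infinitePi fun _ : ℕ => ρ) =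
        ∫⁻ x, expNeg (f x) ∂ρ := fun i => by
      rw [← lintegral_map hfe (measurable_pi_apply i)]
      congr 1
      exact Measure.infinitePi_map_eval (fun _ : ℕ => ρ) i
    simp [this]
  simp_rw [inner]
  rw [lintegral_pow_poissonMeasure r hle, mul_comm, lintegral_sub hfe (hle.trans_lt ENNReal.one_lt_top).ne
    (ae_of_all _ fun x => expNeg_le_one _)]
  simp

/-- Existence of Poisson random measures. -/
theorem exists_isPoissonRandomMeasure {E : Type} [MeasurableSpace E] [Nonempty E] (ν : Measure E)
    [SFinite ν] : ∃ (Ω : Type) (_ : MeasurableSpace Ω) (P : Measure Ω) (_ : IsProbabilityMeasure P)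
      (N : Ω → Measure E), IsPoissonRandomMeasure P N ν := by
  -- An s-finite intensity is a countable sum of finite ones, and independent Poisson measures with
  -- finite intensities are superposed.
  choose ρ hρ hνρ using fun j => exists_isProbabilityMeasure_smul_eq (sfiniteSeq ν j)
  let r : ℕ → ℝ≥0 := fun j => (sfiniteSeq ν j univ).toNNReal
  have hr : ∀ j, (r j : ℝ≥0∞) • ρ j = sfiniteSeq ν j := fun j => by
    rw [ENNReal.coe_toNNReal (measure_ne_top _ _), ← hνρ j]
  let Q : ℕ → Measure (ℕ × (ℕ → E)) := fun j =>
    (poissonMeasure (r j)).prod (Measure.infinitePi fun _ : ℕ => ρ j)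
  let N : (ℕ → ℕ × (ℕ → E)) → Measure E := fun ω => Measure.sum fun j => empiricalMeasure (ω j)
  have hN : Measurable N := by
    refine Measure.measurable_of_measurable_coe _ fun A hA => ?_
    simp only [N, Measure.sum_apply _ hA]
    exact Measurable.tsum fun j =>
      (Measure.measurable_coe hA).comp (measurable_empiricalMeasure.comp (measurable_pi_apply j))
  refine ⟨_, inferInstance, Measure.infinitePi Q, inferInstance, N,
    IsPoissonRandomMeasure.of_laplace hN fun f hf => ?_⟩
  let g : ℕ × (ℕ → E) → ℝ≥0∞ := fun p => ∫⁻ x, f x ∂(empiricalMeasure p)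
  have hg : Measurable g := (Measure.measurable_lintegral hf).comp measurable_empiricalMeasure
  let a : ℕ → ℝ≥0∞ := fun j => ∫⁻ x, (1 - expNeg (f x)) ∂(sfiniteSeq ν j)
  have hsum : ∫⁻ x, (1 - expNeg (f x)) ∂ν = ∑' j, a j := by
    rw [← lintegral_sum_measure, sum_sfiniteSeq]
  have fin : ∀ n, ∫⁻ ω, expNeg (∑ j ∈ Finset.range n, g (ω j)) ∂(Measure.infinitePi Q) =
      expNeg (∑ j ∈ Finset.range n, a j) := by
    intro n
    simp_rw [expNeg_sum]
    rw [lintegral_prod_eq_prod_lintegral_of_indepFun (Finset.range n)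
      (fun j (ω : ℕ → ℕ × (ℕ → E)) => expNeg (g (ω j)))
      (iIndepFun_infinitePi (X := fun _ p => expNeg (g p)) fun _ => measurable_expNeg.comp hg)
      (fun i => (measurable_expNeg.comp hg).comp (measurable_pi_apply i))]
    refine Finset.prod_congr rfl fun j _ => ?_
    rw [← lintegral_map (f := fun p => expNeg (g p)) (measurable_expNeg.comp hg)
      (measurable_pi_apply j), Measure.infinitePi_map_eval Q j,
      lintegral_expNeg_empiricalMeasure (r j) (ρ j) hf]
    simp only [a]
    rw [← hr j, lintegral_smul_measure, smul_eq_mul]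
  have lim1 : Tendsto (fun n => ∫⁻ ω, expNeg (∑ j ∈ Finset.range n, g (ω j))
      ∂(Measure.infinitePi Q)) atTop (𝓝 (∫⁻ ω, expNeg (∫⁻ x, f x ∂(N ω)) ∂(Measure.infinitePi Q))) := by
    refine tendsto_lintegral_of_dominated_convergence (fun _ => 1)
      (fun n => measurable_expNeg.comp (Finset.measurable_sum _ fun j _ =>
        hg.comp (measurable_pi_apply j)))
      (fun n => ae_of_all _ fun ω => expNeg_le_one _) (by simp) (ae_of_all _ fun ω => ?_)
    refine (continuous_expNeg.tendsto _).comp ?_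
    simp only [N, lintegral_sum_measure]
    exact ENNReal.tendsto_nat_tsum _
  have lim2 : Tendsto (fun n => expNeg (∑ j ∈ Finset.range n, a j)) atTop
      (𝓝 (expNeg (∫⁻ x, (1 - expNeg (f x)) ∂ν))) := by
    rw [hsum]
    exact (continuous_expNeg.tendsto _).comp (ENNReal.tendsto_nat_tsum _)
  simp_rw [fin] at lim1
  exact tendsto_nhds_unique lim1 lim2

theorem IsPoissonRandomMeasure.map {E' : Type*} [MeasurableSpace E']
    (hN : IsPoissonRandomMeasure P N ν) {g : E → E'} (hg : Measurable g) :
    IsPoissonRandomMeasure P (fun ω => (N ω).map g) (ν.map g) where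
  measurable := (Measure.measurable_map g hg).comp hN.measurable
  law A hA hfin := by
    rw [Measure.map_apply hg hA] at hfin ⊢
    simp_rw [Measure.map_apply hg hA]
    exact hN.law _ (hg hA) hfin
  indep n A hA hd := by
    simp_rw [Measure.map_apply hg (hA _)]
    exact hN.indep n _ (fun i => hg (hA i)) fun i j hij => (hd hij).preimage g

end PoissonConstruction

/-! ### The simple Markov property in terms of moments -/

section MarkovPair

/-- The indicator of the event `τ > r`. -/
noncomputable def alive {Ω : Type*} (τ : Ω → ℝ≥0∞) (r : ℝ≥0) (ω : Ω) : ℝ :=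
  {ω | (r : ℝ≥0∞) < τ ω}.indicator (fun _ => 1) ω

theorem alive_mem_Icc {Ω : Type*} (τ : Ω → ℝ≥0∞) (r : ℝ≥0) (ω : Ω) :
    alive τ r ω ∈ Icc (0 : ℝ) 1 := by
  unfold alive
  by_cases h : ω ∈ {ω | (r : ℝ≥0∞) < τ ω} <;> simp [h]

theorem alive_of_lt {Ω : Type*} {τ : Ω → ℝ≥0∞} {r : ℝ≥0} {ω : Ω} (h : (r : ℝ≥0∞) < τ ω) :
    alive τ r ω = 1 := indicator_of_mem (s := {ω | (r : ℝ≥0∞) < τ ω}) h _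

theorem alive_of_le {Ω : Type*} {τ : Ω → ℝ≥0∞} {r : ℝ≥0} {ω : Ω} (h : τ ω ≤ (r : ℝ≥0∞)) :
    alive τ r ω = 0 := indicator_of_notMem (s := {ω | (r : ℝ≥0∞) < τ ω}) (not_lt.mpr h) _

theorem measurable_alive {Ω : Type*} [MeasurableSpace Ω] {τ : Ω → ℝ≥0∞} (hτ : Measurable τ)
    (r : ℝ≥0) : Measurable (alive τ r) :=
  measurable_const.indicator (measurableSet_lt measurable_const hτ)

/-- The simple Markov property, at the level of mixed moments, of a multiplicative process `M`
with stationary independent increments together with a time `τ` with the lack of memory. -/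
structure IsMarkovPair {Ω : Type*} [MeasurableSpace Ω] (μ : Measure Ω) (M : ℝ≥0 → Ω → ℝ)
    (τ : Ω → ℝ≥0∞) : Prop where
  before : ∀ (t r : ℝ≥0) (k l : List ℝ≥0), (∀ s ∈ k, s ≤ t) →
    ∫ ω, (k.map fun s => M s ω).prod * (l.map (future M t ω)).prod * alive τ (t + r) ω ∂μ =
      (∫ ω, (k.map fun s => M s ω).prod * alive τ t ω ∂μ) *
        ∫ ω, (l.map fun s => M s ω).prod * alive τ r ω ∂μ
  -- With r ≤ t the indicator belongs to the past, and the future is that of the process alone,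
  -- without the time.
  after : ∀ (t r : ℝ≥0) (k l : List ℝ≥0), r ≤ t → (∀ s ∈ k, s ≤ t) →
    ∫ ω, (k.map fun s => M s ω).prod * (l.map (future M t ω)).prod * alive τ r ω ∂μ =
      (∫ ω, (k.map fun s => M s ω).prod * alive τ r ω ∂μ) *
        ∫ ω, (l.map fun s => M s ω).prod ∂μ

end MarkovPair

/-! ### σ-finiteness and integrals for splitting measures and their marked versions -/

section Intensity

/-- The level sets f ≥ 1/(n+1) have finite measure by Markov's inequality and exhaust the space. The
weight will be essentially 1-u, since a splitting measure may have infinite mass near 1. -/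
theorem sigmaFinite_of_lintegral_lt_top {α : Type*} [MeasurableSpace α] {ν : Measure α}
    {f : α → ℝ≥0∞} (hf : Measurable f) (hpos : ∀ x, 0 < f x) (hfin : ∫⁻ x, f x ∂ν < ∞) :
    SigmaFinite ν := by
  refine ⟨⟨⟨fun n => {x | ((n : ℝ≥0∞) + 1)⁻¹ ≤ f x}, fun n => trivial, fun n => ?_, ?_⟩⟩⟩
  · exact (meas_ge_le_lintegral_div hf.aemeasurable (by simp) (by simp)).trans_lt
      (ENNReal.div_lt_top hfin.ne (by simp))
  · refine eq_univ_of_forall fun x => mem_iUnion.mpr ?_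
    obtain ⟨n, hn⟩ := ENNReal.exists_inv_nat_lt (hpos x).ne'
    exact ⟨n, (ENNReal.inv_le_inv.mpr le_self_add).trans hn.le⟩

variable {Λ : Measure ℝ} {p : ℝ → ℝ}

/-- A positive weight with respect to which a splitting measure is finite. -/
noncomputable def splittingWeight (u : ℝ) : ℝ≥0∞ := if u < 1 then ENNReal.ofReal (1 - u) else 1

theorem measurable_splittingWeight : Measurable splittingWeight := by
  unfold splittingWeight
  exact Measurable.ite measurableSet_Iio (by fun_prop) measurable_const

theorem splittingWeight_pos (u : ℝ) : 0 < splittingWeight u := by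
  unfold splittingWeight
  split_ifs with h
  · simpa using h
  · simp

theorem IsSplittingMeasure.ae_mem (hΛ : IsSplittingMeasure Λ) : ∀ᵐ u ∂Λ, u ∈ Ioo (0 : ℝ) 1 :=
  hΛ.support

theorem IsSplittingMeasure.lintegral_splittingWeight (hΛ : IsSplittingMeasure Λ) :
    ∫⁻ u, splittingWeight u ∂Λ < ∞ := by
  refine lt_of_eq_of_lt (lintegral_congr_ae ?_) hΛ.integrable
  filter_upwards [hΛ.ae_mem] with u hu
  simp [splittingWeight, hu.2]

theorem IsSplittingMeasure.sigmaFinite (hΛ : IsSplittingMeasure Λ) : SigmaFinite Λ :=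
  sigmaFinite_of_lintegral_lt_top measurable_splittingWeight splittingWeight_pos
    hΛ.lintegral_splittingWeight

theorem lintegral_markedMeasure {f : ℝ × Bool → ℝ≥0∞} (hf : Measurable f) :
    ∫⁻ x, f x ∂(markedMeasure Λ p) =
      ∫⁻ u, f (u, true) ∂(Λ.withDensity fun u => ENNReal.ofReal (p u)) +
        ∫⁻ u, f (u, false) ∂(Λ.withDensity fun u => ENNReal.ofReal (1 - p u)) := by
  rw [markedMeasure, lintegral_add_measure, lintegral_map hf (by fun_prop),
    lintegral_map hf (by fun_prop)]

theorem withDensity_add_withDensity (hp : Measurable p) (hp01 : ∀ u, p u ∈ Icc (0 : ℝ) 1) :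
    (Λ.withDensity fun u => ENNReal.ofReal (p u)) +
      (Λ.withDensity fun u => ENNReal.ofReal (1 - p u)) = Λ := by
  rw [← withDensity_add_left (by fun_prop)]
  convert withDensity_one using 2
  funext u
  simp only [Pi.add_apply, Pi.one_apply]
  rw [← ENNReal.ofReal_add (hp01 u).1 (by linarith [(hp01 u).2])]
  simp

theorem lintegral_markedMeasure_fst (hp : Measurable p) (hp01 : ∀ u, p u ∈ Icc (0 : ℝ) 1)
    {f : ℝ → ℝ≥0∞} (hf : Measurable f) :
    ∫⁻ x, f x.1 ∂(markedMeasure Λ p) = ∫⁻ u, f u ∂Λ := by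
  rw [lintegral_markedMeasure (f := fun x => f x.1) (by fun_prop), ← lintegral_add_measure,
    withDensity_add_withDensity hp hp01]

theorem map_fst_markedMeasure (hp : Measurable p) (hp01 : ∀ u, p u ∈ Icc (0 : ℝ) 1) :
    (markedMeasure Λ p).map Prod.fst = Λ := by
  ext A hA
  have := lintegral_markedMeasure_fst (Λ := Λ) hp hp01
    (f := A.indicator 1) (measurable_one.indicator hA)
  rw [lintegral_indicator_one hA] at this
  rw [Measure.map_apply measurable_fst hA, ← this, ← lintegral_indicator_one (measurable_fst hA)]
  rfl

theorem IsSplittingMeasure.sigmaFinite_markedMeasure (hΛ : IsSplittingMeasure Λ)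
    (hp : Measurable p) (hp01 : ∀ u, p u ∈ Icc (0 : ℝ) 1) : SigmaFinite (markedMeasure Λ p) := by
  refine sigmaFinite_of_lintegral_lt_top (f := fun x => splittingWeight x.1)
    (measurable_splittingWeight.comp measurable_fst) (fun x => splittingWeight_pos _) ?_
  rw [lintegral_markedMeasure_fst hp hp01 measurable_splittingWeight]
  exact hΛ.lintegral_splittingWeight

end Intensity

/-! ### Independence and stationarity of a Poisson measure over time strips -/

section Strips

variable {Ω F : Type*} [MeasurableSpace Ω] [MeasurableSpace F] {P : Measure Ω}

/-- The function `f`, started at time `t`. -/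
noncomputable def delay {F : Type*} (t : ℝ) (f : ℝ × F → ℝ≥0∞) (x : ℝ × F) : ℝ≥0∞ :=
  {x : ℝ × F | t < x.1}.indicator (fun x => f (x.1 - t, x.2)) x

theorem measurableSet_lt_fst (t : ℝ) : MeasurableSet {x : ℝ × F | t < x.1} :=
  measurableSet_lt measurable_const measurable_fst

theorem measurableSet_fst_le (t : ℝ) : MeasurableSet {x : ℝ × F | x.1 ≤ t} :=
  measurableSet_le measurable_fst measurable_const

theorem measurable_delay (t : ℝ) {f : ℝ × F → ℝ≥0∞} (hf : Measurable f) :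
    Measurable (delay t f) :=
  (hf.comp (by fun_prop)).indicator (measurableSet_lt_fst t)

theorem delay_add {F : Type*} (t : ℝ) (f g : ℝ × F → ℝ≥0∞) (x : ℝ × F) :
    delay t (fun x => f x + g x) x = delay t f x + delay t g x := by
  unfold delay
  by_cases h : t < x.1 <;> simp [h]

/-- Translation invariance of Lebesgue measure; t ≥ 0 keeps the translated support inside (0, ∞). -/
theorem lintegral_delay (Θ : Measure F) [SFinite Θ] {t : ℝ} (ht : 0 ≤ t) {f : ℝ × F → ℝ≥0∞}
    (hf : Measurable f) :
    ∫⁻ x, delay t f x ∂((volume.restrict (Ioi (0 : ℝ))).prod Θ) =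
      ∫⁻ x, f x ∂((volume.restrict (Ioi (0 : ℝ))).prod Θ) := by
  rw [lintegral_prod _ (measurable_delay t hf).aemeasurable, lintegral_prod _ hf.aemeasurable]
  let φ : ℝ → ℝ≥0∞ := fun s => (Ioi (0 : ℝ)).indicator (fun s => ∫⁻ y, f (s, y) ∂Θ) s
  have h1 : ∀ s, (Ioi (0 : ℝ)).indicator (fun s => ∫⁻ y, delay t f (s, y) ∂Θ) s = φ (s - t) := by
    intro s
    by_cases hs : t < s
    · have : 0 < s := ht.trans_lt hs
      simp [φ, delay, hs, this]
    · simp only [φ, delay]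
      simp [hs, indicator_apply]
  rw [← lintegral_indicator measurableSet_Ioi, ← lintegral_indicator measurableSet_Ioi]
  simp_rw [h1]
  exact lintegral_sub_right_eq_self φ t

/-- At each point at most one of the two functions is nonzero, so 1 - exp(-·) is additive on them
and the exponents of the Laplace functional add up. This is the Markov property at time t. -/
theorem IsPoissonRandomMeasure.lintegral_expNeg_add_delay [IsProbabilityMeasure P] {Θ : Measure F}
    [SigmaFinite Θ] {N : Ω → Measure (ℝ × F)}
    (hN : IsPoissonRandomMeasure P N ((volume.restrict (Ioi (0 : ℝ))).prod Θ)) {t : ℝ} (ht : 0 ≤ t)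
    {f g : ℝ × F → ℝ≥0∞} (hf : Measurable f) (hg : Measurable g) (hft : ∀ x, t < x.1 → f x = 0) :
    ∫⁻ ω, expNeg (∫⁻ x, (f x + delay t g x) ∂(N ω)) ∂P =
      (∫⁻ ω, expNeg (∫⁻ x, f x ∂(N ω)) ∂P) * ∫⁻ ω, expNeg (∫⁻ x, g x ∂(N ω)) ∂P := by
  rw [hN.lintegral_expNeg (f := fun x => f x + delay t g x) (hf.add (measurable_delay t hg)), hN.lintegral_expNeg hf,
    hN.lintegral_expNeg hg, ← expNeg_add]
  congr 1
  rw [← lintegral_delay Θ ht (f := fun x => 1 - expNeg (g x))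
    (measurable_const.sub (measurable_expNeg.comp hg)),
    ← lintegral_add_left (f := fun x => 1 - expNeg (f x))
      (measurable_const.sub (measurable_expNeg.comp hf))]
  refine lintegral_congr fun x => ?_
  by_cases hx : t < x.1
  · simp [hft x hx, delay, hx, expNeg_zero]
  · simp [delay, hx]

/-- The probability of finiteness is at least E exp(-c ∫ f dN) for every c > 0, and this tends to 1
as c tends to 0 by dominated convergence in the exponent. -/
theorem IsPoissonRandomMeasure.ae_lintegral_lt_top {E : Type*} [MeasurableSpace E]
    [IsProbabilityMeasure P] {ν : Measure E} [SigmaFinite ν] {N : Ω → Measure E}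
    (hN : IsPoissonRandomMeasure P N ν) {f : E → ℝ≥0∞} (hf : Measurable f)
    (hfin : ∀ x, f x ≠ ∞) (h_int : ∫⁻ x, (1 - expNeg (f x)) ∂ν ≠ ∞) :
    ∀ᵐ ω ∂P, ∫⁻ x, f x ∂(N ω) ≠ ∞ := by
  let c : ℕ → ℝ≥0∞ := fun n => ((n : ℝ≥0∞) + 1)⁻¹
  have hc0 : ∀ n, c n ≠ 0 := fun n => by simp [c]
  have hc1 : ∀ n, c n ≤ 1 := fun n => by simp [c]
  have hct : Tendsto c atTop (𝓝 0) := by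
    have := (tendsto_add_atTop_iff_nat 1).mpr ENNReal.tendsto_inv_nat_nhds_zero
    simpa [c] using this
  have hmeas : Measurable fun ω => ∫⁻ x, f x ∂(N ω) :=
    (Measure.measurable_lintegral hf).comp hN.measurable
  have hset : MeasurableSet {ω | ∫⁻ x, f x ∂(N ω) ≠ ∞} :=
    (hmeas (measurableSet_singleton ∞)).compl
  have hle : ∀ n, expNeg (∫⁻ x, (1 - expNeg (c n * f x)) ∂ν) ≤
      P {ω | ∫⁻ x, f x ∂(N ω) ≠ ∞} := by
    intro n
    rw [← hN.lintegral_expNeg (hf.const_mul (c n)), ← lintegral_indicator_one hset]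
    refine lintegral_mono fun ω => ?_
    rw [lintegral_const_mul _ hf]
    by_cases h : ∫⁻ x, f x ∂(N ω) = ∞
    · simp [h, ENNReal.mul_top (hc0 n), expNeg_top]
    · have : ω ∈ {ω | ∫⁻ x, f x ∂(N ω) ≠ ∞} := h
      simp only [indicator_of_mem this, Pi.one_apply]
      exact expNeg_le_one _
  have hlim : Tendsto (fun n => expNeg (∫⁻ x, (1 - expNeg (c n * f x)) ∂ν)) atTop (𝓝 1) := by
    suffices h : Tendsto (fun n => ∫⁻ x, (1 - expNeg (c n * f x)) ∂ν) atTop (𝓝 0) by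
      simpa [expNeg_zero, Function.comp_def] using (continuous_expNeg.tendsto _).comp h
    have := tendsto_lintegral_of_dominated_convergence (μ := ν)
      (F := fun n x => 1 - expNeg (c n * f x)) (f := fun _ => 0) (fun x => 1 - expNeg (f x))
      (fun n => measurable_const.sub (measurable_expNeg.comp (hf.const_mul (c n))))
      (fun n => ae_of_all _ fun x => tsub_le_tsub_left
        (expNeg_antitone (mul_le_of_le_one_left' (hc1 n))) _) h_int
      (ae_of_all _ fun x => ?_)
    · simpa using this
    · have h1 : Tendsto (fun n => c n * f x) atTop (𝓝 (0 * f x)) :=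
        ENNReal.Tendsto.mul_const hct (Or.inr (hfin x))
      have h2 := ENNReal.Tendsto.sub (tendsto_const_nhds (x := (1 : ℝ≥0∞)))
        ((continuous_expNeg.tendsto _).comp h1) (Or.inl ENNReal.one_ne_top)
      simpa [expNeg_zero] using h2
  have h1 : P {ω | ∫⁻ x, f x ∂(N ω) ≠ ∞} = 1 :=
    le_antisymm prob_le_one (le_of_tendsto' hlim hle)
  exact (mem_ae_iff_prob_eq_one hset).mpr h1

/-- The Laplace functional is evaluated at the function equal to ∞ on `A` and 0 elsewhere; this also
covers sets of infinite intensity. -/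
theorem IsPoissonRandomMeasure.measure_eval_eq_zero {E : Type*} [MeasurableSpace E]
    [IsProbabilityMeasure P] {ν : Measure E} [SigmaFinite ν] {N : Ω → Measure E}
    (hN : IsPoissonRandomMeasure P N ν) {A : Set E} (hA : MeasurableSet A) :
    P {ω | N ω A = 0} = expNeg (ν A) := by
  have h := hN.lintegral_expNeg (f := A.indicator fun _ => ∞) (measurable_const.indicator hA)
  have e : ∀ x, 1 - expNeg (A.indicator (fun _ => ∞) x) = A.indicator 1 x := fun x => by
    by_cases hx : x ∈ A <;> simp [hx, expNeg_top, expNeg_zero]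
  simp_rw [e] at h
  rw [lintegral_indicator_one hA] at h
  rw [← h, ← lintegral_indicator_one (measurableSet_eq_fun (hN.measurable_eval hA)
    measurable_const)]
  refine lintegral_congr fun ω => ?_
  rw [lintegral_indicator_const hA]
  by_cases hω : N ω A = 0
  · simp [hω, expNeg_zero]
  · simp [hω, ENNReal.top_mul hω, expNeg_top]

end Strips

/-! ### The Poisson fragmenter and its first switching time: Markov property and exponents -/

section PoissonFragmenter

/-- The contribution `-log u` of a point `(s, u, m)`. -/
noncomputable def logSize (y : ℝ × Bool) : ℝ≥0∞ := ENNReal.ofReal (-Real.log y.1)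

theorem measurable_logSize : Measurable logSize := by unfold logSize; fun_prop

theorem logSize_ne_top (y : ℝ × Bool) : logSize y ≠ ∞ := ENNReal.ofReal_ne_top

/-- The contribution to `-log M_t` of a point. -/
noncomputable def logSizeUpTo (t : ℝ≥0) (x : ℝ × ℝ × Bool) : ℝ≥0∞ :=
  {x : ℝ × ℝ × Bool | x.1 ≤ t}.indicator (fun x => logSize x.2) x

/-- The function which is infinite at marked points up to time `r`. -/
noncomputable def markUpTo (r : ℝ≥0) (x : ℝ × ℝ × Bool) : ℝ≥0∞ :=
  {x : ℝ × ℝ × Bool | x.1 ≤ r ∧ x.2.2 = true}.indicator (fun _ => ∞) x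

theorem measurable_logSizeUpTo (t : ℝ≥0) : Measurable (logSizeUpTo t) :=
  (measurable_logSize.comp measurable_snd).indicator (measurableSet_fst_le _)

theorem measurableSet_marked (r : ℝ≥0) :
    MeasurableSet {x : ℝ × ℝ × Bool | x.1 ≤ r ∧ x.2.2 = true} :=
  (measurableSet_fst_le _).inter
    (measurableSet_eq_fun (measurable_snd.comp measurable_snd) measurable_const)

theorem measurable_markUpTo (r : ℝ≥0) : Measurable (markUpTo r) :=
  measurable_const.indicator (measurableSet_marked r)

theorem delay_logSizeUpTo (t v : ℝ≥0) (x : ℝ × ℝ × Bool) :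
    logSizeUpTo t x + delay t (logSizeUpTo v) x = logSizeUpTo (t + v) x := by
  unfold delay logSizeUpTo
  have hv : (0 : ℝ) ≤ v := v.2
  by_cases h1 : x.1 ≤ t
  · have h2 : x.1 ≤ t + v := by linarith
    simp [h1, h2]
  · by_cases h2 : x.1 ≤ t + v
    · have h3 : x.1 ≤ v + t := by linarith
      simp [h1, h2, h3, not_le.mp h1]
    · have h3 : ¬ x.1 ≤ v + t := by linarith
      simp [h1, h2, h3]

theorem delay_markUpTo (t r : ℝ≥0) (x : ℝ × ℝ × Bool) :
    markUpTo t x + delay t (markUpTo r) x = markUpTo (t + r) x := by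
  unfold delay markUpTo
  have hv : (0 : ℝ) ≤ r := r.2
  by_cases hm : x.2.2 = true
  · by_cases h1 : x.1 ≤ t
    · have h2 : x.1 ≤ t + r := by linarith
      simp [h1, h2, hm]
    · by_cases h2 : x.1 ≤ t + r
      · have h3 : x.1 ≤ r + t := by linarith
        simp [h1, h2, h3, not_le.mp h1, hm]
      · have h3 : ¬ x.1 ≤ r + t := by linarith
        simp [h1, h2, h3, hm]
  · simp [hm, indicator_apply]

/-- The total contribution of a point to `-log (∏ M_s)`, `s` running through the list `k`. -/
noncomputable def logSizeList (k : List ℝ≥0) (x : ℝ × ℝ × Bool) : ℝ≥0∞ :=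
  (k.map fun s => logSizeUpTo s x).sum

theorem logSizeList_cons (a : ℝ≥0) (k : List ℝ≥0) (x : ℝ × ℝ × Bool) :
    logSizeList (a :: k) x = logSizeUpTo a x + logSizeList k x := by
  simp [logSizeList]

theorem logSizeList_replicate (k : ℕ) (t : ℝ≥0) (x : ℝ × ℝ × Bool) :
    logSizeList (List.replicate k t) x =
      {x : ℝ × ℝ × Bool | x.1 ≤ t}.indicator (fun x => k * logSize x.2) x := by
  unfold logSizeList logSizeUpTo
  by_cases hx : x.1 ≤ t <;> simp [hx]

theorem measurable_logSizeList (k : List ℝ≥0) : Measurable (logSizeList k) := by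
  induction k with
  | nil => exact measurable_const
  | cons a k ih =>
    have : logSizeList (a :: k) = fun x => logSizeUpTo a x + logSizeList k x :=
      funext (logSizeList_cons a k)
    rw [this]
    exact (measurable_logSizeUpTo a).add ih

theorem factorProduct_factors (N : Measure (ℝ × ℝ × Bool)) (t : ℝ≥0) :
    factorProduct (factors N) t = Real.exp (-(∫⁻ x, logSizeUpTo t x ∂N).toReal) := by
  unfold factorProduct factors logSizeUpTo
  rw [setLIntegral_map (measurableSet_fst_le _) (by fun_prop) (by fun_prop),
    lintegral_indicator (measurableSet_fst_le _)]
  rfl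

section Pathwise

variable {N : Measure (ℝ × ℝ × Bool)} (hfin : ∀ t, ∫⁻ x, logSizeUpTo t x ∂N ≠ ∞)
include hfin

/-- Finiteness matters because `factorProduct` reads an infinite exponent as 0 through `toReal`,
whereas `expNeg` sends it to 0. -/
theorem prod_factorProduct_factors (k : List ℝ≥0) :
    (k.map fun s => factorProduct (factors N) s).prod =
      (expNeg (∫⁻ x, logSizeList k x ∂N)).toReal := by
  induction k with
  | nil => simp [logSizeList, expNeg_zero]
  | cons a k ih =>
    simp_rw [logSizeList_cons]
    rw [lintegral_add_left (measurable_logSizeUpTo a), expNeg_add, ENNReal.toReal_mul, ← ih,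
      toReal_expNeg_of_ne_top (hfin a), ← factorProduct_factors]
    simp

/-- The ratio of the products at t+v and t is carried by the points in the strip (t, t+v], that is,
by the functional delayed by t. -/
theorem prod_factorProduct_factors_div (t : ℝ≥0) (l : List ℝ≥0) :
    (l.map fun v => factorProduct (factors N) (t + v) / factorProduct (factors N) t).prod =
      (expNeg (∫⁻ x, delay t (logSizeList l) x ∂N)).toReal := by
  induction l with
  | nil =>
    have : ∀ x, delay (t : ℝ) (logSizeList []) x = 0 := fun x => by
      simp [delay, logSizeList]
    simp [this, expNeg_zero]
  | cons a k ih =>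
    have e : ∀ x, delay (t : ℝ) (logSizeList (a :: k)) x =
        delay t (logSizeUpTo a) x + delay t (logSizeList k) x := fun x => by
      rw [← delay_add]; congr 1
    have h1 : ∫⁻ x, logSizeUpTo (t + a) x ∂N =
        ∫⁻ x, logSizeUpTo t x ∂N + ∫⁻ x, delay t (logSizeUpTo a) x ∂N := by
      rw [← lintegral_add_left (measurable_logSizeUpTo t)]
      exact lintegral_congr fun x => (delay_logSizeUpTo t a x).symm
    have h2 : ∫⁻ x, delay t (logSizeUpTo a) x ∂N ≠ ∞ := by
      have := hfin (t + a)
      rw [h1] at this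
      exact (ENNReal.add_ne_top.mp this).2
    simp_rw [e]
    rw [lintegral_add_left (measurable_delay _ (measurable_logSizeUpTo a)), expNeg_add,
      ENNReal.toReal_mul, ← ih, toReal_expNeg_of_ne_top h2, List.map_cons, List.prod_cons,
      factorProduct_factors, factorProduct_factors, ← Real.exp_sub, h1,
      ENNReal.toReal_add (hfin t) h2]
    congr 2
    ring

end Pathwise

variable {Ω : Type*} [MeasurableSpace Ω] {P : Measure Ω} [IsProbabilityMeasure P]
  {N : Ω → Measure (ℝ × ℝ × Bool)} {Λ : Measure ℝ} {p : ℝ → ℝ}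

theorem lintegral_indicator_fst_le {F : Type*} [MeasurableSpace F] (Θ : Measure F) [SFinite Θ]
    (t : ℝ≥0) {f : F → ℝ≥0∞} (hf : Measurable f) :
    ∫⁻ x, {x : ℝ × F | x.1 ≤ t}.indicator (fun x => f x.2) x
      ∂((volume.restrict (Ioi (0 : ℝ))).prod Θ) = t * ∫⁻ y, f y ∂Θ := by
  have hm : Measurable fun x : ℝ × F => {x : ℝ × F | x.1 ≤ t}.indicator (fun x => f x.2) x :=
    (hf.comp measurable_snd).indicator (measurableSet_fst_le _)
  rw [lintegral_prod _ hm.aemeasurable]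
  have e : ∀ s : ℝ, ∫⁻ y, {x : ℝ × F | x.1 ≤ t}.indicator (fun x => f x.2) (s, y) ∂Θ =
      (Iic (t : ℝ)).indicator (fun _ => ∫⁻ y, f y ∂Θ) s := fun s => by
    by_cases hs : s ≤ t <;> simp [hs]
  simp_rw [e]
  rw [lintegral_indicator measurableSet_Iic, setLIntegral_const,
    Measure.restrict_apply measurableSet_Iic, mul_comm]
  congr 1
  rw [inter_comm, Ioi_inter_Iic, Real.volume_Ioc]
  simp

theorem expNeg_nat_mul_logSize {y : ℝ × Bool} (hy : y.1 ∈ Ioo (0 : ℝ) 1) (k : ℕ) :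
    1 - expNeg (k * logSize y) = ENNReal.ofReal (1 - y.1 ^ k) := by
  have h0 : 0 ≤ -Real.log y.1 := by
    have := Real.log_nonpos hy.1.le hy.2.le
    linarith
  rw [expNeg_nat_mul, expNeg_of_ne_top (logSize_ne_top y), logSize, ENNReal.toReal_ofReal h0,
    neg_neg, Real.exp_log hy.1, ← ENNReal.ofReal_pow hy.1.le, ← ENNReal.ofReal_one,
    ENNReal.ofReal_sub _ (pow_nonneg hy.1.le k)]

theorem ae_mem_markedMeasure (hΛ : IsSplittingMeasure Λ) (hp : Measurable p)
    (hp01 : ∀ u, p u ∈ Icc (0 : ℝ) 1) : ∀ᵐ y ∂(markedMeasure Λ p), y.1 ∈ Ioo (0 : ℝ) 1 := by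
  have h : ∀ᵐ u ∂((markedMeasure Λ p).map Prod.fst), u ∈ Ioo (0 : ℝ) 1 := by
    rw [map_fst_markedMeasure hp hp01]; exact hΛ.ae_mem
  exact (ae_map_iff measurable_fst.aemeasurable measurableSet_Ioo).mp h

theorem lintegral_logSize_markedMeasure (hΛ : IsSplittingMeasure Λ) (hp : Measurable p)
    (hp01 : ∀ u, p u ∈ Icc (0 : ℝ) 1) (k : ℕ) :
    ∫⁻ y, (1 - expNeg (k * logSize y)) ∂(markedMeasure Λ p) =
      ∫⁻ u, ENNReal.ofReal (1 - u ^ k) ∂Λ := by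
  rw [← lintegral_markedMeasure_fst hp hp01 (by fun_prop)]
  refine lintegral_congr_ae ?_
  filter_upwards [ae_mem_markedMeasure hΛ hp hp01] with y hy
  exact expNeg_nat_mul_logSize hy k

theorem IsSplittingMeasure.lintegral_one_sub_pow_lt_top (hΛ : IsSplittingMeasure Λ) (k : ℕ) :
    ∫⁻ u, ENNReal.ofReal (1 - u ^ k) ∂Λ < ∞ := by
  refine lt_of_le_of_lt (b := ∫⁻ u, k * ENNReal.ofReal (1 - u) ∂Λ) (lintegral_mono_ae ?_) ?_
  · filter_upwards [hΛ.ae_mem] with u hu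
    rw [← ENNReal.ofReal_natCast, ← ENNReal.ofReal_mul (by positivity)]
    refine ENNReal.ofReal_le_ofReal ?_
    have := one_add_mul_le_pow (a := u - 1) (by linarith [hu.1]) k
    simp only [add_sub_cancel] at this
    linarith
  · rw [lintegral_const_mul _ (by fun_prop)]
    exact ENNReal.mul_lt_top (by simp) hΛ.integrable

section

variable (hΛ : IsSplittingMeasure Λ) (hp : Measurable p) (hp01 : ∀ u, p u ∈ Icc (0 : ℝ) 1)
  (hN : IsPoissonRandomMeasure P N ((volume.restrict (Ioi (0 : ℝ))).prod (markedMeasure Λ p)))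

include hΛ hp hp01 hN

/-- Integer times give countably many almost sure statements, and monotonicity in t covers the rest.
The intensity condition is exactly ∫ (1-u) dΛ < ∞. -/
theorem ae_logSizeUpTo_ne_top :
    ∀ᵐ ω ∂P, ∀ t, ∫⁻ x, logSizeUpTo t x ∂(N ω) ≠ ∞ := by
  have := hΛ.sigmaFinite_markedMeasure hp hp01
  have h1 : ∀ᵐ ω ∂P, ∀ n : ℕ, ∫⁻ x, logSizeUpTo n x ∂(N ω) ≠ ∞ := by
    refine ae_all_iff.mpr fun n => hN.ae_lintegral_lt_top (measurable_logSizeUpTo n)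
      (fun x => ?_) ?_
    · unfold logSizeUpTo
      by_cases hx : x ∈ {x : ℝ × ℝ × Bool | x.1 ≤ (n : ℝ≥0)}
      · rw [indicator_of_mem hx]; exact logSize_ne_top _
      · rw [indicator_of_notMem hx]; simp
    · have e : ∀ x, 1 - expNeg (logSizeUpTo n x) =
          {x : ℝ × ℝ × Bool | x.1 ≤ (n : ℝ≥0)}.indicator
            (fun x => 1 - expNeg ((1 : ℕ) * logSize x.2)) x := fun x => by
        unfold logSizeUpTo
        by_cases hx : x ∈ {x : ℝ × ℝ × Bool | x.1 ≤ (n : ℝ≥0)}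
        · rw [indicator_of_mem hx, indicator_of_mem hx]; simp
        · rw [indicator_of_notMem hx, indicator_of_notMem hx]; simp [expNeg_zero]
      simp_rw [e]
      rw [lintegral_indicator_fst_le _ _ (f := fun y => 1 - expNeg ((1 : ℕ) * logSize y))
        (measurable_const.sub (measurable_expNeg.comp (measurable_logSize.const_mul _))),
        lintegral_logSize_markedMeasure hΛ hp hp01]
      exact ENNReal.mul_ne_top (by simp) (hΛ.lintegral_one_sub_pow_lt_top 1).ne
  filter_upwards [h1] with ω hω t
  obtain ⟨n, hn⟩ := exists_nat_ge t
  refine ne_top_of_le_ne_top (hω n) (lintegral_mono fun x => ?_)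
  refine indicator_le_indicator_of_subset (fun x hx => ?_) (fun _ => zero_le) x
  exact le_trans (show x.1 ≤ (t : ℝ) from hx) (by exact_mod_cast hn)

/-- An infinite weight on marked points turns exp(-∫) into the indicator that there is no mark up to
r. This differs from the indicator of `firstSwitch` > r only if marks accumulate at r from the
right. That is a null event, as the strips (r, r + 1/(n+1)] carry marked intensity at most ∫ p
dΛ/(n+1). -/
theorem ae_alive_firstSwitch (hpfin : ∫⁻ u, ENNReal.ofReal (p u) ∂Λ < ∞) (r : ℝ≥0) :
    ∀ᵐ ω ∂P, alive (fun ω => firstSwitch (N ω)) r ω =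
      (expNeg (∫⁻ x, markUpTo r x ∂(N ω))).toReal := by
  have := hΛ.sigmaFinite_markedMeasure hp hp01
  let c : ℕ → ℝ≥0 := fun n => ((n : ℝ≥0) + 1)⁻¹
  let A : ℕ → Set (ℝ × ℝ × Bool) := fun n => {x | (r : ℝ) < x.1 ∧ x.1 ≤ (r + c n : ℝ≥0) ∧ x.2.2 = true}
  have hA : ∀ n, MeasurableSet (A n) := fun n =>
    (measurableSet_lt_fst _).inter (measurableSet_marked (r + c n))
  let lam : ℝ≥0∞ := ∫⁻ u, ENNReal.ofReal (p u) ∂Λ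
  have hνA : ∀ n, ((volume.restrict (Ioi (0 : ℝ))).prod (markedMeasure Λ p)) (A n) ≤
      c n * lam := by
    intro n
    have hs : A n ⊆ Ioc (r : ℝ) (r + c n : ℝ≥0) ×ˢ {y : ℝ × Bool | y.2 = true} := fun x hx =>
      ⟨⟨hx.1, hx.2.1⟩, hx.2.2⟩
    refine (measure_mono hs).trans ?_
    rw [Measure.prod_prod]
    gcongr
    · refine (Measure.restrict_apply_le _ _).trans ?_
      rw [Real.volume_Ioc]
      simp
    · have hm : MeasurableSet {y : ℝ × Bool | y.2 = true} :=
        measurableSet_eq_fun measurable_snd measurable_const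
      rw [← lintegral_indicator_one hm, lintegral_markedMeasure (measurable_one.indicator hm)]
      simp [lam]
  have hbad : P {ω | ∀ n, N ω (A n) ≠ 0} = 0 := by
    have hle : ∀ n, P {ω | ∀ n, N ω (A n) ≠ 0} ≤ 1 - expNeg (c n * lam) := by
      intro n
      have h1 : P {ω | N ω (A n) ≠ 0} = 1 - P {ω | N ω (A n) = 0} := by
        rw [← prob_compl_eq_one_sub (measurableSet_eq_fun (hN.measurable_eval (hA n))
          measurable_const)]
        rfl
      have hsub : {ω | ∀ n, N ω (A n) ≠ 0} ⊆ {ω | N ω (A n) ≠ 0} := fun ω hω => hω n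
      refine (measure_mono hsub).trans (h1.le.trans ?_)
      rw [hN.measure_eval_eq_zero (hA n)]
      exact tsub_le_tsub_left (expNeg_antitone (hνA n)) _
    have hc : Tendsto (fun n => (c n : ℝ≥0∞)) atTop (𝓝 0) := by
      have := (tendsto_add_atTop_iff_nat 1).mpr ENNReal.tendsto_inv_nat_nhds_zero
      refine this.congr fun n => ?_
      simp [c]
    have hl : Tendsto (fun n => 1 - expNeg (c n * lam)) atTop (𝓝 0) := by
      have h2 : Tendsto (fun n => c n * lam) atTop (𝓝 (0 * lam)) :=
        ENNReal.Tendsto.mul_const hc (Or.inr hpfin.ne)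
      have h3 := ENNReal.Tendsto.sub (tendsto_const_nhds (x := (1 : ℝ≥0∞)))
        ((continuous_expNeg.tendsto _).comp h2) (Or.inl ENNReal.one_ne_top)
      simpa [expNeg_zero, Function.comp_def] using h3
    exact le_antisymm (ge_of_tendsto' hl hle) (zero_le)
  have hae : ∀ᵐ ω ∂P, ∃ n, N ω (A n) = 0 := by
    rw [ae_iff]; simpa using hbad
  filter_upwards [hae] with ω ⟨n, hn⟩
  have h_int : ∫⁻ x, markUpTo r x ∂(N ω) = ∞ * N ω {x | x.1 ≤ r ∧ x.2.2 = true} := by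
    unfold markUpTo
    rw [lintegral_indicator_const (measurableSet_marked r)]
  rw [h_int]
  by_cases h0 : N ω {x | x.1 ≤ r ∧ x.2.2 = true} = 0
  · rw [h0, mul_zero, expNeg_zero, ENNReal.toReal_one]
    refine alive_of_lt ?_
    have hcpos : (0 : ℝ≥0) < c n := by positivity
    refine lt_of_lt_of_le (b := ((r + c n : ℝ≥0) : ℝ≥0∞)) ?_ ?_
    · exact_mod_cast lt_add_of_pos_right r hcpos
    · refine le_iInf₂ fun t ht => ?_
      by_contra hlt
      push Not at hlt
      have hlt' : t ≤ r + c n := by exact_mod_cast hlt.le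
      apply ht
      refine measure_mono_null (t := {x | x.1 ≤ r ∧ x.2.2 = true} ∪ A n) (fun x hx => ?_)
        (measure_union_null h0 hn)
      by_cases hxr : x.1 ≤ r
      · exact Or.inl ⟨hxr, hx.2⟩
      · exact Or.inr ⟨not_le.mp hxr, hx.1.trans (by exact_mod_cast hlt'), hx.2⟩
  · rw [ENNReal.top_mul h0, expNeg_top, ENNReal.toReal_zero]
    exact alive_of_le (iInf₂_le r h0)

theorem integral_toReal_expNeg_add_delay {t : ℝ≥0} {f g : ℝ × ℝ × Bool → ℝ≥0∞}
    (hf : Measurable f) (hg : Measurable g) (hft : ∀ x, (t : ℝ) < x.1 → f x = 0) :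
    ∫ ω, (expNeg (∫⁻ x, (f x + delay t g x) ∂(N ω))).toReal ∂P =
      (∫ ω, (expNeg (∫⁻ x, f x ∂(N ω))).toReal ∂P) *
        ∫ ω, (expNeg (∫⁻ x, g x ∂(N ω))).toReal ∂P := by
  have := hΛ.sigmaFinite_markedMeasure hp hp01
  have hm : ∀ h : ℝ × ℝ × Bool → ℝ≥0∞, Measurable h → Measurable fun ω => ∫⁻ x, h x ∂(N ω) :=
    fun h hh => (Measure.measurable_lintegral hh).comp hN.measurable
  rw [integral_toReal_expNeg (hm (fun x => f x + delay t g x) (hf.add (measurable_delay _ hg))),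
    integral_toReal_expNeg (hm _ hf), integral_toReal_expNeg (hm _ hg), ← ENNReal.toReal_mul,
    hN.lintegral_expNeg_add_delay (NNReal.coe_nonneg t) hf hg hft]

/-- The simple Markov property of the process and first switching time of a Poisson random
measure. -/
theorem isMarkovPair_poisson (hpfin : ∫⁻ u, ENNReal.ofReal (p u) ∂Λ < ∞) :
    IsMarkovPair P (fun t ω => factorProduct (factors (N ω)) t) (fun ω => firstSwitch (N ω)) := by
  have hfin := ae_logSizeUpTo_ne_top hΛ hp hp01 hN
  have hal := ae_alive_firstSwitch hΛ hp hp01 hN hpfin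
  have hG0 : ∀ (t : ℝ≥0) (k : List ℝ≥0), (∀ s ∈ k, s ≤ t) → ∀ x : ℝ × ℝ × Bool, (t : ℝ) < x.1 →
      logSizeList k x = 0 := by
    intro t k hk x hx
    refine List.sum_eq_zero fun y hy => ?_
    obtain ⟨s, hs, rfl⟩ := List.mem_map.mp hy
    refine indicator_of_notMem (fun h => ?_) _
    have h1 : x.1 ≤ (s : ℝ) := h
    have h2 : (s : ℝ) ≤ t := by exact_mod_cast hk s hs
    linarith
  have hH0 : ∀ (t r : ℝ≥0), r ≤ t → ∀ x : ℝ × ℝ × Bool, (t : ℝ) < x.1 → markUpTo r x = 0 := by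
    intro t r hr x hx
    refine indicator_of_notMem (fun h => ?_) _
    have h1 : x.1 ≤ (r : ℝ) := h.1
    have h2 : (r : ℝ) ≤ t := by exact_mod_cast hr
    linarith
  have hmGH : ∀ k r, Measurable fun x => logSizeList k x + markUpTo r x := fun k r =>
    (measurable_logSizeList k).add (measurable_markUpTo r)
  have hone : ∀ (k : List ℝ≥0) (r : ℝ≥0),
      ∫ ω, (k.map fun s => factorProduct (factors (N ω)) s).prod *
        alive (fun ω => firstSwitch (N ω)) r ω ∂P =
      ∫ ω, (expNeg (∫⁻ x, (logSizeList k x + markUpTo r x) ∂(N ω))).toReal ∂P := by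
    intro k r
    refine integral_congr_ae ?_
    filter_upwards [hfin, hal r] with ω hω hr
    rw [hr, prod_factorProduct_factors hω, lintegral_add_left (measurable_logSizeList k),
      expNeg_add, ENNReal.toReal_mul]
  refine ⟨fun t r k l hk => ?_, fun t r k l hr hk => ?_⟩
  · rw [hone, hone, ← integral_toReal_expNeg_add_delay hΛ hp hp01 hN (hmGH k t) (hmGH l r)
      fun x hx => by rw [hG0 t k hk x hx, hH0 t t le_rfl x hx, add_zero]]
    refine integral_congr_ae ?_
    filter_upwards [hfin, hal (t + r)] with ω hω hr
    have e : ∀ x, logSizeList k x + markUpTo t x +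
        delay t (fun x => logSizeList l x + markUpTo r x) x =
        logSizeList k x + (delay t (logSizeList l) x + markUpTo (t + r) x) := fun x => by
      rw [delay_add, ← delay_markUpTo]; ring
    simp_rw [e]
    rw [lintegral_add_left (measurable_logSizeList k),
      lintegral_add_left (measurable_delay _ (measurable_logSizeList l)), expNeg_add, expNeg_add,
      ENNReal.toReal_mul, ENNReal.toReal_mul, hr, ← prod_factorProduct_factors hω,
      ← prod_factorProduct_factors_div hω, mul_assoc]
    rfl
  · have hl : ∫ ω, (l.map fun s => factorProduct (factors (N ω)) s).prod ∂P =
        ∫ ω, (expNeg (∫⁻ x, logSizeList l x ∂(N ω))).toReal ∂P :=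
      integral_congr_ae (by
        filter_upwards [hfin] with ω hω
        exact prod_factorProduct_factors hω l)
    rw [hone, hl, ← integral_toReal_expNeg_add_delay hΛ hp hp01 hN (hmGH k r)
      (measurable_logSizeList l) fun x hx => by rw [hG0 t k hk x hx, hH0 t r hr x hx, add_zero]]
    refine integral_congr_ae ?_
    filter_upwards [hfin, hal r] with ω hω hr
    have e : ∀ x, logSizeList k x + markUpTo r x + delay t (logSizeList l) x =
        logSizeList k x + (delay t (logSizeList l) x + markUpTo r x) := fun x => by ring
    simp_rw [e]
    rw [lintegral_add_left (measurable_logSizeList k),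
      lintegral_add_left (measurable_delay _ (measurable_logSizeList l)), expNeg_add, expNeg_add,
      ENNReal.toReal_mul, ENNReal.toReal_mul, hr, ← prod_factorProduct_factors hω,
      ← prod_factorProduct_factors_div hω, mul_assoc]
    rfl

/-- The Laplace functional of k(-log u) over times up to t: a point of size u contributes 1 - u^k to
the exponent. -/
theorem integral_factorProduct_pow (k : ℕ) (t : ℝ≥0) :
    ∫ ω, factorProduct (factors (N ω)) t ^ k ∂P =
      Real.exp (-(t * (∫⁻ u, ENNReal.ofReal (1 - u ^ k) ∂Λ).toReal)) := by
  have := hΛ.sigmaFinite_markedMeasure hp hp01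
  have h1 : ∫ ω, factorProduct (factors (N ω)) t ^ k ∂P =
      ∫ ω, (expNeg (∫⁻ x, logSizeList (List.replicate k t) x ∂(N ω))).toReal ∂P := by
    refine integral_congr_ae ?_
    filter_upwards [ae_logSizeUpTo_ne_top hΛ hp hp01 hN] with ω hω
    rw [← prod_factorProduct_factors hω]
    simp
  have e : ∀ x, 1 - expNeg (logSizeList (List.replicate k t) x) =
      {x : ℝ × ℝ × Bool | x.1 ≤ t}.indicator (fun x => 1 - expNeg (k * logSize x.2)) x :=
    fun x => by
      rw [logSizeList_replicate]
      by_cases hx : x.1 ≤ t <;> simp [hx, expNeg_zero]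
  have hmN : Measurable fun ω => ∫⁻ x, logSizeList (List.replicate k t) x ∂(N ω) :=
    (Measure.measurable_lintegral (measurable_logSizeList _)).comp hN.measurable
  rw [h1, integral_toReal_expNeg hmN,
    hN.lintegral_expNeg (measurable_logSizeList _)]
  simp_rw [e]
  rw [lintegral_indicator_fst_le _ _ (f := fun y => 1 - expNeg (k * logSize y))
    (measurable_const.sub (measurable_expNeg.comp (measurable_logSize.const_mul _))),
    lintegral_logSize_markedMeasure hΛ hp hp01, toReal_expNeg_of_ne_top
      (ENNReal.mul_ne_top (by simp) (hΛ.lintegral_one_sub_pow_lt_top k).ne)]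
  simp

/-- A marked point up to time t has infinite weight and contributes 1 to the exponent whatever its
size; an unmarked one contributes 1 - u^k. -/
theorem integral_factorProduct_pow_alive (hpfin : ∫⁻ u, ENNReal.ofReal (p u) ∂Λ < ∞) (k : ℕ)
    (t : ℝ≥0) :
    ∫ ω, factorProduct (factors (N ω)) t ^ k * alive (fun ω => firstSwitch (N ω)) t ω ∂P =
      Real.exp (-(t * ((∫⁻ u, ENNReal.ofReal (1 - u ^ k)
        ∂(Λ.withDensity fun u => ENNReal.ofReal (1 - p u))).toReal +
          (∫⁻ u, ENNReal.ofReal (p u) ∂Λ).toReal))) := by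
  have := hΛ.sigmaFinite_markedMeasure hp hp01
  have h1 : ∫ ω, factorProduct (factors (N ω)) t ^ k *
        alive (fun ω => firstSwitch (N ω)) t ω ∂P =
      ∫ ω, (expNeg (∫⁻ x, (logSizeList (List.replicate k t) x + markUpTo t x)
        ∂(N ω))).toReal ∂P := by
    refine integral_congr_ae ?_
    filter_upwards [ae_logSizeUpTo_ne_top hΛ hp hp01 hN,
      ae_alive_firstSwitch hΛ hp hp01 hN hpfin t] with ω hω hr
    rw [lintegral_add_left (measurable_logSizeList _), expNeg_add, ENNReal.toReal_mul, hr,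
      ← prod_factorProduct_factors hω]
    simp
  let h : ℝ × Bool → ℝ≥0∞ := fun y =>
    1 - expNeg (k * logSize y + {y : ℝ × Bool | y.2 = true}.indicator (fun _ => ∞) y)
  have hh : Measurable h := measurable_const.sub (measurable_expNeg.comp
    ((measurable_logSize.const_mul _).add (measurable_const.indicator
      (measurableSet_eq_fun measurable_snd measurable_const))))
  have e : ∀ x, 1 - expNeg (logSizeList (List.replicate k t) x + markUpTo t x) =
      {x : ℝ × ℝ × Bool | x.1 ≤ t}.indicator (fun x => h x.2) x :=
    fun x => by
      rw [logSizeList_replicate]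
      unfold markUpTo
      by_cases hx : x.1 ≤ t <;> simp [hx, expNeg_zero, h, indicator_apply]
  have hmm : Measurable fun x => logSizeList (List.replicate k t) x + markUpTo t x :=
    (measurable_logSizeList _).add (measurable_markUpTo t)
  have hmN : Measurable fun ω => ∫⁻ x, (logSizeList (List.replicate k t) x + markUpTo t x)
        ∂(N ω) := (Measure.measurable_lintegral hmm).comp hN.measurable
  have hval : ∫⁻ y, h y ∂(markedMeasure Λ p) = ∫⁻ u, ENNReal.ofReal (p u) ∂Λ +
      ∫⁻ u, ENNReal.ofReal (1 - u ^ k) ∂(Λ.withDensity fun u => ENNReal.ofReal (1 - p u)) := by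
    rw [lintegral_markedMeasure hh]
    congr 1
    · simp [h, expNeg_top]
    · refine lintegral_congr_ae ?_
      filter_upwards [(withDensity_absolutelyContinuous Λ _).ae_le hΛ.ae_mem] with u hu
      simp only [h]
      rw [← expNeg_nat_mul_logSize (y := (u, false)) hu]
      simp
  have hfin0 : ∫⁻ u, ENNReal.ofReal (1 - u ^ k)
      ∂(Λ.withDensity fun u => ENNReal.ofReal (1 - p u)) ≠ ∞ := by
    refine ne_top_of_le_ne_top (hΛ.lintegral_one_sub_pow_lt_top k).ne
      (lintegral_mono' ?_ le_rfl)
    conv_rhs => rw [← withDensity_add_withDensity (Λ := Λ) hp hp01]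
    exact Measure.le_add_left le_rfl
  rw [h1, integral_toReal_expNeg hmN, hN.lintegral_expNeg hmm]
  simp_rw [e]
  rw [lintegral_indicator_fst_le _ _ hh, hval, toReal_expNeg_of_ne_top
      (ENNReal.mul_ne_top (by simp) (ENNReal.add_ne_top.mpr ⟨hpfin.ne, hfin0⟩)),
      ENNReal.toReal_mul, ENNReal.toReal_add hpfin.ne hfin0]
  rw [add_comm, ENNReal.coe_toReal]

end

end PoissonFragmenter

/-! ### The law of a Markov pair is determined by its one-time moments -/

section MarkovPairLaw

variable {Ω Ω' : Type*} [MeasurableSpace Ω] [MeasurableSpace Ω'] {μ : Measure Ω} {μ' : Measure Ω'}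
  {M : ℝ≥0 → Ω → ℝ} {τ : Ω → ℝ≥0∞} {M' : ℝ≥0 → Ω' → ℝ} {τ' : Ω' → ℝ≥0∞}

theorem measurable_future {M : ℝ≥0 → Ω → ℝ} (hM : ∀ t, Measurable (M t)) (t v : ℝ≥0) :
    Measurable fun ω => future M t ω v :=
  (hM (t + v)).div (hM t)

theorem measurable_prod_future {M : ℝ≥0 → Ω → ℝ} (hM : ∀ t, Measurable (M t)) (t : ℝ≥0)
    (l : List ℝ≥0) : Measurable fun ω => (l.map (future M t ω)).prod :=
  measurable_list_prod_map (X := fun v ω => future M t ω v) fun v _ => measurable_future hM t v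

/-- Being a Markov pair depends only on the joint law of the process and the time. -/
theorem IsMarkovPair.of_map (h : AEMeasurable (fun ω => ((fun t => M t ω : ℝ≥0 → ℝ), τ ω)) μ) :
    IsMarkovPair (μ.map fun ω => ((fun t => M t ω : ℝ≥0 → ℝ), τ ω))
      (fun t z => z.1 t) (fun z => z.2) ↔ IsMarkovPair μ M τ := by
  have hm : ∀ t : ℝ≥0, Measurable fun z : (ℝ≥0 → ℝ) × ℝ≥0∞ => z.1 t := fun t => by fun_prop
  have hk : ∀ k : List ℝ≥0, Measurable fun z : (ℝ≥0 → ℝ) × ℝ≥0∞ => (k.map fun s => z.1 s).prod :=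
    fun k => measurable_list_prod_map (X := fun s (z : (ℝ≥0 → ℝ) × ℝ≥0∞) => z.1 s)
      fun s _ => hm s
  have ha : ∀ r : ℝ≥0, Measurable (alive (fun z : (ℝ≥0 → ℝ) × ℝ≥0∞ => z.2) r) :=
    measurable_alive measurable_snd
  have hf : ∀ (t : ℝ≥0) (l : List ℝ≥0), Measurable fun z : (ℝ≥0 → ℝ) × ℝ≥0∞ =>
      (l.map (future (fun t (z : (ℝ≥0 → ℝ) × ℝ≥0∞) => z.1 t) t z)).prod :=
    measurable_prod_future hm
  have e1 : ∀ (k l : List ℝ≥0) (t r : ℝ≥0),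
      ∫ z, (k.map fun s => z.1 s).prod *
        (l.map (future (fun t (z : (ℝ≥0 → ℝ) × ℝ≥0∞) => z.1 t) t z)).prod *
          alive (fun z : (ℝ≥0 → ℝ) × ℝ≥0∞ => z.2) r z
        ∂(μ.map fun ω => ((fun t => M t ω : ℝ≥0 → ℝ), τ ω)) =
      ∫ ω, (k.map fun s => M s ω).prod * (l.map (future M t ω)).prod * alive τ r ω ∂μ :=
    fun k l t r => integral_map h (((hk k).mul (hf t l)).mul (ha r)).aestronglyMeasurable
  have e2 : ∀ (k : List ℝ≥0) (r : ℝ≥0),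
      ∫ z, (k.map fun s => z.1 s).prod * alive (fun z : (ℝ≥0 → ℝ) × ℝ≥0∞ => z.2) r z
        ∂(μ.map fun ω => ((fun t => M t ω : ℝ≥0 → ℝ), τ ω)) =
      ∫ ω, (k.map fun s => M s ω).prod * alive τ r ω ∂μ :=
    fun k r => integral_map h ((hk k).mul (ha r)).aestronglyMeasurable
  have e3 : ∀ (k : List ℝ≥0),
      ∫ z, (k.map fun s => z.1 s).prod ∂(μ.map fun ω => ((fun t => M t ω : ℝ≥0 → ℝ), τ ω)) =
      ∫ ω, (k.map fun s => M s ω).prod ∂μ :=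
    fun k => integral_map h (hk k).aestronglyMeasurable
  refine ⟨fun H => ⟨fun t r k l hk => ?_, fun t r k l hr hk => ?_⟩,
    fun H => ⟨fun t r k l hk => ?_, fun t r k l hr hk => ?_⟩⟩
  · have := H.before t r k l hk
    rwa [e1, e2, e2] at this
  · have := H.after t r k l hr hk
    rwa [e1, e2, e3] at this
  · rw [e1, e2, e2]; exact H.before t r k l hk
  · rw [e1, e2, e3]; exact H.after t r k l hr hk

theorem IsMarkovPair.of_identDistrib
    (h : IdentDistrib (fun ω => ((fun t => M t ω : ℝ≥0 → ℝ), τ ω))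
      (fun ω => ((fun t => M' t ω : ℝ≥0 → ℝ), τ' ω)) μ μ') (H : IsMarkovPair μ' M' τ') :
    IsMarkovPair μ M τ := by
  rw [← IsMarkovPair.of_map h.aemeasurable_fst, h.map_eq, IsMarkovPair.of_map h.aemeasurable_snd]
  exact H

theorem prod_map_eq_pow_mul_future {Ω : Type*} {M : ℝ≥0 → Ω → ℝ} {ω : Ω} {t : ℝ≥0} (h0 : M t ω ≠ 0) {l : List ℝ≥0}
    (hl : ∀ s ∈ l, t ≤ s) :
    (l.map fun s => M s ω).prod =
      M t ω ^ l.length * ((l.map fun s => s - t).map (future M t ω)).prod := by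
  induction l with
  | nil => simp
  | cons a l ih =>
    have ha : t + (a - t) = a := add_tsub_cancel_of_le (hl a (by simp))
    simp only [List.map_cons, List.prod_cons, List.length_cons, pow_succ]
    rw [ih fun s hs => hl s (by simp [hs])]
    simp only [future, ha]
    field_simp

/-- The recursion which expresses the mixed moments of a Markov pair by those at one time. -/
theorem IsMarkovPair.integral_cons (H : IsMarkovPair μ M τ) (h0 : ∀ t, ∀ᵐ ω ∂μ, 0 < M t ω)
    (hτ : ∀ᵐ ω ∂μ, 0 < τ ω) {t : ℝ≥0} {l : List ℝ≥0} (hl : ∀ s ∈ l, t ≤ s) (r : ℝ≥0) :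
    ∫ ω, ((t :: l).map fun s => M s ω).prod * alive τ r ω ∂μ =
      if t ≤ r then
        (∫ ω, M t ω ^ (l.length + 1) * alive τ t ω ∂μ) *
          ∫ ω, ((l.map fun s => s - t).map fun s => M s ω).prod * alive τ (r - t) ω ∂μ
      else (∫ ω, M r ω ^ (l.length + 1) * alive τ r ω ∂μ) *
        (∫ ω, M (t - r) ω ^ (l.length + 1) ∂μ) *
          ∫ ω, ((l.map fun s => s - t).map fun s => M s ω).prod * alive τ 0 ω ∂μ := by
  have e : ∀ r, ∫ ω, ((t :: l).map fun s => M s ω).prod * alive τ r ω ∂μ =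
      ∫ ω, ((List.replicate (l.length + 1) t).map fun s => M s ω).prod *
        ((l.map fun s => s - t).map (future M t ω)).prod * alive τ r ω ∂μ := fun r => by
    refine integral_congr_ae ?_
    filter_upwards [h0 t] with ω hω
    rw [List.map_cons, List.prod_cons, prod_map_eq_pow_mul_future hω.ne' hl]
    simp only [List.map_replicate, List.prod_replicate]
    ring
  have hrep : ∀ s ∈ List.replicate (l.length + 1) t, s ≤ t := fun s hs =>
    (List.eq_of_mem_replicate hs).le
  split_ifs with htr
  · have := H.before t (r - t) (List.replicate (l.length + 1) t) (l.map fun s => s - t) hrep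
    rw [add_tsub_cancel_of_le htr, ← e r] at this
    rw [this]
    simp
  · have htr' : r ≤ t := (not_le.mp htr).le
    have := H.after t r (List.replicate (l.length + 1) t) (l.map fun s => s - t) htr' hrep
    rw [← e r] at this
    rw [this]
    congr 1
    -- For r < t the factor E[M_t^K; τ > r] is itself split at r, into E[M_r^K; τ > r] and
    -- E[M_{t-r}^K].
    · have h2 := H.after r r (List.replicate (l.length + 1) r)
        (List.replicate (l.length + 1) (t - r)) le_rfl
        fun s hs => (List.eq_of_mem_replicate hs).le
      simp only [List.map_replicate, List.prod_replicate] at h2 ⊢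
      rw [← h2]
      refine integral_congr_ae ?_
      filter_upwards [h0 r] with ω hω
      simp only [future, add_tsub_cancel_of_le htr']
      rw [← mul_pow, mul_div_cancel₀ _ hω.ne']
    · refine integral_congr_ae ?_
      filter_upwards [hτ] with ω hω
      rw [alive_of_lt (by simpa using hω), mul_one]

/-- Sort the times and apply the Markov property at the smallest one: it leaves one-time moments and
a mixed moment with one time fewer, so induction on the number of times applies. -/
theorem IsMarkovPair.moments_eq (H : IsMarkovPair μ M τ) (H' : IsMarkovPair μ' M' τ')
    (h0 : ∀ t, ∀ᵐ ω ∂μ, 0 < M t ω) (h0' : ∀ t, ∀ᵐ ω ∂μ', 0 < M' t ω)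
    (hτ : ∀ᵐ ω ∂μ, 0 < τ ω) (hτ' : ∀ᵐ ω ∂μ', 0 < τ' ω)
    (hpow : ∀ t k, ∫ ω, M t ω ^ k ∂μ = ∫ ω, M' t ω ^ k ∂μ')
    (halive : ∀ t k, ∫ ω, M t ω ^ k * alive τ t ω ∂μ = ∫ ω, M' t ω ^ k * alive τ' t ω ∂μ')
    (l : List ℝ≥0) (r : ℝ≥0) :
    ∫ ω, (l.map fun s => M s ω).prod * alive τ r ω ∂μ =
      ∫ ω, (l.map fun s => M' s ω).prod * alive τ' r ω ∂μ' := by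
  have main : ∀ (n : ℕ) (l : List ℝ≥0), l.length = n → l.Pairwise (· ≤ ·) → ∀ r,
      ∫ ω, (l.map fun s => M s ω).prod * alive τ r ω ∂μ =
        ∫ ω, (l.map fun s => M' s ω).prod * alive τ' r ω ∂μ' := by
    intro n
    induction n with
    | zero =>
      intro l hl _ r
      rw [List.length_eq_zero_iff.mp hl]
      simpa using halive r 0
    | succ n ih =>
      intro l hl hs r
      cases l with
      | nil => simp at hl
      | cons t l =>
        have hts := List.pairwise_cons.mp hs
        have hsorted : (l.map fun s => s - t).Pairwise (· ≤ ·) :=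
          List.pairwise_map.mpr (hts.2.imp fun h => tsub_le_tsub_right h t)
        have ih' := ih (l.map fun s => s - t) (by simpa using hl) hsorted
        rw [H.integral_cons h0 hτ hts.1, H'.integral_cons h0' hτ' hts.1, ih', ih', halive, halive,
          hpow]
  have hperm := List.mergeSort_perm l (fun a b => decide (a ≤ b))
  have hsorted : (l.mergeSort (fun a b => decide (a ≤ b))).Pairwise (· ≤ ·) := by
    have := List.pairwise_mergeSort (le := fun a b : ℝ≥0 => decide (a ≤ b))
      (fun a b c hab hbc => by simp at *; exact hab.trans hbc)
      (fun a b => by simpa using le_total a b) l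
    exact this.imp fun h => by simpa using h
  have h := main _ _ rfl hsorted r
  have e : ∀ ω, ((l.mergeSort (fun a b => decide (a ≤ b))).map fun s => M s ω).prod =
      (l.map fun s => M s ω).prod := fun ω => (hperm.map _).prod_eq
  have e' : ∀ ω, ((l.mergeSort (fun a b => decide (a ≤ b))).map fun s => M' s ω).prod =
      (l.map fun s => M' s ω).prod := fun ω => (hperm.map _).prod_eq
  simpa only [e, e'] using h

/-- The events τ > r are nested, so the largest r decides. The starting value 0 of the fold accounts
for the empty product, where τ > 0 is needed. -/
theorem prod_map_alive {Ω : Type*} {τ : Ω → ℝ≥0∞} {ω : Ω} (hτ : 0 < τ ω) (k : List ℝ≥0) :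
    (k.map fun r => alive τ r ω).prod = alive τ (k.foldr max 0) ω := by
  induction k with
  | nil => simp [alive_of_lt (r := 0) (by simpa using hτ)]
  | cons a k ih =>
    rw [List.map_cons, List.prod_cons, ih, List.foldr_cons]
    rcases le_total a (k.foldr max 0) with h | h
    · rw [max_eq_right h]
      by_cases h2 : ((k.foldr max 0 : ℝ≥0) : ℝ≥0∞) < τ ω
      · rw [alive_of_lt h2, alive_of_lt (lt_of_le_of_lt (by exact_mod_cast h) h2), one_mul]
      · rw [alive_of_le (not_lt.mp h2), mul_zero]
    · rw [max_eq_left h]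
      by_cases h2 : (a : ℝ≥0∞) < τ ω
      · rw [alive_of_lt h2, alive_of_lt (lt_of_le_of_lt (by exact_mod_cast h) h2), one_mul]
      · rw [alive_of_le (not_lt.mp h2), zero_mul]

/-- The time `τ`, recovered from the indicators of the events `τ > r`. -/
noncomputable def lifetime (z : ℝ≥0 → ℝ) : ℝ≥0∞ :=
  ⨆ q : ℚ, if 1 / 2 < z (Real.toNNReal q) then ((Real.toNNReal q : ℝ≥0) : ℝ≥0∞) else 0

theorem measurable_lifetime : Measurable lifetime :=
  Measurable.iSup fun _ => Measurable.ite
    (measurableSet_lt measurable_const (measurable_pi_apply _)) measurable_const measurable_const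

theorem lifetime_alive {Ω : Type*} (τ : Ω → ℝ≥0∞) (ω : Ω) : lifetime (fun r => alive τ r ω) = τ ω := by
  refine le_antisymm (iSup_le fun q => ?_) (le_of_forall_lt fun a ha => ?_)
  · split_ifs with h
    · by_contra hq
      beta_reduce at h
      rw [alive_of_le (not_le.mp hq).le] at h
      norm_num at h
    · exact zero_le
  · obtain ⟨q, _, haq, hq⟩ := ENNReal.lt_iff_exists_rat_btwn.mp ha
    refine haq.trans_le (le_trans ?_ (le_iSup _ q))
    beta_reduce
    rw [alive_of_lt hq]
    norm_num

variable [IsProbabilityMeasure μ] [IsProbabilityMeasure μ']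

/-- The law of a process and a time is determined by moments. -/
theorem identDistrib_of_moments (hM : ∀ t, Measurable (M t)) (hM' : ∀ t, Measurable (M' t))
    (hτm : AEMeasurable τ μ) (hτm' : AEMeasurable τ' μ')
    (h01 : ∀ t, ∀ᵐ ω ∂μ, M t ω ∈ Icc (0 : ℝ) 1) (h01' : ∀ t, ∀ᵐ ω ∂μ', M' t ω ∈ Icc (0 : ℝ) 1)
    (hτ : ∀ᵐ ω ∂μ, 0 < τ ω) (hτ' : ∀ᵐ ω ∂μ', 0 < τ' ω)
    (h : ∀ (l : List ℝ≥0) (r : ℝ≥0), ∫ ω, (l.map fun s => M s ω).prod * alive τ r ω ∂μ =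
      ∫ ω, (l.map fun s => M' s ω).prod * alive τ' r ω ∂μ') :
    IdentDistrib (fun ω => ((fun t => M t ω : ℝ≥0 → ℝ), τ ω))
      (fun ω => ((fun t => M' t ω : ℝ≥0 → ℝ), τ' ω)) μ μ' := by
  have hMm : Measurable (fun ω t => M t ω) := measurable_pi_lambda _ hM
  have hMm' : Measurable (fun ω t => M' t ω) := measurable_pi_lambda _ hM'
  refine ⟨hMm.aemeasurable.prodMk hτm, hMm'.aemeasurable.prodMk hτm', ?_⟩
  -- The time is only almost everywhere measurable, so the moment argument is run on a measurable
  -- version.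
  have hc : ∀ᵐ ω ∂μ, τ ω = hτm.mk τ ω := hτm.ae_eq_mk
  have hc' : ∀ᵐ ω ∂μ', τ' ω = hτm'.mk τ' ω := hτm'.ae_eq_mk
  have hal : ∀ᵐ ω ∂μ, ∀ r, alive τ r ω = alive (hτm.mk τ) r ω := by
    filter_upwards [hc] with ω hω r
    simp [alive, indicator_apply, hω]
  have hal' : ∀ᵐ ω ∂μ', ∀ r, alive τ' r ω = alive (hτm'.mk τ') r ω := by
    filter_upwards [hc'] with ω hω r
    simp [alive, indicator_apply, hω]
  let X : ℝ≥0 ⊕ ℝ≥0 → Ω → ℝ := Sum.elim M (alive (hτm.mk τ))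
  let X' : ℝ≥0 ⊕ ℝ≥0 → Ω' → ℝ := Sum.elim M' (alive (hτm'.mk τ'))
  have hX : ∀ i, Measurable (X i) := by
    rintro (i | i); exacts [hM i, measurable_alive hτm.measurable_mk i]
  have hX' : ∀ i, Measurable (X' i) := by
    rintro (i | i); exacts [hM' i, measurable_alive hτm'.measurable_mk i]
  have key : μ.map (fun ω i => X i ω) = μ'.map (fun ω i => X' i ω) := by
    refine map_eq_of_moments hX hX' ?_ ?_ fun l => ?_
    · rintro (i | i); exacts [h01 i, ae_of_all _ fun ω => alive_mem_Icc _ _ _]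
    · rintro (i | i); exacts [h01' i, ae_of_all _ fun ω => alive_mem_Icc _ _ _]
    · have := h (l.filterMap Sum.getLeft?) ((l.filterMap Sum.getRight?).foldr max 0)
      convert this using 1
      · refine integral_congr_ae ?_
        filter_upwards [hτ, hal, hc] with ω hω hω2 hω3
        rw [hω2, ← prod_map_alive (by rw [← hω3]; exact hω), ← prod_map_sumElim]
        congr 2
        funext i
        cases i <;> rfl
      · refine integral_congr_ae ?_
        filter_upwards [hτ', hal', hc'] with ω hω hω2 hω3
        rw [hω2, ← prod_map_alive (by rw [← hω3]; exact hω), ← prod_map_sumElim]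
        congr 2
        funext i
        cases i <;> rfl
  let g : (ℝ≥0 ⊕ ℝ≥0 → ℝ) → (ℝ≥0 → ℝ) × ℝ≥0∞ := fun z =>
    (fun t => z (.inl t), lifetime fun r => z (.inr r))
  have hg : Measurable g :=
    (measurable_pi_lambda _ fun t => measurable_pi_apply _).prodMk
      (measurable_lifetime.comp (measurable_pi_lambda _ fun t => measurable_pi_apply _))
  have := congrArg (Measure.map g) key
  rw [Measure.map_map hg (measurable_pi_lambda _ hX),
    Measure.map_map hg (measurable_pi_lambda _ hX')] at this
  convert this using 1
  · refine Measure.map_congr ?_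
    filter_upwards [hc] with ω hω
    refine Prod.ext rfl ?_
    exact hω.trans (lifetime_alive (hτm.mk τ) ω).symm
  · refine Measure.map_congr ?_
    filter_upwards [hc'] with ω hω
    refine Prod.ext rfl ?_
    exact hω.trans (lifetime_alive (hτm'.mk τ') ω).symm

end MarkovPairLaw

/-! ### Measurable evaluation at random times and measurability of separation times -/

section RandomTimes

/-- Points of the grid `ℕ / (n + 1)` which approximate `t` from above. -/
noncomputable def gridR (n : ℕ) (t : ℝ≥0) : ℝ≥0 := (⌊((n : ℝ≥0) + 1) * t⌋₊ + 1 : ℕ) / ((n : ℝ≥0) + 1)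

/-- Points of the grid `ℕ / (n + 1)` which approximate `t` from below. -/
noncomputable def gridL (n : ℕ) (t : ℝ≥0) : ℝ≥0 := (⌈((n : ℝ≥0) + 1) * t⌉₊ - 1 : ℕ) / ((n : ℝ≥0) + 1)

theorem lt_gridR (n : ℕ) (t : ℝ≥0) : t < gridR n t := by
  have hn : (0 : ℝ≥0) < (n : ℝ≥0) + 1 := by positivity
  rw [gridR, lt_div_iff₀ hn, mul_comm]
  exact_mod_cast Nat.lt_floor_add_one _

theorem gridR_le (n : ℕ) (t : ℝ≥0) : gridR n t ≤ t + ((n : ℝ≥0) + 1)⁻¹ := by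
  have hn : (0 : ℝ≥0) < (n : ℝ≥0) + 1 := by positivity
  have h1 : (t + ((n : ℝ≥0) + 1)⁻¹) * ((n : ℝ≥0) + 1) = ((n : ℝ≥0) + 1) * t + 1 := by
    field_simp
  rw [gridR, div_le_iff₀ hn, h1]
  push_cast
  gcongr
  exact Nat.floor_le zero_le

theorem gridL_lt {n : ℕ} {t : ℝ≥0} (ht : 0 < t) : gridL n t < t := by
  have hn : (0 : ℝ≥0) < (n : ℝ≥0) + 1 := by positivity
  have hpos : 0 < ((n : ℝ≥0) + 1) * t := by positivity
  have hc : 1 ≤ ⌈((n : ℝ≥0) + 1) * t⌉₊ := Nat.one_le_ceil_iff.mpr hpos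
  rw [gridL, div_lt_iff₀ hn, mul_comm t]
  have := Nat.ceil_lt_add_one (a := ((n : ℝ≥0) + 1) * t) zero_le
  have h2 : ((⌈((n : ℝ≥0) + 1) * t⌉₊ - 1 : ℕ) : ℝ≥0) + 1 = ⌈((n : ℝ≥0) + 1) * t⌉₊ := by
    exact_mod_cast Nat.sub_add_cancel hc
  rw [← h2] at this
  exact lt_of_add_lt_add_right this

theorem le_gridL_add (n : ℕ) (t : ℝ≥0) : t ≤ gridL n t + ((n : ℝ≥0) + 1)⁻¹ := by
  have hn : (0 : ℝ≥0) < (n : ℝ≥0) + 1 := by positivity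
  rw [gridL, ← one_div, ← add_div, le_div_iff₀ hn, mul_comm t]
  refine (Nat.le_ceil _).trans ?_
  have : ⌈((n : ℝ≥0) + 1) * t⌉₊ ≤ ⌈((n : ℝ≥0) + 1) * t⌉₊ - 1 + 1 := by omega
  exact_mod_cast this

theorem tendsto_inv_nat_add_one_nnreal :
    Tendsto (fun n : ℕ => ((n : ℝ≥0) + 1)⁻¹) atTop (𝓝 0) := by
  have := tendsto_one_div_add_atTop_nhds_zero_nat (𝕜 := ℝ)
  rw [← NNReal.tendsto_coe]
  refine this.congr fun n => ?_
  simp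

theorem tendsto_gridR (t : ℝ≥0) : Tendsto (fun n => gridR n t) atTop (𝓝[≥] t) := by
  refine tendsto_nhdsWithin_iff.mpr ⟨?_, Eventually.of_forall fun n => (lt_gridR n t).le⟩
  refine tendsto_of_tendsto_of_tendsto_of_le_of_le tendsto_const_nhds
    (h := fun n : ℕ => t + ((n : ℝ≥0) + 1)⁻¹) ?_ (fun n => (lt_gridR n t).le) (gridR_le · t)
  simpa using (tendsto_const_nhds (x := t)).add tendsto_inv_nat_add_one_nnreal

theorem tendsto_gridL {t : ℝ≥0} (ht : 0 < t) : Tendsto (fun n => gridL n t) atTop (𝓝[<] t) := by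
  refine tendsto_nhdsWithin_iff.mpr ⟨?_, Eventually.of_forall fun n => gridL_lt ht⟩
  refine tendsto_of_tendsto_of_tendsto_of_le_of_le (g := fun n : ℕ => t - ((n : ℝ≥0) + 1)⁻¹)
    ?_ tendsto_const_nhds (fun n => tsub_le_iff_right.mpr (le_gridL_add n t))
    (fun n => (gridL_lt ht).le)
  simpa using (tendsto_const_nhds (x := t)).sub tendsto_inv_nat_add_one_nnreal

/-- The value at `t` of a right-continuous function, as a limit along the grids. -/
noncomputable def evalR (f : ℝ≥0 → ℝ) (t : ℝ≥0) : ℝ := limsup (fun n => f (gridR n t)) atTop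

/-- The left limit at `t`, as a limit along the grids. -/
noncomputable def evalL (f : ℝ≥0 → ℝ) (t : ℝ≥0) : ℝ := limsup (fun n => f (gridL n t)) atTop

theorem evalR_eq {f : ℝ≥0 → ℝ} {t : ℝ≥0} (hf : ContinuousWithinAt f (Ici t) t) :
    evalR f t = f t :=
  (hf.tendsto.comp (tendsto_gridR t)).limsup_eq

theorem evalL_eq {f : ℝ≥0 → ℝ} (hf : Antitone f) {t : ℝ≥0} (ht : 0 < t) :
    evalL f t = Function.leftLim f t :=
  ((hf.tendsto_leftLim t).comp (tendsto_gridL ht)).limsup_eq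

/-- Evaluation at a random time is not jointly measurable on the space of all paths, but it is when
the time takes countably many values. Hence `evalR` and `evalL` pass along grids. -/
theorem measurable_apply_natCast_div {α : Type*} [MeasurableSpace α] {f : α → ℝ≥0 → ℝ}
    (hf : Measurable f) {j : α → ℕ} (hj : Measurable j) (c : ℝ≥0) :
    Measurable fun a => f a ((j a : ℝ≥0) / c) := by
  have h1 : Measurable fun z : (ℝ≥0 → ℝ) × ℕ => z.1 ((z.2 : ℝ≥0) / c) :=
    measurable_from_prod_countable_left fun n => measurable_pi_apply ((n : ℝ≥0) / c)
  exact h1.comp (hf.prodMk hj)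

theorem measurable_evalR {α : Type*} [MeasurableSpace α] {f : α → ℝ≥0 → ℝ} {t : α → ℝ≥0}
    (hf : Measurable f) (ht : Measurable t) : Measurable fun a => evalR (f a) (t a) := by
  refine Measurable.limsup fun n => measurable_apply_natCast_div hf ?_ _
  exact (Nat.measurable_floor.comp (ht.const_mul _)).add_const 1

theorem measurable_evalL {α : Type*} [MeasurableSpace α] {f : α → ℝ≥0 → ℝ} {t : α → ℝ≥0}
    (hf : Measurable f) (ht : Measurable t) : Measurable fun a => evalL (f a) (t a) := by
  refine Measurable.limsup fun n => measurable_apply_natCast_div hf ?_ _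
  exact (measurable_from_nat (f := fun m => m - 1)).comp (Nat.measurable_ceil.comp (ht.const_mul _))

theorem measurable_apply_of_rightContinuous {Ω : Type*} [MeasurableSpace Ω] {M : ℝ≥0 → Ω → ℝ}
    (hM : ∀ t, Measurable (M t)) (hc : ∀ ω t, ContinuousWithinAt (fun t => M t ω) (Ici t) t)
    {σ : Ω → ℝ≥0} (hσ : Measurable σ) : Measurable fun ω => M (σ ω) ω := by
  have := measurable_evalR (measurable_pi_lambda (fun ω t => M t ω) hM) hσ
  simpa only [evalR_eq (hc _ _)] using this

/-- The separation time of two paths, computed at rational times. -/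
noncomputable def ratSeparation (f g : ℝ≥0 → ℝ) : ℝ≥0∞ :=
  ⨅ q : ℚ, if f (Real.toNNReal q) = g (Real.toNNReal q) then ∞
    else ((Real.toNNReal q : ℝ≥0) : ℝ≥0∞)

theorem measurable_ratSeparation {α : Type*} [MeasurableSpace α] {f g : α → ℝ≥0 → ℝ}
    (hf : Measurable f) (hg : Measurable g) : Measurable fun a => ratSeparation (f a) (g a) :=
  Measurable.iInf fun _ => Measurable.ite (measurableSet_eq_fun
    ((measurable_pi_apply _).comp hf) ((measurable_pi_apply _).comp hg))
    measurable_const measurable_const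

theorem exists_rat_ne_of_ne {f g : ℝ≥0 → ℝ} {t : ℝ≥0} (hf : ContinuousWithinAt f (Ici t) t)
    (hg : ContinuousWithinAt g (Ici t) t) (h : f t ≠ g t) {b : ℝ≥0} (hb : t < b) :
    ∃ q : ℚ, t < Real.toNNReal q ∧ Real.toNNReal q < b ∧
      f (Real.toNNReal q) ≠ g (Real.toNNReal q) := by
  have h1 : ∀ᶠ s in 𝓝[≥] t, f s - g s ≠ 0 :=
    (hf.sub hg).eventually_ne (sub_ne_zero.mpr h)
  obtain ⟨c, hc, hcs⟩ := (mem_nhdsGE_iff_exists_Ico_subset' hb).mp h1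
  have hlt : ((t : ℝ≥0) : ℝ≥0∞) < ((min b c : ℝ≥0) : ℝ≥0∞) := by
    exact_mod_cast lt_min hb hc
  obtain ⟨q, _, h3, h4⟩ := ENNReal.lt_iff_exists_rat_btwn.mp hlt
  have h3' : t < Real.toNNReal q := by exact_mod_cast h3
  have h4' : Real.toNNReal q < min b c := by exact_mod_cast h4
  exact ⟨q, h3', h4'.trans_le (min_le_left _ _),
    sub_ne_zero.mp (hcs ⟨h3'.le, h4'.trans_le (min_le_right _ _)⟩)⟩

/-- By right continuity a discrepancy at t persists on an interval to the right of t, which contains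
rationals. The separation time thus becomes a measurable functional of the two paths, applicable to
pasts and futures alike. -/
theorem separationTime_eq_ratSeparation {Ω : Type*} {M M' : ℝ≥0 → Ω → ℝ} {ω : Ω}
    (hM : ∀ t, ContinuousWithinAt (fun t => M t ω) (Ici t) t)
    (hM' : ∀ t, ContinuousWithinAt (fun t => M' t ω) (Ici t) t) :
    separationTime M M' ω = ratSeparation (fun t => M t ω) (fun t => M' t ω) := by
  refine le_antisymm (le_iInf fun q => ?_) (le_iInf₂ fun t ht => ?_)
  · split_ifs with h
    · exact le_top
    · exact iInf₂_le (f := fun (t : ℝ≥0) (_ : M t ω ≠ M' t ω) => (t : ℝ≥0∞)) _ h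
  · refine le_of_forall_gt fun b hb => ?_
    obtain ⟨c, hc1, hc2⟩ := ENNReal.lt_iff_exists_nnreal_btwn.mp hb
    obtain ⟨q, _, hq, hne⟩ := exists_rat_ne_of_ne (hM t) (hM' t) ht
      (show t < c by exact_mod_cast hc1)
    refine lt_of_le_of_lt (iInf_le (fun q : ℚ => _) q) ?_
    rw [if_neg hne]
    exact lt_trans (by exact_mod_cast hq) hc2

end RandomTimes

/-! ### Product laws under restriction and conditioning -/

section ProductLaws

variable {Ω α β γ δ : Type*} [MeasurableSpace Ω] [MeasurableSpace α] [MeasurableSpace β]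
  [MeasurableSpace γ] [MeasurableSpace δ] {μ : Measure Ω}

/-- The event depends on Z only, so restricting to it affects neither the law of R nor its
independence. Working with unnormalised restrictions avoids a separate treatment of null events. -/
theorem restrict_map_prodMk_eq_of_indepFun [IsProbabilityMeasure μ] {Z : Ω → α} {R : Ω → β}
    (hZ : Measurable Z) (hR : Measurable R) (h : IndepFun R Z μ) {B : Set α} (hB : MeasurableSet B)
    {G : α → γ} (hG : Measurable G) :
    (μ.restrict (Z ⁻¹' B)).map (fun ω => (G (Z ω), R ω)) =
      ((μ.restrict (Z ⁻¹' B)).map fun ω => G (Z ω)).prod (μ.map R) := by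
  have h1 := (indepFun_iff_map_prod_eq_prod_map_map hZ.aemeasurable hR.aemeasurable).mp h.symm
  have h2 : (μ.restrict (Z ⁻¹' B)).map (fun ω => (Z ω, R ω)) =
      ((μ.restrict (Z ⁻¹' B)).map Z).prod (μ.map R) := by
    have e : Z ⁻¹' B = (fun ω => (Z ω, R ω)) ⁻¹' (B ×ˢ univ) := by ext; simp
    rw [← Measure.restrict_map hZ hB, ← Measure.restrict_univ (μ := μ.map R),
      Measure.prod_restrict, ← h1, e, Measure.restrict_map (hZ.prodMk hR) (hB.prod .univ)]
  have h3 := congrArg (Measure.map (Prod.map G id)) h2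
  rw [Measure.map_map (hG.prodMap measurable_id) (hZ.prodMk hR),
    ← Measure.map_prod_map _ _ hG measurable_id, Measure.map_map hG hZ, Measure.map_id] at h3
  exact h3

theorem map_prodMk_comp_of_eq_prod {X : Ω → α} {Y : Ω → β} {ν : Measure β} [SFinite μ] [SFinite ν]
    (hX : AEMeasurable X μ) (hY : AEMeasurable Y μ)
    (h : μ.map (fun ω => (X ω, Y ω)) = (μ.map X).prod ν)
    {f : α → γ} {g : β → δ} (hf : Measurable f) (hg : Measurable g) :
    μ.map (fun ω => (f (X ω), g (Y ω))) = (μ.map fun ω => f (X ω)).prod (ν.map g) := by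
  have h3 := congrArg (Measure.map (Prod.map f g)) h
  rw [AEMeasurable.map_map_of_aemeasurable (hf.prodMap hg).aemeasurable (hX.prodMk hY),
    ← Measure.map_prod_map _ _ hf hg,
    AEMeasurable.map_map_of_aemeasurable hf.aemeasurable hX] at h3
  exact h3

/-- Passage to the conditional laws in the branching property; the law of Y is read off as the
second marginal, the first factor having mass 1 after normalisation. -/
theorem cond_of_restrict_map_eq_prod [IsProbabilityMeasure μ] {A : Set Ω} (hA0 : μ A ≠ 0)
    {X : Ω → α} {Y : Ω → β} {ν : Measure β} [IsProbabilityMeasure ν]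
    (hX : Measurable X) (hY : Measurable Y)
    (h : (μ.restrict A).map (fun ω => (X ω, Y ω)) = ((μ.restrict A).map X).prod ν) :
    (cond μ A).map Y = ν ∧ IndepFun Y X (cond μ A) := by
  have hc : (cond μ A).map (fun ω => (X ω, Y ω)) = ((cond μ A).map X).prod ν := by
    rw [ProbabilityTheory.cond, Measure.map_smul, Measure.map_smul, h, Measure.prod_smul_left]
  have : IsProbabilityMeasure (cond μ A) := cond_isProbabilityMeasure hA0
  have hpX : IsProbabilityMeasure ((cond μ A).map X) :=
    Measure.isProbabilityMeasure_map hX.aemeasurable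
  have hY' : (cond μ A).map Y = ν := by
    have := congrArg Measure.snd hc
    rwa [Measure.snd_map_prodMk hX, Measure.snd_prod] at this
  refine ⟨hY', IndepFun.symm ?_⟩
  rw [indepFun_iff_map_prod_eq_prod_map_map hX.aemeasurable hY.aemeasurable, hc, hY']

end ProductLaws

/-! ### Unmarked and switched fragmenters as images of marked Poisson measures -/

section Fragmenters

theorem measurable_factorProduct (t : ℝ≥0) : Measurable fun N => factorProduct N t := by
  unfold factorProduct
  have h : Measurable fun N : Measure (ℝ × ℝ) =>
      ∫⁻ x in {x : ℝ × ℝ | x.1 ≤ t}, ENNReal.ofReal (-Real.log x.2) ∂N := by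
    simp_rw [← lintegral_indicator (measurableSet_fst_le (F := ℝ) (t : ℝ))]
    exact Measure.measurable_lintegral
      (Measurable.indicator (by fun_prop) (measurableSet_fst_le (F := ℝ) (t : ℝ)))
  exact Real.measurable_exp.comp h.ennreal_toReal.neg

theorem factorProduct_mem_Ioc (N : Measure (ℝ × ℝ)) (t : ℝ≥0) :
    factorProduct N t ∈ Ioc (0 : ℝ) 1 :=
  ⟨Real.exp_pos _, Real.exp_le_one_iff.mpr (neg_nonpos.mpr ENNReal.toReal_nonneg)⟩

theorem measurable_firstSwitch : Measurable firstSwitch := by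
  have e : firstSwitch = fun N : Measure (ℝ × ℝ × Bool) => ⨅ q : ℚ,
      if N {x | x.1 ≤ (Real.toNNReal q : ℝ≥0) ∧ x.2.2 = true} = 0 then ∞
        else ((Real.toNNReal q : ℝ≥0) : ℝ≥0∞) := by
    funext N
    refine le_antisymm (le_iInf fun q => ?_) (le_iInf₂ fun t ht => ?_)
    · split_ifs with h
      · exact le_top
      · exact iInf₂_le (f := fun (t : ℝ≥0) (_ : N {x | x.1 ≤ t ∧ x.2.2 = true} ≠ 0) =>
          (t : ℝ≥0∞)) _ h
    · refine le_of_forall_gt fun b hb => ?_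
      obtain ⟨q, _, hq1, hq2⟩ := ENNReal.lt_iff_exists_rat_btwn.mp hb
      refine lt_of_le_of_lt (iInf_le (fun q : ℚ => _) q) ?_
      have hq1' : t ≤ Real.toNNReal q := by exact_mod_cast hq1.le
      rw [if_neg]
      · exact hq2
      · intro h0
        refine ht (measure_mono_null (fun x hx => ?_) h0)
        exact ⟨hx.1.trans (by exact_mod_cast hq1'), hx.2⟩
  rw [e]
  exact Measurable.iInf fun q => Measurable.ite (measurableSet_eq_fun
    (Measure.measurable_coe (measurableSet_marked _)) measurable_const)
    measurable_const measurable_const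

variable {Ω : Type*} [MeasurableSpace Ω] {P : Measure Ω}
  {Λ : Measure ℝ} {p : ℝ → ℝ}

theorem markedMeasure_zero : markedMeasure Λ (fun _ => 0) = Λ.map fun u => (u, false) := by
  have h0 : (Λ.withDensity fun _ => ENNReal.ofReal 0) = 0 := by
    rw [ENNReal.ofReal_zero]; exact withDensity_zero
  have h1 : (Λ.withDensity fun _ => ENNReal.ofReal (1 - 0)) = Λ := by
    rw [sub_zero, ENNReal.ofReal_one]; exact withDensity_one
  rw [markedMeasure, h0, h1, Measure.map_zero, zero_add]

theorem map_prod_snd {F G : Type*} [MeasurableSpace F] [MeasurableSpace G] (Θ : Measure F)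
    [SFinite Θ] {g : F → G} (hg : Measurable g) :
    ((volume.restrict (Ioi (0 : ℝ))).prod Θ).map (fun x => (x.1, g x.2)) =
      (volume.restrict (Ioi (0 : ℝ))).prod (Θ.map g) := by
  have := Measure.map_prod_map (volume.restrict (Ioi (0 : ℝ))) Θ measurable_id hg
  rw [Measure.map_id] at this
  exact this.symm

section Unmarked

variable {N : Ω → Measure (ℝ × ℝ)}

/-- An unmarked measure is the marked case p = 0, in which no switch ever occurs; results for marked
measures then specialise to plain fragmenters. -/
theorem IsPoissonRandomMeasure.addMark (hΛ : IsSplittingMeasure Λ)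
    (hN : IsPoissonRandomMeasure P N ((volume.restrict (Ioi (0 : ℝ))).prod Λ)) :
    IsPoissonRandomMeasure P (fun ω => (N ω).map fun x => (x.1, x.2, false))
      ((volume.restrict (Ioi (0 : ℝ))).prod (markedMeasure Λ fun _ => 0)) := by
  have := hΛ.sigmaFinite
  rw [markedMeasure_zero, ← map_prod_snd Λ (g := fun u => (u, false)) (by fun_prop)]
  exact hN.map (by fun_prop)

theorem factors_addMark (N : Measure (ℝ × ℝ)) :
    factors (N.map fun x => (x.1, x.2, false)) = N := by
  rw [factors, Measure.map_map (by fun_prop) (by fun_prop)]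
  exact Measure.map_id

theorem firstSwitch_addMark (N : Measure (ℝ × ℝ)) :
    firstSwitch (N.map fun x => (x.1, x.2, false)) = ∞ := by
  refine iInf₂_eq_top.mpr fun t ht => (ht ?_).elim
  rw [Measure.map_apply (by fun_prop) (measurableSet_marked t)]
  simp

theorem isMarkovPair_factorProduct [IsProbabilityMeasure P] (hΛ : IsSplittingMeasure Λ)
    (hN : IsPoissonRandomMeasure P N ((volume.restrict (Ioi (0 : ℝ))).prod Λ)) :
    IsMarkovPair P (fun t ω => factorProduct (N ω) t) (fun _ => ∞) := by
  have := isMarkovPair_poisson (p := fun _ => 0) hΛ measurable_const (fun _ => by simp)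
    (hN.addMark hΛ) (by simp)
  simpa only [factors_addMark, firstSwitch_addMark] using this

theorem integral_factorProduct_pow_eq [IsProbabilityMeasure P] (hΛ : IsSplittingMeasure Λ)
    (hN : IsPoissonRandomMeasure P N ((volume.restrict (Ioi (0 : ℝ))).prod Λ)) (k : ℕ) (t : ℝ≥0) :
    ∫ ω, factorProduct (N ω) t ^ k ∂P =
      Real.exp (-(t * (∫⁻ u, ENNReal.ofReal (1 - u ^ k) ∂Λ).toReal)) := by
  have := integral_factorProduct_pow (p := fun _ => 0) hΛ measurable_const (fun _ => by simp)
    (hN.addMark hΛ) k t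
  simpa only [factors_addMark] using this

end Unmarked

/-- The size of a factor after switching. -/
noncomputable def switchSize (y : ℝ × Bool) : ℝ := if y.2 = true then 1 - y.1 else y.1

theorem measurable_switchSize : Measurable switchSize :=
  Measurable.ite (measurableSet_eq_fun measurable_snd measurable_const) (by fun_prop) (by fun_prop)

theorem lintegral_map_switchSize {f : ℝ → ℝ≥0∞} (hf : Measurable f) :
    ∫⁻ u, f u ∂((markedMeasure Λ p).map switchSize) =
      ∫⁻ u, f (1 - u) ∂(Λ.withDensity fun u => ENNReal.ofReal (p u)) +
        ∫⁻ u, f u ∂(Λ.withDensity fun u => ENNReal.ofReal (1 - p u)) := by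
  rw [lintegral_map hf measurable_switchSize,
    lintegral_markedMeasure (f := fun y => f (switchSize y)) (hf.comp measurable_switchSize)]
  simp [switchSize]

variable {N : Ω → Measure (ℝ × ℝ × Bool)}

theorem withDensity_one_sub_le (hp : Measurable p) (hp01 : ∀ u, p u ∈ Icc (0 : ℝ) 1) :
    (Λ.withDensity fun u => ENNReal.ofReal (1 - p u)) ≤ Λ := by
  conv_rhs => rw [← withDensity_add_withDensity (Λ := Λ) hp hp01]
  exact Measure.le_add_left le_rfl

/-- On the switched part 1 - (1-u) = u is bounded by 1 and the mass ∫ p dΛ is finite; the unswitched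
part is dominated by Λ. -/
theorem IsSplittingMeasure.switch (hΛ : IsSplittingMeasure Λ) (hp : Measurable p)
    (hp01 : ∀ u, p u ∈ Icc (0 : ℝ) 1) (hpfin : ∫⁻ u, ENNReal.ofReal (p u) ∂Λ < ∞) :
    IsSplittingMeasure ((markedMeasure Λ p).map switchSize) := by
  constructor
  · have h : ∀ᵐ u ∂((markedMeasure Λ p).map switchSize), u ∈ Ioo (0 : ℝ) 1 := by
      refine (ae_map_iff measurable_switchSize.aemeasurable measurableSet_Ioo).mpr ?_
      filter_upwards [ae_mem_markedMeasure hΛ hp hp01] with y hy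
      unfold switchSize
      split_ifs
      · exact ⟨by linarith [hy.2], by linarith [hy.1]⟩
      · exact hy
    exact h
  · rw [lintegral_map_switchSize (by fun_prop)]
    refine ENNReal.add_lt_top.mpr ⟨?_, ?_⟩
    · refine lt_of_le_of_lt (b := ∫⁻ u, 1 ∂(Λ.withDensity fun u => ENNReal.ofReal (p u)))
        (lintegral_mono_ae ?_) ?_
      · filter_upwards [(withDensity_absolutelyContinuous Λ _).ae_le hΛ.ae_mem] with u hu
        rw [← ENNReal.ofReal_one]
        exact ENNReal.ofReal_le_ofReal (by linarith [hu.2])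
      · simpa using hpfin
    · exact lt_of_le_of_lt (lintegral_mono' (withDensity_one_sub_le hp hp01) le_rfl) hΛ.integrable

theorem IsPoissonRandomMeasure.factors (hΛ : IsSplittingMeasure Λ) (hp : Measurable p)
    (hp01 : ∀ u, p u ∈ Icc (0 : ℝ) 1)
    (hN : IsPoissonRandomMeasure P N ((volume.restrict (Ioi (0 : ℝ))).prod (markedMeasure Λ p))) :
    IsPoissonRandomMeasure P (fun ω => factors (N ω)) ((volume.restrict (Ioi (0 : ℝ))).prod Λ) := by
  have := hΛ.sigmaFinite_markedMeasure hp hp01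
  have h := hN.map (g := fun x : ℝ × ℝ × Bool => (x.1, x.2.1)) (by fun_prop)
  rwa [map_prod_snd _ measurable_fst, map_fst_markedMeasure hp hp01] at h

theorem IsPoissonRandomMeasure.switchedFactors (hΛ : IsSplittingMeasure Λ) (hp : Measurable p)
    (hp01 : ∀ u, p u ∈ Icc (0 : ℝ) 1)
    (hN : IsPoissonRandomMeasure P N ((volume.restrict (Ioi (0 : ℝ))).prod (markedMeasure Λ p))) :
    IsPoissonRandomMeasure P (fun ω => switchedFactors (N ω))
      ((volume.restrict (Ioi (0 : ℝ))).prod ((markedMeasure Λ p).map switchSize)) := by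
  have := hΛ.sigmaFinite_markedMeasure hp hp01
  have h := hN.map (g := fun x : ℝ × ℝ × Bool => (x.1, switchSize x.2))
    (measurable_fst.prodMk (measurable_switchSize.comp measurable_snd))
  rwa [map_prod_snd _ measurable_switchSize] at h

end Fragmenters

/-! ### The Markov property of a fragmenter alone -/

section MarkovPairConsequences

variable {Ω Ω' : Type*} [MeasurableSpace Ω] [MeasurableSpace Ω'] {μ : Measure Ω} {μ' : Measure Ω'}
  {M : ℝ≥0 → Ω → ℝ} {M' : ℝ≥0 → Ω' → ℝ}

theorem alive_top {Ω : Type*} (r : ℝ≥0) (ω : Ω) : alive (fun _ => ∞) r ω = 1 :=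
  alive_of_lt ENNReal.coe_lt_top

/-- The constant time ∞ encodes the Markov property of a process without a time attached. -/
theorem IsMarkovPair.of_identDistrib_top
    (h : IdentDistrib (fun ω t => M t ω) (fun ω t => M' t ω) μ μ')
    (H : IsMarkovPair μ' M' fun _ => ∞) : IsMarkovPair μ M fun _ => ∞ :=
  IsMarkovPair.of_identDistrib
    (h.comp (u := fun z : ℝ≥0 → ℝ => (z, (∞ : ℝ≥0∞))) (measurable_id.prodMk measurable_const)) H

theorem IsMarkovPair.top_integral (H : IsMarkovPair μ M fun _ => ∞) (t : ℝ≥0) (k l : List ℝ≥0)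
    (hk : ∀ s ∈ k, s ≤ t) :
    ∫ ω, (k.map fun s => M s ω).prod * (l.map (future M t ω)).prod ∂μ =
      (∫ ω, (k.map fun s => M s ω).prod ∂μ) * ∫ ω, (l.map fun s => M s ω).prod ∂μ := by
  simpa only [alive_top, mul_one] using H.after t t k l le_rfl hk

theorem ae_mem_Ioc_of_identDistrib {N : Ω' → Measure (ℝ × ℝ)}
    (h : IdentDistrib (fun ω t => M t ω) (fun ω t => factorProduct (N ω) t) μ μ') (t : ℝ≥0) :
    ∀ᵐ ω ∂μ, M t ω ∈ Ioc (0 : ℝ) 1 :=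
  (h.comp (u := fun z : ℝ≥0 → ℝ => z t) (measurable_pi_apply t)).symm.ae_mem_snd
    measurableSet_Ioc (ae_of_all _ fun ω => factorProduct_mem_Ioc (N ω) t)

theorem IsFragmenter.isMarkovPair {Λ : Measure ℝ} (h : IsFragmenter μ M Λ) :
    IsMarkovPair μ M fun _ => ∞ := by
  obtain ⟨Ω', _, P, _, N, hN, hlaw⟩ := h.law
  exact (isMarkovPair_factorProduct h.splitting hN).of_identDistrib_top hlaw

theorem IsFragmenter.ae_mem_Ioc {Λ : Measure ℝ} (h : IsFragmenter μ M Λ) (t : ℝ≥0) :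
    ∀ᵐ ω ∂μ, M t ω ∈ Ioc (0 : ℝ) 1 := by
  obtain ⟨Ω', _, P, _, N, hN, hlaw⟩ := h.law
  exact ae_mem_Ioc_of_identDistrib hlaw t

end MarkovPairConsequences

/-! ### The second process as a functional of the first, the splitting time and the later evolution
-/

section Gluing

theorem toNNReal_le_of_le_coe {a : ℝ≥0∞} {s : ℝ≥0} (h : a ≤ s) : a.toNNReal ≤ s := by
  simpa using ENNReal.toNNReal_mono ENNReal.coe_ne_top h

theorem lt_toNNReal_of_coe_lt {a : ℝ≥0∞} {t : ℝ≥0} (ha : a ≠ ∞) (h : (t : ℝ≥0∞) < a) :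
    t < a.toNNReal := by
  lift a to ℝ≥0 using ha
  simpa using h

theorem evalL_eq_of_tendsto {f : ℝ≥0 → ℝ} {t : ℝ≥0} (ht : 0 < t) {a : ℝ}
    (h : Tendsto f (𝓝[<] t) (𝓝 a)) : evalL f t = a :=
  (h.comp (tendsto_gridL ht)).limsup_eq

/-- The path which follows `z.1` up to the time `z.2`, takes the value of the jump of `z.1` at
that time, and then evolves multiplicatively as `r`. -/
noncomputable def glue (z : (ℝ≥0 → ℝ) × ℝ≥0∞) (r : ℝ≥0 → ℝ) (v : ℝ≥0) : ℝ :=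
  if (v : ℝ≥0∞) < z.2 then z.1 v
  else (evalL z.1 z.2.toNNReal - evalR z.1 z.2.toNNReal) * evalR r (v - z.2.toNNReal)

theorem measurable_glue {α : Type*} [MeasurableSpace α] {z : α → (ℝ≥0 → ℝ) × ℝ≥0∞}
    {r : α → ℝ≥0 → ℝ} (hz : Measurable z) (hr : Measurable r) (v : ℝ≥0) :
    Measurable fun a => glue (z a) (r a) v := by
  have h1 : Measurable fun a => (z a).1 := hz.fst
  have h2 : Measurable fun a => (z a).2.toNNReal := hz.snd.ennreal_toNNReal
  refine Measurable.ite (measurableSet_lt measurable_const hz.snd)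
    ((measurable_pi_apply v).comp h1) ?_
  exact ((measurable_evalL h1 h2).sub (measurable_evalR h1 h2)).mul
    (measurable_evalR hr (measurable_const.sub h2))

/-- The normalised evolution of `M'` after the time `τ`. -/
noncomputable def postSplit {Ω : Type*} (M' : ℝ≥0 → Ω → ℝ) (τ : Ω → ℝ≥0∞) (v : ℝ≥0) (ω : Ω) : ℝ :=
  M' ((τ ω).toNNReal + v) ω / M' (τ ω).toNNReal ω

theorem tendsto_add_left_nhdsLT {t σ : ℝ≥0} (h : t ≤ σ) :
    Tendsto (fun v => t + v) (𝓝[<] (σ - t)) (𝓝[<] σ) := by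
  refine tendsto_nhdsWithin_iff.mpr ⟨?_, ?_⟩
  · have : Tendsto (fun v : ℝ≥0 => t + v) (𝓝 (σ - t)) (𝓝 (t + (σ - t))) :=
      (continuous_const.add continuous_id).tendsto _
    rw [add_tsub_cancel_of_le h] at this
    exact this.mono_left nhdsWithin_le_nhds
  · filter_upwards [self_mem_nhdsWithin] with v hv
    exact lt_tsub_iff_left.mp (show v < σ - t from hv)

theorem continuousWithinAt_add_left {f : ℝ≥0 → ℝ} (t v : ℝ≥0)
    (hf : ContinuousWithinAt f (Ici (t + v)) (t + v)) :
    ContinuousWithinAt (fun v => f (t + v)) (Ici v) v :=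
  ContinuousWithinAt.comp (f := fun v : ℝ≥0 => t + v) (t := Ici (t + v)) hf
    (continuous_const.add continuous_id).continuousWithinAt
    fun _ hw => add_le_add_right (show v ≤ _ from hw) t

theorem IsPureJumpPath.future_mem_Ioc {f : ℝ≥0 → ℝ} (hf : IsPureJumpPath f) (t v : ℝ≥0) :
    f (t + v) / f t ∈ Ioc (0 : ℝ) 1 :=
  ⟨div_pos (hf.pos _) (hf.pos _), (div_le_one (hf.pos _)).mpr (hf.antitone le_self_add)⟩

variable {Ω : Type*} {M M' : ℝ≥0 → Ω → ℝ} {τ : Ω → ℝ≥0∞} {ω : Ω}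

theorem continuousWithinAt_postSplit (hM' : IsPureJumpPath fun t => M' t ω) (v : ℝ≥0) :
    ContinuousWithinAt (fun v => postSplit M' τ v ω) (Ici v) v :=
  (continuousWithinAt_add_left _ v (hM'.right_continuous _)).div_const _

theorem postSplit_mem_Ioc (hM' : IsPureJumpPath fun t => M' t ω) (v : ℝ≥0) :
    postSplit M' τ v ω ∈ Ioc (0 : ℝ) 1 :=
  hM'.future_mem_Ioc _ _

section

variable (hM : IsPureJumpPath fun t => M t ω) (hM' : IsPureJumpPath fun t => M' t ω)
  (hτ : 0 < τ ω ∧ τ ω < ∞)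
  (h1 : ∀ t : ℝ≥0, (t : ℝ≥0∞) < τ ω → M' t ω = M t ω)
  (h2 : M' (τ ω).toNNReal ω =
    Function.leftLim (fun t => M t ω) (τ ω).toNNReal - M (τ ω).toNNReal ω)

include hM' in
theorem apply_eq_mul_postSplit {s : ℝ≥0} (hs : τ ω ≤ s) :
    M' s ω = M' (τ ω).toNNReal ω * postSplit M' τ (s - (τ ω).toNNReal) ω := by
  have hσ : (τ ω).toNNReal ≤ s := toNNReal_le_of_le_coe hs
  rw [postSplit, add_tsub_cancel_of_le hσ, mul_div_cancel₀ _ (hM'.pos _).ne']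

include hM hM' hτ h1 h2 in
theorem apply_eq_glue (s : ℝ≥0) :
    M' s ω = glue (fun t => M t ω, τ ω) (fun v => postSplit M' τ v ω) s := by
  have hσ0 : 0 < (τ ω).toNNReal := ENNReal.toNNReal_pos hτ.1.ne' hτ.2.ne
  unfold glue
  split_ifs with hs
  · exact h1 s hs
  · simp only
    rw [evalL_eq hM.antitone hσ0, evalR_eq (hM.right_continuous _),
      evalR_eq (continuousWithinAt_postSplit hM' _), ← h2]
    exact apply_eq_mul_postSplit hM' (not_lt.mp hs)

-- When τ ≤ t and s ≤ t, the path of M enters only up to time t, so stopping it at t loses nothing;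
-- this allows independence from the future of M after t.
include hM hM' hτ h1 h2 in
theorem apply_eq_glue_stopped {t s : ℝ≥0} (ht : τ ω ≤ t) (hs : s ≤ t) :
    M' s ω = glue (fun s => M (min s t) ω, τ ω) (fun v => postSplit M' τ v ω) s := by
  have hσ0 : 0 < (τ ω).toNNReal := ENNReal.toNNReal_pos hτ.1.ne' hτ.2.ne
  have hσt : (τ ω).toNNReal ≤ t := toNNReal_le_of_le_coe ht
  unfold glue
  split_ifs with hs'
  · simp only [min_eq_left hs]
    exact h1 s hs'
  · have hL : evalL (fun s => M (min s t) ω) (τ ω).toNNReal =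
        Function.leftLim (fun t => M t ω) (τ ω).toNNReal := by
      refine evalL_eq_of_tendsto hσ0 ((hM.antitone.tendsto_leftLim _).congr' ?_)
      filter_upwards [self_mem_nhdsWithin] with v hv
      rw [min_eq_left ((show v < _ from hv).le.trans hσt)]
    have hR : evalR (fun s => M (min s t) ω) (τ ω).toNNReal = M (τ ω).toNNReal ω := by
      have hc : ContinuousWithinAt (fun s => M (min s t) ω) (Ici (τ ω).toNNReal)
          (τ ω).toNNReal :=
        ContinuousWithinAt.comp (f := fun s : ℝ≥0 => min s t)
          (t := Ici (min (τ ω).toNNReal t)) (hM.right_continuous _)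
          (continuous_id.min continuous_const).continuousWithinAt
          fun w hw => min_le_min_right t (show _ ≤ w from hw)
      rw [evalR_eq hc, min_eq_left hσt]
    simp only
    rw [hL, hR, evalR_eq (continuousWithinAt_postSplit hM' _), ← h2]
    exact apply_eq_mul_postSplit hM' (not_lt.mp hs')

-- The functional `glue` is homogeneous in the first path and compatible with time shifts, so before
-- τ the future has the same form, with residual time τ - t and unchanged later evolution.
include hM hM' hτ h1 h2 in
theorem future_eq_glue {t : ℝ≥0} (ht : (t : ℝ≥0∞) < τ ω) (v : ℝ≥0) :
    future M' t ω v =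
      glue (future M t ω, τ ω - t) (fun v => postSplit M' τ v ω) v := by
  have hσt : t < (τ ω).toNNReal := lt_toNNReal_of_coe_lt hτ.2.ne ht
  have hsub : (τ ω - t).toNNReal = (τ ω).toNNReal - t := by
    rw [ENNReal.toNNReal_sub ENNReal.coe_ne_top, ENNReal.toNNReal_coe]
  have hpos : 0 < (τ ω).toNNReal - t := tsub_pos_of_lt hσt
  have hL : evalL (future M t ω) ((τ ω).toNNReal - t) =
      Function.leftLim (fun t => M t ω) (τ ω).toNNReal / M t ω :=
    evalL_eq_of_tendsto hpos
      (((hM.antitone.tendsto_leftLim _).comp (tendsto_add_left_nhdsLT hσt.le)).div_const _)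
  have hR : evalR (future M t ω) ((τ ω).toNNReal - t) = M (τ ω).toNNReal ω / M t ω := by
    have := evalR_eq (f := future M t ω) (t := (τ ω).toNNReal - t)
      ((continuousWithinAt_add_left t _ (hM.right_continuous _)).div_const _)
    rw [this, future, add_tsub_cancel_of_le hσt.le]
  have hlt : ((v : ℝ≥0∞) < τ ω - t) ↔ ((t + v : ℝ≥0) : ℝ≥0∞) < τ ω := by
    rw [lt_tsub_iff_left, ENNReal.coe_add]
  unfold glue
  simp only [hlt, hsub]
  split_ifs with hs
  · rw [future, future, h1 _ hs, h1 _ ht]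
  · rw [hL, hR, evalR_eq (continuousWithinAt_postSplit hM' _), ← sub_div, ← h2, future,
      apply_eq_mul_postSplit hM' (not_lt.mp hs), h1 _ ht]
    have : t + v - (τ ω).toNNReal = v - ((τ ω).toNNReal - t) := by
      rw [tsub_tsub_eq_add_tsub_of_le hσt.le, add_comm]
    rw [this]
    ring

include hM' in
theorem future_eq_div_postSplit {t : ℝ≥0} (ht : τ ω ≤ t) (v : ℝ≥0) :
    future M' t ω v = postSplit M' τ (t - (τ ω).toNNReal + v) ω /
      postSplit M' τ (t - (τ ω).toNNReal) ω := by
  have hσt : (τ ω).toNNReal ≤ t := toNNReal_le_of_le_coe ht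
  unfold future postSplit
  rw [← add_assoc, add_tsub_cancel_of_le hσt, div_div_div_cancel_right₀ (hM'.pos _).ne']

end

end Gluing

/-! ### Reordering factors of product laws -/

section Rearrange

variable {Ω α β γ : Type*} [MeasurableSpace Ω] [MeasurableSpace α] [MeasurableSpace β]
  [MeasurableSpace γ] {ρ : Measure Ω} {X : Ω → α} {Y : Ω → β} {R : Ω → γ} {ν₀ : Measure α}
  {ν₁ : Measure β} {ν₂ : Measure γ} [SFinite ν₀] [SFinite ν₁] [SFinite ν₂]

theorem map_prodMk_assoc (hX : Measurable X) (hY : Measurable Y) (hR : Measurable R)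
    (h : ρ.map (fun ω => ((X ω, Y ω), R ω)) = (ν₀.prod ν₁).prod ν₂) :
    ρ.map (fun ω => (X ω, (Y ω, R ω))) = ν₀.prod (ν₁.prod ν₂) := by
  have := congrArg (Measure.map MeasurableEquiv.prodAssoc) h
  rw [Measure.prodAssoc_prod, Measure.map_map (MeasurableEquiv.measurable _)
    ((hX.prodMk hY).prodMk hR)] at this
  exact this

theorem map_prodMk_assoc_symm (hX : Measurable X) (hY : Measurable Y) (hR : Measurable R)
    (h : ρ.map (fun ω => (X ω, (Y ω, R ω))) = ν₀.prod (ν₁.prod ν₂)) :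
    ρ.map (fun ω => ((X ω, Y ω), R ω)) = (ν₀.prod ν₁).prod ν₂ := by
  rw [← Measure.prodAssoc_prod] at h
  have := congrArg (Measure.map MeasurableEquiv.prodAssoc.symm) h
  rw [Measure.map_map (MeasurableEquiv.measurable _) (MeasurableEquiv.measurable _),
    Measure.map_map (MeasurableEquiv.measurable _) (hX.prodMk (hY.prodMk hR)),
    MeasurableEquiv.symm_comp_self, Measure.map_id] at this
  exact this

theorem map_prodMk_right_comm (hX : Measurable X) (hY : Measurable Y) (hR : Measurable R)
    (h : ρ.map (fun ω => ((X ω, Y ω), R ω)) = (ν₀.prod ν₁).prod ν₂) :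
    ρ.map (fun ω => ((X ω, R ω), Y ω)) = (ν₀.prod ν₂).prod ν₁ := by
  refine map_prodMk_assoc_symm hX hR hY ?_
  have h1 := map_prodMk_assoc hX hY hR h
  have := congrArg (Measure.map (Prod.map id Prod.swap)) h1
  rw [Measure.map_map (measurable_id.prodMap measurable_swap) (hX.prodMk (hY.prodMk hR)),
    ← Measure.map_prod_map _ _ measurable_id measurable_swap, Measure.map_id,
    Measure.prod_swap] at this
  exact this

end Rearrange

/-! ### Path-level Markov property of (M, τ) on the events τ > t and τ ≤ t -/

section RestrictedLaws

variable {Ω : Type*} [MeasurableSpace Ω] {μ : Measure Ω} [IsProbabilityMeasure μ]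
  {M : ℝ≥0 → Ω → ℝ} {τ : Ω → ℝ≥0∞}

theorem alive_add {Ω : Type*} (τ : Ω → ℝ≥0∞) (t r : ℝ≥0) (ω : Ω) :
    alive τ (t + r) ω = alive (fun ω => τ ω - t) r ω := by
  simp only [alive, indicator_apply, Set.mem_ofPred_eq, lt_tsub_iff_left, ENNReal.coe_add]

theorem alive_mul_alive_of_le {Ω : Type*} (τ : Ω → ℝ≥0∞) {r t : ℝ≥0} (h : r ≤ t) (ω : Ω) :
    alive τ r ω * alive τ t ω = alive τ t ω := by
  by_cases ht : (t : ℝ≥0∞) < τ ω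
  · rw [alive_of_lt (lt_of_le_of_lt (by exact_mod_cast h) ht), one_mul]
  · rw [alive_of_le (not_lt.mp ht), mul_zero]

theorem alive_min_of_le {Ω : Type*} {τ : Ω → ℝ≥0∞} {t : ℝ≥0} {ω : Ω} (h : τ ω ≤ t) (r : ℝ≥0) :
    alive τ (min r t) ω = alive τ r ω := by
  rcases le_total r t with hr | hr
  · rw [min_eq_left hr]
  · rw [min_eq_right hr, alive_of_le h, alive_of_le (h.trans (by exact_mod_cast hr))]

theorem setIntegral_lt_eq {μ : Measure Ω} (hτ : Measurable τ) (t : ℝ≥0) (f : Ω → ℝ) :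
    ∫ ω in {ω | (t : ℝ≥0∞) < τ ω}, f ω ∂μ = ∫ ω, f ω * alive τ t ω ∂μ := by
  rw [← integral_indicator (measurableSet_lt measurable_const hτ)]
  refine integral_congr_ae (ae_of_all _ fun ω => ?_)
  simp [alive, indicator_apply]

theorem setIntegral_le_eq {μ : Measure Ω} (hτ : Measurable τ) (t : ℝ≥0) {f : Ω → ℝ} (hf : Integrable f μ) :
    ∫ ω in {ω | τ ω ≤ t}, f ω ∂μ = ∫ ω, f ω ∂μ - ∫ ω, f ω * alive τ t ω ∂μ := by
  rw [← setIntegral_lt_eq hτ, eq_sub_iff_add_eq, add_comm]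
  have hc : {ω | τ ω ≤ t} = {ω | (t : ℝ≥0∞) < τ ω}ᶜ := by ext; simp
  rw [hc]
  exact integral_add_compl (measurableSet_lt measurable_const hτ) hf

section

variable (hM : ∀ t, Measurable (M t)) (hτm : Measurable τ) (H : IsMarkovPair μ M τ)
  (h01 : ∀ t, ∀ᵐ ω ∂μ, M t ω ∈ Icc (0 : ℝ) 1) (hf01 : ∀ t v ω, future M t ω v ∈ Icc (0 : ℝ) 1)
  (hτ : ∀ᵐ ω ∂μ, 0 < τ ω)

include hM hτm H h01 hf01 hτ

/-- Given `τ > t`, the future after `t` is a copy of the process independent of its past. -/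
theorem IsMarkovPair.restrict_lt_map (t : ℝ≥0) :
    (μ.restrict {ω | (t : ℝ≥0∞) < τ ω}).map
        (fun ω => ((fun s : Iic t => M s ω), (future M t ω, τ ω - t))) =
      ((μ.restrict {ω | (t : ℝ≥0∞) < τ ω}).map fun ω (s : Iic t) => M s ω).prod
        (μ.map fun ω => ((fun t => M t ω : ℝ≥0 → ℝ), τ ω)) := by
  -- The residual time τ - t is represented by the indicators of τ > t + r and recovered from them
  -- by `lifetime`.
  let Y : ℝ≥0 ⊕ ℝ≥0 → Ω → ℝ := Sum.elim (fun v ω => future M t ω v) (fun r => alive τ (t + r))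
  let Y' : ℝ≥0 ⊕ ℝ≥0 → Ω → ℝ := Sum.elim M (alive τ)
  have hY : ∀ i, Measurable (Y i) := by
    rintro (i | i); exacts [measurable_future hM t i, measurable_alive hτm _]
  have hY' : ∀ i, Measurable (Y' i) := by
    rintro (i | i); exacts [hM i, measurable_alive hτm _]
  have key := map_prodMk_eq_prod_of_moments (μ := μ.restrict {ω | (t : ℝ≥0∞) < τ ω})
    (μ₁ := μ.restrict {ω | (t : ℝ≥0∞) < τ ω}) (μ₂ := μ)
    (X := fun (s : Iic t) ω => M s ω) (X' := fun (s : Iic t) ω => M s ω) (Y := Y) (Y' := Y')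
    (fun s => hM s) hY (fun s => hM s) hY' (fun s => ae_restrict_of_ae (h01 s))
    (by
      rintro (i | i)
      exacts [ae_of_all _ fun ω => hf01 t i ω, ae_of_all _ fun ω => alive_mem_Icc _ _ _])
    (fun s => ae_restrict_of_ae (h01 s))
    (by rintro (i | i); exacts [h01 i, ae_of_all _ fun ω => alive_mem_Icc _ _ _])
    fun k l => by
      rw [setIntegral_lt_eq hτm, setIntegral_lt_eq hτm]
      have hk : ∀ s ∈ k.map Subtype.val, s ≤ t := fun s hs => by
        obtain ⟨s', _, rfl⟩ := List.mem_map.mp hs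
        exact s'.2
      have := H.before t ((l.filterMap Sum.getRight?).foldr max 0) (k.map Subtype.val)
        (l.filterMap Sum.getLeft?) hk
      simp only [List.map_map, Function.comp_def] at this
      convert this using 1
      · refine integral_congr_ae ?_
        filter_upwards [hτ] with ω hω
        have e1 : (l.map fun i => Y i ω).prod =
            ((l.filterMap Sum.getLeft?).map (future M t ω)).prod *
              ((l.filterMap Sum.getRight?).map fun r => alive τ (t + r) ω).prod := by
          rw [← prod_map_sumElim]
          congr 2
          funext i
          cases i <;> rfl
        rw [e1]
        by_cases ht : (t : ℝ≥0∞) < τ ω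
        · simp only [alive_add]
          rw [prod_map_alive (τ := fun ω => τ ω - t) (ω := ω) (tsub_pos_of_lt ht), alive_of_lt ht]
          ring
        · rw [alive_of_le (not_lt.mp ht),
            alive_of_le ((not_lt.mp ht).trans (by exact_mod_cast le_self_add))]
          ring
      · congr 1
        refine integral_congr_ae ?_
        filter_upwards [hτ] with ω hω
        rw [← prod_map_alive hω, ← prod_map_sumElim]
        congr 2
        funext i
        cases i <;> rfl
  let g : (ℝ≥0 ⊕ ℝ≥0 → ℝ) → (ℝ≥0 → ℝ) × ℝ≥0∞ := fun z =>
    (fun t => z (.inl t), lifetime fun r => z (.inr r))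
  have hg : Measurable g :=
    (measurable_pi_lambda _ fun t => measurable_pi_apply _).prodMk
      (measurable_lifetime.comp (measurable_pi_lambda _ fun t => measurable_pi_apply _))
  have h2 := map_prodMk_comp_of_eq_prod (measurable_pi_lambda _ fun s : Iic t => hM s).aemeasurable
    (measurable_pi_lambda _ hY).aemeasurable key measurable_id hg
  rw [Measure.map_map hg (measurable_pi_lambda _ hY')] at h2
  have e3 : ∀ ω, g (fun i => Y i ω) = (future M t ω, τ ω - t) := fun ω => by
    refine Prod.ext rfl ?_
    simp only [g, Y, Sum.elim_inr, alive_add]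
    exact lifetime_alive (fun ω => τ ω - t) ω
  have e4 : (g ∘ fun ω i => Y' i ω) = fun ω => ((fun t => M t ω : ℝ≥0 → ℝ), τ ω) := by
    funext ω
    exact Prod.ext rfl (lifetime_alive τ ω)
  rw [e4, Measure.map_congr (ae_of_all _ fun ω => Prod.ext rfl (e3 ω) :
    (fun ω => (id (fun s : Iic t => M s ω), g (fun i => Y i ω))) =ᵐ[_]
      fun ω => ((fun s : Iic t => M s ω), (future M t ω, τ ω - t)))] at h2
  exact h2

/-- Given `τ ≤ t`, the future of `M` after `t` is a copy of `M` independent of its past and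
of `τ`. -/
theorem IsMarkovPair.restrict_le_map (t : ℝ≥0) :
    (μ.restrict {ω | τ ω ≤ t}).map
        (fun ω => (((fun s => M (min s t) ω : ℝ≥0 → ℝ), τ ω), future M t ω)) =
      ((μ.restrict {ω | τ ω ≤ t}).map fun ω =>
        ((fun s => M (min s t) ω : ℝ≥0 → ℝ), τ ω)).prod (μ.map fun ω t => M t ω) := by
  -- Truncating all times at t keeps them in the range of the `after` property; when τ ≤ t the
  -- indicator at min r t equals the one at r, so τ is still determined.
  let X : ℝ≥0 ⊕ ℝ≥0 → Ω → ℝ := Sum.elim (fun s => M (min s t)) (fun r => alive τ (min r t))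
  have hX : ∀ i, Measurable (X i) := by
    rintro (i | i); exacts [hM _, measurable_alive hτm _]
  have hX01 : ∀ i, ∀ᵐ ω ∂(μ.restrict {ω | τ ω ≤ t}), X i ω ∈ Icc (0 : ℝ) 1 := by
    rintro (i | i)
    exacts [ae_restrict_of_ae (h01 _), ae_of_all _ fun ω => alive_mem_Icc _ _ _]
  have hXe : ∀ (k : List (ℝ≥0 ⊕ ℝ≥0)) (ω : Ω), 0 < τ ω → (k.map fun i => X i ω).prod =
      (((k.filterMap Sum.getLeft?).map fun s => min s t).map fun s => M s ω).prod *
        alive τ (((k.filterMap Sum.getRight?).map fun r => min r t).foldr max 0) ω := by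
    intro k ω hω
    rw [← prod_map_alive hω, List.map_map, List.map_map, ← prod_map_sumElim]
    congr 2
    funext i
    cases i <;> rfl
  have hle : ∀ k : List ℝ≥0, (k.map fun r => min r t).foldr max 0 ≤ t := by
    intro k
    induction k with
    | nil => simp
    | cons a k ih => simpa using ih
  have hmem : ∀ (k : List ℝ≥0), ∀ s ∈ k.map fun s => min s t, s ≤ t := fun k s hs => by
    obtain ⟨s', _, rfl⟩ := List.mem_map.mp hs
    exact min_le_right _ _
  have h_int : ∀ (k : List (ℝ≥0 ⊕ ℝ≥0)) (l : List ℝ≥0), Integrable (fun ω =>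
      (k.map fun i => X i ω).prod * (l.map (future M t ω)).prod) μ := by
    intro k l
    refine integrable_of_mem_Icc ((measurable_list_prod_map fun i _ => hX i).mul
      (measurable_prod_future hM t l)).aestronglyMeasurable ?_
    have : ∀ᵐ ω ∂μ, ∀ i ∈ k, X i ω ∈ Icc (0 : ℝ) 1 := by
      refine (ae_ball_iff (S := {i | i ∈ k}) k.finite_toSet.countable).mpr ?_
      rintro (i | i) _
      exacts [h01 _, ae_of_all _ fun ω => alive_mem_Icc _ _ _]
    filter_upwards [this] with ω hω
    exact unitInterval.mul_mem (list_prod_map_mem_Icc hω)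
      (list_prod_map_mem_Icc fun v _ => hf01 t v ω)
  have key := map_prodMk_eq_prod_of_moments (μ := μ.restrict {ω | τ ω ≤ t})
    (μ₁ := μ.restrict {ω | τ ω ≤ t}) (μ₂ := μ) (X := X) (X' := X)
    (Y := fun v ω => future M t ω v) (Y' := M)
    hX (measurable_future hM t) hX hM hX01 (fun v => ae_of_all _ fun ω => hf01 t v ω) hX01 h01
    fun k l => by
      have hint1 : Integrable (fun ω => (k.map fun i => X i ω).prod) μ := by
        simpa using h_int k []
      -- The integral over τ ≤ t is the full one minus that over τ > t. Both are instances of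
      -- `after`, with indicators at r and at t, and they share the factor of the future.
      rw [setIntegral_le_eq hτm t (h_int k l), setIntegral_le_eq hτm t hint1]
      set k1 := (k.filterMap Sum.getLeft?).map fun s => min s t with hk1
      set r := ((k.filterMap Sum.getRight?).map fun r => min r t).foldr max 0 with hr
      have hrt : r ≤ t := hle _
      have a1 := H.after t r k1 l hrt (hmem _)
      have a2 := H.after t t k1 l le_rfl (hmem _)
      have b1 : ∫ ω, (k.map fun i => X i ω).prod * (l.map (future M t ω)).prod ∂μ =
          ∫ ω, (k1.map fun s => M s ω).prod * (l.map (future M t ω)).prod * alive τ r ω ∂μ := by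
        refine integral_congr_ae ?_
        filter_upwards [hτ] with ω hω
        rw [hXe k ω hω]; ring
      have b2 : ∫ ω, (k.map fun i => X i ω).prod * (l.map (future M t ω)).prod *
            alive τ t ω ∂μ =
          ∫ ω, (k1.map fun s => M s ω).prod * (l.map (future M t ω)).prod * alive τ t ω ∂μ := by
        refine integral_congr_ae ?_
        filter_upwards [hτ] with ω hω
        rw [hXe k ω hω, ← hk1, ← hr, ← alive_mul_alive_of_le τ hrt ω]; ring_nf
        have : alive τ r ω ^ 2 = alive τ r ω := by
          rw [sq, alive_mul_alive_of_le τ le_rfl]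
        rw [this]
      have b3 : ∫ ω, (k.map fun i => X i ω).prod ∂μ =
          ∫ ω, (k1.map fun s => M s ω).prod * alive τ r ω ∂μ := by
        refine integral_congr_ae ?_
        filter_upwards [hτ] with ω hω
        rw [hXe k ω hω]
      have b4 : ∫ ω, (k.map fun i => X i ω).prod * alive τ t ω ∂μ =
          ∫ ω, (k1.map fun s => M s ω).prod * alive τ t ω ∂μ := by
        refine integral_congr_ae ?_
        filter_upwards [hτ] with ω hω
        rw [hXe k ω hω, mul_assoc, alive_mul_alive_of_le τ hrt]
      rw [b1, b2, b3, b4, a1, a2]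
      ring
  let g : (ℝ≥0 ⊕ ℝ≥0 → ℝ) → (ℝ≥0 → ℝ) × ℝ≥0∞ := fun z =>
    (fun t => z (.inl t), lifetime fun r => z (.inr r))
  have hg : Measurable g :=
    (measurable_pi_lambda _ fun t => measurable_pi_apply _).prodMk
      (measurable_lifetime.comp (measurable_pi_lambda _ fun t => measurable_pi_apply _))
  have h2 := map_prodMk_comp_of_eq_prod (measurable_pi_lambda _ hX).aemeasurable
    (measurable_pi_lambda _ (measurable_future hM t)).aemeasurable key hg measurable_id
  rw [Measure.map_id] at h2
  have e3 : ∀ᵐ ω ∂(μ.restrict {ω | τ ω ≤ t}), g (fun i => X i ω) =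
      ((fun s => M (min s t) ω : ℝ≥0 → ℝ), τ ω) := by
    refine (ae_restrict_iff' (measurableSet_le hτm measurable_const)).mpr
      (ae_of_all _ fun ω hω => ?_)
    refine Prod.ext rfl ?_
    simp only [g, X, Sum.elim_inr, alive_min_of_le (show τ ω ≤ t from hω)]
    exact lifetime_alive τ ω
  have e4 : (μ.restrict {ω | τ ω ≤ t}).map
        (fun ω => (((fun s => M (min s t) ω : ℝ≥0 → ℝ), τ ω), future M t ω)) =
      (μ.restrict {ω | τ ω ≤ t}).map (fun ω => (g (fun i => X i ω), id (future M t ω))) :=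
    Measure.map_congr (e3.mono fun ω hω => by simp only [hω, id])
  have e5 : (μ.restrict {ω | τ ω ≤ t}).map
        (fun ω => ((fun s => M (min s t) ω : ℝ≥0 → ℝ), τ ω)) =
      (μ.restrict {ω | τ ω ≤ t}).map (fun ω => g (fun i => X i ω)) :=
    Measure.map_congr (e3.mono fun ω hω => by simp only [hω])
  rw [e4, e5]
  exact h2

end

end RestrictedLaws

/-! ### From bifurcators to the asymmetric Markov branching property -/

section Branching

theorem leftLim_eq_of_eq_before {f g : ℝ≥0 → ℝ} (hf : Antitone f) (hg : Antitone g) {σ : ℝ≥0}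
    (hσ : 0 < σ) (h : ∀ t < σ, f t = g t) : Function.leftLim f σ = Function.leftLim g σ := by
  rw [← evalL_eq hf hσ]
  refine evalL_eq_of_tendsto hσ ((hg.tendsto_leftLim σ).congr' ?_)
  filter_upwards [self_mem_nhdsWithin] with v hv
  exact (h v hv).symm

theorem integral_comp_indepFun {Ω α β : Type*} [MeasurableSpace Ω] [MeasurableSpace α]
    [MeasurableSpace β] {μ : Measure Ω} [IsProbabilityMeasure μ] {Z : Ω → α} {R : Ω → β}
    (hZ : Measurable Z) (hR : Measurable R) (h : IndepFun R Z μ) {F : α × β → ℝ}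
    (hF : Measurable F) (h_int : Integrable (fun ω => F (Z ω, R ω)) μ) :
    ∫ ω, F (Z ω, R ω) ∂μ = ∫ ω, ∫ ω', F (Z ω, R ω') ∂μ ∂μ := by
  have h1 := (indepFun_iff_map_prod_eq_prod_map_map hZ.aemeasurable hR.aemeasurable).mp h.symm
  have hi : Integrable F ((μ.map Z).prod (μ.map R)) := by
    rw [← h1]
    exact (integrable_map_measure hF.aestronglyMeasurable (hZ.prodMk hR).aemeasurable).mpr h_int
  rw [← integral_map (hZ.prodMk hR).aemeasurable hF.aestronglyMeasurable, h1, integral_prod F hi,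
    integral_map hZ.aemeasurable hi.aestronglyMeasurable.integral_prod_right']
  refine integral_congr_ae (ae_of_all _ fun ω => ?_)
  exact integral_map hR.aemeasurable (hF.comp measurable_prodMk_left).aestronglyMeasurable

/-- With the first path and the splitting time frozen, a monomial in the glued path is a constant
times a monomial in r at times at most t - τ, to which the Markov property of r at that time
applies. -/
theorem exists_prod_map_glue (z : (ℝ≥0 → ℝ) × ℝ≥0∞) {t : ℝ≥0} (k : List (Iic t)) :
    ∃ (C : ℝ) (k' : List ℝ≥0), (∀ s ∈ k', s ≤ t - z.2.toNNReal) ∧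
      ∀ r : ℝ≥0 → ℝ, (∀ v, evalR r v = r v) →
        (k.map fun s : Iic t => glue z r s).prod = C * (k'.map r).prod := by
  induction k with
  | nil => exact ⟨1, [], by simp, by simp⟩
  | cons s k ih =>
    obtain ⟨C, k', hk', h⟩ := ih
    by_cases hs : ((s : ℝ≥0) : ℝ≥0∞) < z.2
    · refine ⟨z.1 s * C, k', hk', fun r hr => ?_⟩
      rw [List.map_cons, List.prod_cons, h r hr, glue, if_pos hs, mul_assoc]
    · refine ⟨(evalL z.1 z.2.toNNReal - evalR z.1 z.2.toNNReal) * C, (s - z.2.toNNReal) :: k',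
        ?_, fun r hr => ?_⟩
      · intro v hv
        rcases List.mem_cons.mp hv with rfl | hv
        · exact tsub_le_tsub_right s.2 _
        · exact hk' v hv
      · rw [List.map_cons, List.prod_cons, h r hr, glue, if_neg hs, hr, List.map_cons,
          List.prod_cons]
        ring

variable {Ω : Type*} [MeasurableSpace Ω] {μ : Measure Ω}
  {M M' : ℝ≥0 → Ω → ℝ} {τ : Ω → ℝ≥0∞}

theorem tendsto_integral_alive [IsProbabilityMeasure μ] (hτm : Measurable τ)
    (hτ : ∀ᵐ ω ∂μ, τ ω < ∞) : Tendsto (fun n : ℕ => ∫ ω, alive τ n ω ∂μ) atTop (𝓝 0) := by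
  rw [← integral_zero Ω ℝ (μ := μ)]
  refine tendsto_integral_of_dominated_convergence (fun _ => 1)
    (fun n => (measurable_alive hτm _).aestronglyMeasurable)
    (integrable_const _) (fun n => ae_of_all _ fun ω => ?_) ?_
  · rw [Real.norm_eq_abs, abs_of_nonneg (alive_mem_Icc _ _ _).1]
    exact (alive_mem_Icc _ _ _).2
  · filter_upwards [hτ] with ω hω
    obtain ⟨n, hn⟩ := ENNReal.exists_nat_gt hω.ne
    refine tendsto_const_nhds.congr' ?_
    filter_upwards [eventually_ge_atTop n] with m hm
    refine (alive_of_le (hn.le.trans ?_)).symm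
    exact_mod_cast hm

theorem measurable_postSplit (hM' : IsPureJumpProcess M') (hτm : Measurable τ) (v : ℝ≥0) :
    Measurable (postSplit M' τ v) :=
  (measurable_apply_of_rightContinuous hM'.measurable (fun ω t => (hM'.path ω).right_continuous t)
    (hτm.ennreal_toNNReal.add_const v)).div
  (measurable_apply_of_rightContinuous hM'.measurable (fun ω t => (hM'.path ω).right_continuous t)
    hτm.ennreal_toNNReal)

theorem IsPureJumpProcess.future_mem_Icc (hM : IsPureJumpProcess M) (t v : ℝ≥0) (ω : Ω) :
    future M t ω v ∈ Icc (0 : ℝ) 1 :=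
  Ioc_subset_Icc_self ((hM.path ω).future_mem_Ioc t v)

/-- The ingredients of the branching property: `(M, τ)` is a Markov pair, and `M'` splits off
from `M` at `τ` and evolves after `τ` as an independent Markov process. -/
structure IsSplitOff (μ : Measure Ω) (M M' : ℝ≥0 → Ω → ℝ) (τ : Ω → ℝ≥0∞) : Prop where
  left : IsPureJumpProcess M
  right : IsPureJumpProcess M'
  measurable_time : Measurable τ
  time : ∀ᵐ ω ∂μ, 0 < τ ω ∧ τ ω < ∞
  left_mem : ∀ t, ∀ᵐ ω ∂μ, M t ω ∈ Icc (0 : ℝ) 1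
  right_mem : ∀ t, ∀ᵐ ω ∂μ, M' t ω ∈ Icc (0 : ℝ) 1
  markov : IsMarkovPair μ M τ
  markov_right : IsMarkovPair μ M' fun _ => ∞
  markov_post : IsMarkovPair μ (postSplit M' τ) fun _ => ∞
  eq_before : ∀ᵐ ω ∂μ, ∀ t : ℝ≥0, (t : ℝ≥0∞) < τ ω → M' t ω = M t ω
  eq_jump : ∀ᵐ ω ∂μ, M' (τ ω).toNNReal ω =
    Function.leftLim (fun t => M t ω) (τ ω).toNNReal - M (τ ω).toNNReal ω
  indep : IndepFun (fun ω v => postSplit M' τ v ω) (fun ω => ((fun t => M t ω : ℝ≥0 → ℝ), τ ω)) μ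

namespace IsSplitOff

variable (h : IsSplitOff μ M M' τ)

include h

theorem measurable_post : Measurable fun ω v => postSplit M' τ v ω :=
  measurable_pi_lambda _ fun v => measurable_postSplit h.right h.measurable_time v

theorem measurable_pair : Measurable fun ω => ((fun t => M t ω : ℝ≥0 → ℝ), τ ω) :=
  (measurable_pi_lambda _ h.left.measurable).prodMk h.measurable_time

theorem measurable_pastPair (t : ℝ≥0) : Measurable (pastPair M M' t) :=
  measurable_pi_lambda _ fun s => (h.left.measurable s).prodMk (h.right.measurable s)

theorem binaryJunction : BinaryJunction μ M M' τ where
  identification := h.eq_before.mono fun ω hω t ht => (hω t ht).symm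
  splitting := by
    filter_upwards [h.eq_before, h.eq_jump, h.time] with ω h1 h2 h3
    refine ⟨h2.symm, ?_⟩
    rw [leftLim_eq_of_eq_before (h.right.path ω).antitone (h.left.path ω).antitone
      (ENNReal.toNNReal_pos h3.1.ne' h3.2.ne) fun t ht => h1 t ?_, h2]
    · ring
    · rw [← ENNReal.coe_toNNReal h3.2.ne]
      exact_mod_cast ht

variable [IsProbabilityMeasure μ]

/-- Given τ > t, the past pair is the past of M doubled, and the future pair is glued from the
future of M, the residual time and R. By the Markov property this triple is independent of the past
and distributed as (M, τ, R). -/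
theorem restrict_lt_map (t : ℝ≥0) :
    (μ.restrict {ω | (t : ℝ≥0∞) < τ ω}).map
        (fun ω => (pastPair M M' t ω, (fun v => (future M t ω v, future M' t ω v)))) =
      ((μ.restrict {ω | (t : ℝ≥0∞) < τ ω}).map (pastPair M M' t)).prod
        (μ.map fun ω v => (M v ω, M' v ω)) := by
  set A := {ω | (t : ℝ≥0∞) < τ ω}
  have hA : MeasurableSet A := measurableSet_lt measurable_const h.measurable_time
  have hp : Measurable fun ω (s : Iic t) => M s ω := measurable_pi_lambda _ fun s => h.left.measurable s
  have hf : Measurable (future M t) := measurable_pi_lambda _ (measurable_future h.left.measurable t)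
  have e1 := h.markov.restrict_lt_map h.left.measurable h.measurable_time h.left_mem
    h.left.future_mem_Icc (h.time.mono fun ω hω => hω.1) t
  have e2 := restrict_map_prodMk_eq_of_indepFun h.measurable_pair h.measurable_post h.indep
    (B := {z | (t : ℝ≥0∞) < z.2}) (measurableSet_lt measurable_const measurable_snd)
    (G := fun z => ((fun s : Iic t => z.1 s), ((fun v => z.1 (t + v) / z.1 t : ℝ≥0 → ℝ), z.2 - t)))
    (by fun_prop)
  have e3 : (μ.restrict A).map (fun ω => ((fun s : Iic t => M s ω),
      ((future M t ω, τ ω - t), fun v => postSplit M' τ v ω))) =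
      ((μ.restrict A).map fun ω (s : Iic t) => M s ω).prod
        ((μ.map fun ω => ((fun t => M t ω : ℝ≥0 → ℝ), τ ω)).prod
          (μ.map fun ω v => postSplit M' τ v ω)) :=
    map_prodMk_assoc hp (hf.prodMk (h.measurable_time.sub_const _)) h.measurable_post
      (e2.trans (congrArg (fun ν => Measure.prod ν _) e1))
  rw [← (indepFun_iff_map_prod_eq_prod_map_map h.measurable_pair.aemeasurable
    h.measurable_post.aemeasurable).mp h.indep.symm] at e3
  let g : ((ℝ≥0 → ℝ) × ℝ≥0∞) × (ℝ≥0 → ℝ) → ℝ≥0 → ℝ × ℝ := fun x v => (x.1.1 v, glue x.1 x.2 v)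
  have hg : Measurable g := measurable_pi_lambda _ fun v =>
    (by fun_prop : Measurable fun x : ((ℝ≥0 → ℝ) × ℝ≥0∞) × (ℝ≥0 → ℝ) => x.1.1 v).prodMk
      (measurable_glue measurable_fst measurable_snd v)
  have e4 := map_prodMk_comp_of_eq_prod (μ := μ.restrict A) hp.aemeasurable
    ((hf.prodMk (h.measurable_time.sub_const _)).prodMk h.measurable_post).aemeasurable e3
    (f := fun x (s : Iic t) => (x s, x s)) (by fun_prop) hg
  rw [Measure.map_map hg (h.measurable_pair.prodMk h.measurable_post)] at e4
  have hae : ∀ᵐ ω ∂(μ.restrict A), (fun s : Iic t => (M s ω, M s ω)) = pastPair M M' t ω ∧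
      g ((future M t ω, τ ω - t), fun v => postSplit M' τ v ω) =
        fun v => (future M t ω v, future M' t ω v) := by
    refine (ae_restrict_iff' hA).mpr ?_
    filter_upwards [h.eq_before, h.eq_jump, h.time] with ω h1 h2 h3 hω
    refine ⟨funext fun s => Prod.ext rfl (h1 s (lt_of_le_of_lt ?_ hω)).symm,
      funext fun v => Prod.ext rfl ?_⟩
    · exact_mod_cast s.2
    · exact (future_eq_glue (h.left.path ω) (h.right.path ω) h3 h1 h2 hω v).symm
  have e5 : μ.map (g ∘ fun ω => (((fun t => M t ω : ℝ≥0 → ℝ), τ ω), fun v => postSplit M' τ v ω)) =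
      μ.map fun ω v => (M v ω, M' v ω) := by
    refine Measure.map_congr ?_
    filter_upwards [h.eq_before, h.eq_jump, h.time] with ω h1 h2 h3
    exact funext fun v => Prod.ext rfl (apply_eq_glue (h.left.path ω) (h.right.path ω) h3 h1 h2 v).symm
  rw [e5, Measure.map_congr (hae.mono fun ω hω => congrArg₂ Prod.mk hω.1 hω.2),
    Measure.map_congr (hae.mono fun ω hω => hω.1)] at e4
  exact e4

/-- Given τ ≤ t, the future of M' is the future of R after t - τ. Fubini over (M, τ) makes this time
deterministic, and the Markov property of R then separates its future from what the past of M'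
contains. -/
theorem setIntegral_prod_future (t : ℝ≥0) (k₁ : List ℝ≥0) (k₂ : List (Iic t)) (l : List ℝ≥0) :
    ∫ ω in {ω | τ ω ≤ t}, (k₁.map fun s => M s ω).prod * (k₂.map fun s : Iic t => M' s ω).prod *
        (l.map (future M' t ω)).prod ∂μ =
      (∫ ω in {ω | τ ω ≤ t}, (k₁.map fun s => M s ω).prod * (k₂.map fun s : Iic t => M' s ω).prod ∂μ) *
        ∫ ω, (l.map fun v => postSplit M' τ v ω).prod ∂μ := by
  have hA : MeasurableSet {ω | τ ω ≤ t} := measurableSet_le h.measurable_time measurable_const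
  -- The event τ ≤ t is put into the integrand so that Fubini applies to the unrestricted product
  -- law.
  let a : (ℝ≥0 → ℝ) × ℝ≥0∞ → ℝ := fun z => if z.2 ≤ t then (k₁.map fun s => z.1 s).prod else 0
  have ha : Measurable a := Measurable.ite (measurableSet_le measurable_snd measurable_const)
    (measurable_list_prod_map (X := fun s (z : (ℝ≥0 → ℝ) × ℝ≥0∞) => z.1 s)
      fun s _ => by fun_prop) measurable_const
  let F : List ℝ≥0 → ((ℝ≥0 → ℝ) × ℝ≥0∞) × (ℝ≥0 → ℝ) → ℝ := fun l x =>
    a x.1 * (k₂.map fun s : Iic t => glue x.1 x.2 s).prod *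
      (l.map fun v => evalR x.2 (t - x.1.2.toNNReal + v) / evalR x.2 (t - x.1.2.toNNReal)).prod
  have hF : ∀ l, Measurable (F l) := fun l => by
    have ht : Measurable fun x : ((ℝ≥0 → ℝ) × ℝ≥0∞) × (ℝ≥0 → ℝ) => t - x.1.2.toNNReal :=
      measurable_const.sub measurable_fst.snd.ennreal_toNNReal
    refine ((ha.comp measurable_fst).mul (measurable_list_prod_map
      (X := fun (s : Iic t) (x : ((ℝ≥0 → ℝ) × ℝ≥0∞) × (ℝ≥0 → ℝ)) => glue x.1 x.2 s)
        fun s _ => measurable_glue measurable_fst measurable_snd _)).mul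
      (measurable_list_prod_map (X := fun v (x : ((ℝ≥0 → ℝ) × ℝ≥0∞) × (ℝ≥0 → ℝ)) =>
        evalR x.2 (t - x.1.2.toNNReal + v) / evalR x.2 (t - x.1.2.toNNReal)) fun v _ => ?_)
    exact (measurable_evalR measurable_snd (ht.add_const v)).div
      (measurable_evalR measurable_snd ht)
  have hev : ∀ ω v, evalR (fun v => postSplit M' τ v ω) v = postSplit M' τ v ω := fun ω v =>
    evalR_eq (continuousWithinAt_postSplit (h.right.path ω) v)
  have hFe : ∀ l, (fun ω => F l (((fun t => M t ω), τ ω), fun v => postSplit M' τ v ω)) =ᵐ[μ]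
      {ω | τ ω ≤ t}.indicator fun ω => (k₁.map fun s => M s ω).prod *
        (k₂.map fun s : Iic t => M' s ω).prod * (l.map (future M' t ω)).prod := fun l => by
    filter_upwards [h.eq_before, h.eq_jump, h.time] with ω h1 h2 h3
    by_cases hω : τ ω ≤ t
    · rw [indicator_of_mem (s := {ω | τ ω ≤ t}) hω]
      simp only [F, a, if_pos hω, hev]
      congr 2
      · congr 2
        funext s
        exact (apply_eq_glue (h.left.path ω) (h.right.path ω) h3 h1 h2 s).symm
      · congr 1
        funext v
        exact (future_eq_div_postSplit (h.right.path ω) hω v).symm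
    · rw [indicator_of_notMem (s := {ω | τ ω ≤ t}) hω]
      simp only [F, a, if_neg hω, zero_mul]
  have h_int : ∀ l, Integrable
      (fun ω => F l (((fun t => M t ω), τ ω), fun v => postSplit M' τ v ω)) μ := fun l => by
    refine integrable_of_mem_Icc ((hF l).comp (h.measurable_pair.prodMk
      h.measurable_post)).aestronglyMeasurable ?_
    have b1 : ∀ᵐ ω ∂μ, ∀ s ∈ k₁, M s ω ∈ Icc (0 : ℝ) 1 :=
      (ae_ball_iff (S := {i | i ∈ k₁}) k₁.finite_toSet.countable).mpr fun s _ => h.left_mem s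
    have b2 : ∀ᵐ ω ∂μ, ∀ s ∈ k₂, M' s ω ∈ Icc (0 : ℝ) 1 :=
      (ae_ball_iff (S := {i | i ∈ k₂}) k₂.finite_toSet.countable).mpr fun s _ => h.right_mem s
    filter_upwards [hFe l, b1, b2] with ω hω c1 c2
    rw [hω]
    by_cases hω : τ ω ≤ t
    · rw [indicator_of_mem (s := {ω | τ ω ≤ t}) hω]
      exact unitInterval.mul_mem (unitInterval.mul_mem (list_prod_map_mem_Icc c1)
        (list_prod_map_mem_Icc c2)) (list_prod_map_mem_Icc fun v _ => h.right.future_mem_Icc t v ω)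
    · rw [indicator_of_notMem (s := {ω | τ ω ≤ t}) hω]
      simp
  have hkey : ∀ z, ∫ ω, F l (z, fun v => postSplit M' τ v ω) ∂μ =
      (∫ ω, F [] (z, fun v => postSplit M' τ v ω) ∂μ) *
        ∫ ω, (l.map fun v => postSplit M' τ v ω).prod ∂μ := fun z => by
    by_cases hz : z.2 ≤ t
    · obtain ⟨C, k', hk', hC⟩ := exists_prod_map_glue z k₂
      have := h.markov_post.top_integral (t - z.2.toNNReal) k' l hk'
      simp only [F, hev, hC _ (hev _), List.map_nil, List.prod_nil, mul_one]
      simp_rw [mul_assoc]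
      simp_rw [integral_const_mul]
      rw [mul_assoc, mul_assoc, ← this]
      rfl
    · simp [F, a, if_neg hz]
  have e : ∀ l, ∫ ω in {ω | τ ω ≤ t}, (k₁.map fun s => M s ω).prod *
      (k₂.map fun s : Iic t => M' s ω).prod * (l.map (future M' t ω)).prod ∂μ =
      ∫ ω, ∫ ω', F l (((fun t => M t ω), τ ω), fun v => postSplit M' τ v ω') ∂μ ∂μ := fun l => by
    rw [← integral_indicator hA, ← integral_congr_ae (hFe l)]
    exact integral_comp_indepFun h.measurable_pair h.measurable_post h.indep (hF l) (h_int l)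
  rw [e l]
  simp_rw [hkey]
  rw [integral_mul_const, ← e []]
  simp

/-- Given τ ≤ t, the past pair is glued from M stopped at t, the time τ and R, and this triple is
independent of the future of M. -/
theorem restrict_le_map_left (t : ℝ≥0) :
    (μ.restrict {ω | τ ω ≤ t}).map (fun ω => (pastPair M M' t ω, future M t ω)) =
      ((μ.restrict {ω | τ ω ≤ t}).map (pastPair M M' t)).prod (μ.map fun ω v => M v ω) := by
  set A := {ω | τ ω ≤ t}
  have hA : MeasurableSet A := measurableSet_le h.measurable_time measurable_const
  have hs : Measurable fun ω => ((fun s => M (min s t) ω : ℝ≥0 → ℝ), τ ω) :=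
    (measurable_pi_lambda _ fun s => h.left.measurable (min s t)).prodMk h.measurable_time
  have hf : Measurable (future M t) := measurable_pi_lambda _ (measurable_future h.left.measurable t)
  have e1 := h.markov.restrict_le_map h.left.measurable h.measurable_time h.left_mem
    h.left.future_mem_Icc (h.time.mono fun ω hω => hω.1) t
  have hB : MeasurableSet {z : (ℝ≥0 → ℝ) × ℝ≥0∞ | z.2 ≤ t} :=
    measurableSet_le measurable_snd measurable_const
  have e2 := restrict_map_prodMk_eq_of_indepFun h.measurable_pair h.measurable_post h.indep hB
    (G := fun z => (((fun s => z.1 (min s t) : ℝ≥0 → ℝ), z.2), (fun v => z.1 (t + v) / z.1 t : ℝ≥0 → ℝ)))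
    (by fun_prop)
  have e2' := restrict_map_prodMk_eq_of_indepFun h.measurable_pair h.measurable_post h.indep hB
    (G := fun z => ((fun s => z.1 (min s t) : ℝ≥0 → ℝ), z.2)) (by fun_prop)
  have e3 : (μ.restrict A).map (fun ω => ((((fun s => M (min s t) ω : ℝ≥0 → ℝ), τ ω),
      fun v => postSplit M' τ v ω), future M t ω)) =
      ((μ.restrict A).map fun ω => (((fun s => M (min s t) ω : ℝ≥0 → ℝ), τ ω),
        fun v => postSplit M' τ v ω)).prod (μ.map fun ω t => M t ω) :=
    (map_prodMk_right_comm hs hf h.measurable_post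
      (e2.trans (congrArg (fun ν => Measure.prod ν _) e1))).trans
      (congrArg (fun ν => Measure.prod ν _) e2'.symm)
  have e4 := map_prodMk_comp_of_eq_prod (μ := μ.restrict A)
    (hs.prodMk h.measurable_post).aemeasurable hf.aemeasurable e3
    (f := fun x (s : Iic t) => (x.1.1 s, glue x.1 x.2 s))
    (measurable_pi_lambda _ fun s => (by fun_prop :
      Measurable fun x : ((ℝ≥0 → ℝ) × ℝ≥0∞) × (ℝ≥0 → ℝ) => x.1.1 s).prodMk
        (measurable_glue measurable_fst measurable_snd s)) measurable_id
  have hae : ∀ᵐ ω ∂(μ.restrict A), (fun s : Iic t => (M (min s t) ω,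
      glue ((fun s => M (min s t) ω : ℝ≥0 → ℝ), τ ω) (fun v => postSplit M' τ v ω) s)) =
        pastPair M M' t ω := by
    refine (ae_restrict_iff' hA).mpr ?_
    filter_upwards [h.eq_before, h.eq_jump, h.time] with ω h1 h2 h3 hω
    refine funext fun s => Prod.ext ?_ ?_
    · simp only [pastPair, min_eq_left (show (s : ℝ≥0) ≤ t from s.2)]
    · exact (apply_eq_glue_stopped (h.left.path ω) (h.right.path ω) h3 h1 h2 hω s.2).symm
  rw [Measure.map_id, Measure.map_congr (hae.mono fun ω hω => congrArg₂ Prod.mk hω rfl),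
    Measure.map_congr hae] at e4
  exact e4

theorem restrict_le_map (t : ℝ≥0) :
    (μ.restrict {ω | τ ω ≤ t}).map
        (fun ω => (pastPair M M' t ω, (future M t ω, future M' t ω))) =
      ((μ.restrict {ω | τ ω ≤ t}).map (pastPair M M' t)).prod
        ((μ.map fun ω v => M v ω).prod (μ.map fun ω v => postSplit M' τ v ω)) := by
  set A := {ω | τ ω ≤ t}
  have hf : Measurable (future M t) := measurable_pi_lambda _ (measurable_future h.left.measurable t)
  have hf' : Measurable (future M' t) :=
    measurable_pi_lambda _ (measurable_future h.right.measurable t)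
  -- All times of M are admitted here, not only those up to t: the future of M is then a function of
  -- this family, and the future of M' is independent of both the past pair and the future of M.
  let X : ℝ≥0 ⊕ Iic t → Ω → ℝ := Sum.elim M fun s => M' s
  have hX : ∀ i, Measurable (X i) := by
    rintro (i | i); exacts [h.left.measurable i, h.right.measurable i]
  have hX01 : ∀ i, ∀ᵐ ω ∂(μ.restrict A), X i ω ∈ Icc (0 : ℝ) 1 := by
    rintro (i | i); exacts [ae_restrict_of_ae (h.left_mem i), ae_restrict_of_ae (h.right_mem i)]
  have hXe : ∀ (k : List (ℝ≥0 ⊕ Iic t)) ω, (k.map fun i => X i ω).prod =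
      ((k.filterMap Sum.getLeft?).map fun s => M s ω).prod *
        ((k.filterMap Sum.getRight?).map fun s : Iic t => M' s ω).prod := fun k ω => by
    rw [← prod_map_sumElim]
    congr 2
    funext i
    cases i <;> rfl
  have key := map_prodMk_eq_prod_of_moments (μ := μ.restrict A) (μ₁ := μ.restrict A) (μ₂ := μ)
    (X := X) (X' := X) (Y := fun v ω => future M' t ω v) (Y' := postSplit M' τ)
    hX (measurable_future h.right.measurable t) hX (measurable_postSplit h.right h.measurable_time)
    hX01 (fun v => ae_of_all _ fun ω => h.right.future_mem_Icc t v ω) hX01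
    (fun v => ae_of_all _ fun ω => Ioc_subset_Icc_self (postSplit_mem_Ioc (h.right.path ω) v))
    fun k l => by
      simp_rw [hXe]
      exact h.setIntegral_prod_future t _ _ l
  have e := map_prodMk_comp_of_eq_prod (μ := μ.restrict A)
    (measurable_pi_lambda _ hX).aemeasurable hf'.aemeasurable key
    (f := fun x => ((fun s : Iic t => (x (.inl s), x (.inr s))),
      (fun v => x (.inl (t + v)) / x (.inl t) : ℝ≥0 → ℝ))) (by fun_prop) measurable_id
  rw [Measure.map_id] at e
  exact map_prodMk_assoc (h.measurable_pastPair t) hf hf'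
    (e.trans (congrArg (fun ν => Measure.prod ν _) (h.restrict_le_map_left t)))

/-- The future of M' at n has the moments of M' by its own Markov property, while on τ ≤ n it has
those of R. The two can differ only through τ > n, whose probability tends to 0. -/
theorem map_post_eq : μ.map (fun ω v => postSplit M' τ v ω) = μ.map fun ω v => M' v ω := by
  refine map_eq_of_moments (measurable_postSplit h.right h.measurable_time) h.right.measurable
    (fun v => ae_of_all _ fun ω => Ioc_subset_Icc_self (postSplit_mem_Ioc (h.right.path ω) v))
    h.right_mem fun l => ?_
  have ha := tendsto_integral_alive h.measurable_time (h.time.mono fun ω hω => hω.2)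
  have hfm : ∀ n : ℕ, Measurable fun ω => (l.map (future M' n ω)).prod := fun n =>
    measurable_prod_future h.right.measurable _ l
  have hfI : ∀ (n : ℕ) ω, (l.map (future M' n ω)).prod ∈ Icc (0 : ℝ) 1 := fun n ω =>
    list_prod_map_mem_Icc fun v _ => h.right.future_mem_Icc _ v ω
  have hb : Tendsto (fun n : ℕ => ∫ ω, (l.map (future M' n ω)).prod * alive τ n ω ∂μ) atTop
      (𝓝 0) := by
    refine tendsto_of_tendsto_of_tendsto_of_le_of_le tendsto_const_nhds ha (fun n => ?_)
      fun n => ?_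
    · exact integral_nonneg fun ω => mul_nonneg (hfI n ω).1 (alive_mem_Icc _ _ _).1
    · refine integral_mono (integrable_of_mem_Icc ((hfm n).mul
        (measurable_alive h.measurable_time _)).aestronglyMeasurable (ae_of_all _ fun ω =>
          unitInterval.mul_mem (hfI n ω) (alive_mem_Icc _ _ _)))
        (integrable_of_mem_Icc (measurable_alive h.measurable_time _).aestronglyMeasurable
          (ae_of_all _ fun ω => alive_mem_Icc _ _ _)) fun ω => ?_
      exact mul_le_of_le_one_left (alive_mem_Icc _ _ _).1 (hfI n ω).2
  have e : ∀ n : ℕ, (1 - ∫ ω, alive τ n ω ∂μ) * ∫ ω, (l.map fun v => postSplit M' τ v ω).prod ∂μ =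
      ∫ ω, (l.map fun v => M' v ω).prod ∂μ -
        ∫ ω, (l.map (future M' n ω)).prod * alive τ n ω ∂μ := fun n => by
    have e1 := h.setIntegral_prod_future n [] [] l
    have e2 := h.markov_right.top_integral n [] l (by simp)
    simp only [List.map_nil, List.prod_nil, one_mul] at e1 e2
    rw [integral_const (μ := μ), probReal_univ, one_smul, one_mul] at e2
    rw [setIntegral_le_eq h.measurable_time n (integrable_of_mem_Icc (hfm n).aestronglyMeasurable
      (ae_of_all _ (hfI n))), setIntegral_le_eq h.measurable_time n (integrable_const _), e2] at e1
    rw [e1]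
    simp
  have l1 := ((tendsto_const_nhds (x := (1 : ℝ))).sub ha).mul_const
    (∫ ω, (l.map fun v => postSplit M' τ v ω).prod ∂μ)
  have l2 := (tendsto_const_nhds (x := ∫ ω, (l.map fun v => M' v ω).prod ∂μ)).sub hb
  simp_rw [e] at l1
  simpa using tendsto_nhds_unique l1 l2

theorem asymmetricMarkovBranching : AsymmetricMarkovBranching μ M M' τ where
  before t ht := by
    have hY : Measurable fun ω v => (future M t ω v, future M' t ω v) :=
      measurable_pi_lambda _ fun v => (measurable_future h.left.measurable t v).prodMk
        (measurable_future h.right.measurable t v)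
    have hY' : Measurable fun ω v => (M v ω, M' v ω) :=
      measurable_pi_lambda _ fun v => (h.left.measurable v).prodMk (h.right.measurable v)
    have : IsProbabilityMeasure (μ.map fun ω v => (M v ω, M' v ω)) :=
      Measure.isProbabilityMeasure_map hY'.aemeasurable
    obtain ⟨h1, h2⟩ := cond_of_restrict_map_eq_prod ht (h.measurable_pastPair t) hY
      (h.restrict_lt_map t)
    exact ⟨⟨hY.aemeasurable, hY'.aemeasurable, h1⟩, h2⟩
  after t ht := by
    have hf : Measurable (future M t) :=
      measurable_pi_lambda _ (measurable_future h.left.measurable t)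
    have hf' : Measurable (future M' t) :=
      measurable_pi_lambda _ (measurable_future h.right.measurable t)
    have hm : Measurable fun ω v => M v ω := measurable_pi_lambda _ h.left.measurable
    have hm' : Measurable fun ω v => M' v ω := measurable_pi_lambda _ h.right.measurable
    have : IsProbabilityMeasure (μ.map fun ω v => M v ω) :=
      Measure.isProbabilityMeasure_map hm.aemeasurable
    have : IsProbabilityMeasure (μ.map fun ω v => M' v ω) :=
      Measure.isProbabilityMeasure_map hm'.aemeasurable
    have e := h.restrict_le_map t
    rw [h.map_post_eq] at e
    obtain ⟨h1, h2⟩ := cond_of_restrict_map_eq_prod ht (h.measurable_pastPair t)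
      (hf.prodMk hf') e
    have : IsProbabilityMeasure (cond μ {ω | τ ω ≤ t}) := cond_isProbabilityMeasure ht
    have c1 : (cond μ {ω | τ ω ≤ t}).map (future M t) = μ.map fun ω v => M v ω := by
      have := congrArg Measure.fst h1
      rwa [Measure.fst_map_prodMk hf', Measure.fst_prod] at this
    have c2 : (cond μ {ω | τ ω ≤ t}).map (future M' t) = μ.map fun ω v => M' v ω := by
      have := congrArg Measure.snd h1
      rwa [Measure.snd_map_prodMk hf, Measure.snd_prod] at this
    refine ⟨⟨hf.aemeasurable, hm.aemeasurable, c1⟩, ⟨hf'.aemeasurable, hm'.aemeasurable, c2⟩, ?_, h2⟩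
    rw [indepFun_iff_map_prod_eq_prod_map_map hf.aemeasurable hf'.aemeasurable, h1, c1, c2]

end IsSplitOff

theorem IsBifurcator.isSplitOff (hM : IsPureJumpProcess M) (hM' : IsPureJumpProcess M')
    (hτm : Measurable τ) (hτ : ∀ᵐ ω ∂μ, 0 < τ ω ∧ τ ω < ∞) (hB : IsBifurcator μ M M' τ) :
    IsSplitOff μ M M' τ := by
  obtain ⟨Λ, p, hfM, ⟨Λ', hfM'⟩, hp, hp01, hpfin, Ω', _, P, _, N, hN, hlaw, h1, h2, hpost, hind⟩ := hB
  have hΛ := hfM.splitting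
  exact
  { left := hM
    right := hM'
    measurable_time := hτm
    time := hτ
    left_mem := fun t => (hfM.ae_mem_Ioc t).mono fun ω hω => Ioc_subset_Icc_self hω
    right_mem := fun t => (hfM'.ae_mem_Ioc t).mono fun ω hω => Ioc_subset_Icc_self hω
    markov := (isMarkovPair_poisson hΛ hp hp01 hN hpfin).of_identDistrib hlaw
    markov_right := hfM'.isMarkovPair
    markov_post := IsMarkovPair.of_identDistrib_top (M := postSplit M' τ) hpost
      (isMarkovPair_factorProduct (hΛ.switch hp hp01 hpfin) (hN.switchedFactors hΛ hp hp01))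
    eq_before := h1
    eq_jump := h2
    indep := hind }

end Branching

/-! ### The separation time as a functional of the future or of the past -/

section SeparationTime

variable {Ω : Type*} {M M' : ℝ≥0 → Ω → ℝ} {ω : Ω}

theorem separationTime_comm (M M' : ℝ≥0 → Ω → ℝ) : separationTime M' M = separationTime M M' := by
  funext ω
  simp only [separationTime, ne_comm]

theorem separationTime_le {t : ℝ≥0} (h : M t ω ≠ M' t ω) : separationTime M M' ω ≤ t :=
  iInf₂_le (f := fun (t : ℝ≥0) (_ : M t ω ≠ M' t ω) => (t : ℝ≥0∞)) t h

theorem eq_of_lt_separationTime {t : ℝ≥0} (h : (t : ℝ≥0∞) < separationTime M M' ω) :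
    M t ω = M' t ω := by
  by_contra hne
  exact absurd (separationTime_le hne) (not_le.mpr h)

theorem measurable_separationTime [MeasurableSpace Ω] (hM : IsPureJumpProcess M)
    (hM' : IsPureJumpProcess M') : Measurable (separationTime M M') := by
  have e : separationTime M M' = fun ω => ratSeparation (fun t => M t ω) (fun t => M' t ω) :=
    funext fun ω => separationTime_eq_ratSeparation (hM.path ω).right_continuous
      (hM'.path ω).right_continuous
  rw [e]
  exact measurable_ratSeparation (measurable_pi_lambda _ hM.measurable)
    (measurable_pi_lambda _ hM'.measurable)

/-- The paths agree at t, so both are divided by the same value and separation is merely shifted by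
t. -/
theorem ratSeparation_future (hM : IsPureJumpPath fun t => M t ω)
    (hM' : IsPureJumpPath fun t => M' t ω) {t : ℝ≥0}
    (ht : (t : ℝ≥0∞) < separationTime M M' ω) :
    ratSeparation (future M t ω) (future M' t ω) = separationTime M M' ω - t := by
  have e := separationTime_eq_ratSeparation (M := fun v ω => future M t ω v)
    (M' := fun v ω => future M' t ω v) (ω := ω)
    (fun v => (continuousWithinAt_add_left t v (hM.right_continuous _)).div_const _)
    (fun v => (continuousWithinAt_add_left t v (hM'.right_continuous _)).div_const _)
  rw [← e]
  have h0 : M t ω = M' t ω := eq_of_lt_separationTime ht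
  refine le_antisymm ?_ ?_
  · refine ENNReal.le_sub_of_add_le_left ENNReal.coe_ne_top (le_iInf₂ fun s hs => ?_)
    have hts : t ≤ s := by exact_mod_cast (ht.trans_le (separationTime_le hs)).le
    have hv : future M t ω (s - t) ≠ future M' t ω (s - t) := by
      simp only [future, add_tsub_cancel_of_le hts, h0]
      exact fun h => hs ((div_left_inj' (hM'.pos t).ne').mp h)
    calc (t : ℝ≥0∞) + _ ≤ t + ((s - t : ℝ≥0) : ℝ≥0∞) := by
          gcongr
          exact separationTime_le (M := fun v ω => future M t ω v)
            (M' := fun v ω => future M' t ω v) hv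
      _ = s := by exact_mod_cast add_tsub_cancel_of_le hts
  · refine le_iInf₂ fun v hv => tsub_le_iff_left.mpr ?_
    rw [← ENNReal.coe_add]
    refine separationTime_le fun h => hv ?_
    simp only [future, h, h0]

/-- The separation time as a function of the past of the pair, valid if separation has occurred. -/
noncomputable def pastTime (t : ℝ≥0) (x : Iic t → ℝ × ℝ) : ℝ≥0∞ :=
  min (ratSeparation (fun s => (x ⟨min s t, min_le_right s t⟩).1)
    (fun s => (x ⟨min s t, min_le_right s t⟩).2)) t

theorem measurable_pastTime (t : ℝ≥0) : Measurable (pastTime t) :=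
  (measurable_ratSeparation (by fun_prop) (by fun_prop)).min measurable_const

theorem IsPureJumpPath.right_continuous_stopped {f : ℝ≥0 → ℝ} (hf : IsPureJumpPath f) (t s : ℝ≥0) :
    ContinuousWithinAt (fun s => f (min s t)) (Ici s) s :=
  ContinuousWithinAt.comp (f := fun s : ℝ≥0 => min s t) (t := Ici (min s t))
    (hf.right_continuous _) (continuous_id.min continuous_const).continuousWithinAt
    fun w hw => min_le_min_right t (show _ ≤ w from hw)

/-- The cap at t in `pastTime` matters when τ = t but the infimum is not attained: the paths stopped
at t then never separate. -/
theorem pastTime_pastPair (hM : IsPureJumpPath fun t => M t ω)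
    (hM' : IsPureJumpPath fun t => M' t ω) {t : ℝ≥0} (ht : separationTime M M' ω ≤ t) :
    pastTime t (pastPair M M' t ω) = separationTime M M' ω := by
  have e := separationTime_eq_ratSeparation (M := fun s ω => M (min s t) ω)
    (M' := fun s ω => M' (min s t) ω) (ω := ω) (hM.right_continuous_stopped t)
    (hM'.right_continuous_stopped t)
  have e2 : pastTime t (pastPair M M' t ω) =
      min (separationTime (fun s ω => M (min s t) ω) (fun s ω => M' (min s t) ω) ω) t := by
    rw [e]; rfl
  rw [e2]
  refine le_antisymm (le_iInf₂ fun s hs => ?_) (le_min (le_iInf₂ fun s hs => ?_) ht)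
  · rcases le_total s t with h | h
    · refine (min_le_left _ _).trans (separationTime_le ?_)
      simpa only [min_eq_left h] using hs
    · exact (min_le_right _ _).trans (by exact_mod_cast h)
  · exact (separationTime_le hs).trans (by exact_mod_cast min_le_left s t)

end SeparationTime

/-! ### From the branching property to Markov pairs -/

section BranchingConsequences

theorem alive_congr {Ω Ω' : Type*} {τ : Ω → ℝ≥0∞} {τ' : Ω' → ℝ≥0∞} {ω : Ω} {ω' : Ω'} {r : ℝ≥0}
    (h : τ ω = τ' ω') : alive τ r ω = alive τ' r ω' := by
  by_cases hr : (r : ℝ≥0∞) < τ ω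
  · rw [alive_of_lt hr, alive_of_lt (h ▸ hr)]
  · rw [alive_of_le (not_lt.mp hr), alive_of_le (h ▸ not_lt.mp hr)]

theorem setIntegral_mul_of_cond {Ω α β : Type*} [MeasurableSpace Ω] [MeasurableSpace α]
    [MeasurableSpace β] {μ : Measure Ω} [IsFiniteMeasure μ] {A : Set Ω} {X : Ω → α} {Y Y' : Ω → β}
    (hX : Measurable X) (hY : Measurable Y) (hY' : Measurable Y')
    (h : μ A ≠ 0 → (cond μ A).map Y = μ.map Y' ∧ IndepFun Y X (cond μ A))
    {F : α → ℝ} {G : β → ℝ} (hF : Measurable F) (hG : Measurable G) :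
    ∫ ω in A, F (X ω) * G (Y ω) ∂μ = (∫ ω in A, F (X ω) ∂μ) * ∫ ω, G (Y' ω) ∂μ := by
  by_cases hA : μ A = 0
  · simp [Measure.restrict_eq_zero.mpr hA]
  · obtain ⟨h1, h2⟩ := h hA
    have e : ∀ f : Ω → ℝ, ∫ ω in A, f ω ∂μ = (μ A).toReal * ∫ ω, f ω ∂(cond μ A) := fun f => by
      rw [ProbabilityTheory.cond, integral_smul_measure, smul_eq_mul, ← mul_assoc,
        ← ENNReal.toReal_mul, ENNReal.mul_inv_cancel hA (measure_ne_top μ A)]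
      simp
    have e2 : ∫ ω, F (X ω) * G (Y ω) ∂(cond μ A) =
        (∫ ω, F (X ω) ∂(cond μ A)) * ∫ ω, G (Y ω) ∂(cond μ A) :=
      (h2.symm.comp hF hG).integral_fun_mul_eq_mul_integral
        (hF.comp hX).aestronglyMeasurable (hG.comp hY).aestronglyMeasurable
    rw [e, e, e2,
      ← integral_map (μ := μ) hY'.aemeasurable hG.aestronglyMeasurable, ← h1,
      integral_map hY.aemeasurable hG.aestronglyMeasurable, mul_assoc]

variable {Ω : Type*} [MeasurableSpace Ω] {μ : Measure Ω} {M M' : ℝ≥0 → Ω → ℝ} {τ : Ω → ℝ≥0∞}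

theorem measurable_pastPair (hM : ∀ t, Measurable (M t)) (hM' : ∀ t, Measurable (M' t)) (t : ℝ≥0) :
    Measurable (pastPair M M' t) :=
  measurable_pi_lambda _ fun s => (hM s).prodMk (hM' s)

/-- The defining conditions treat the two processes alike; the asymmetry lies in their laws. Each
result about one process thereby serves for the other. -/
theorem AsymmetricMarkovBranching.swap (h : AsymmetricMarkovBranching μ M M' τ) :
    AsymmetricMarkovBranching μ M' M τ where
  before t ht := by
    obtain ⟨h1, h2⟩ := h.before t ht
    exact ⟨h1.comp (u := fun (z : ℝ≥0 → ℝ × ℝ) v => (z v).swap) (by fun_prop),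
      h2.comp (φ := fun (z : ℝ≥0 → ℝ × ℝ) v => (z v).swap)
        (ψ := fun (z : Iic t → ℝ × ℝ) s => (z s).swap) (by fun_prop) (by fun_prop)⟩
  after t ht := by
    obtain ⟨h1, h2, h3, h4⟩ := h.after t ht
    exact ⟨h2, h1, h3.symm, h4.comp (φ := Prod.swap)
        (ψ := fun (z : Iic t → ℝ × ℝ) s => (z s).swap) measurable_swap (by fun_prop)⟩

namespace AsymmetricMarkovBranching

/-- Condition (i) at t = 0 gives M_0 the law of M_0/M_0 = 1. -/
theorem ae_eq_one (h : AsymmetricMarkovBranching μ M M' τ) [IsProbabilityMeasure μ]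
    (hM : IsPureJumpProcess M) (hτ : ∀ᵐ ω ∂μ, 0 < τ ω) : ∀ᵐ ω ∂μ, M 0 ω = 1 := by
  have h0 : μ {ω | ((0 : ℝ≥0) : ℝ≥0∞) < τ ω} ≠ 0 := by
    intro h0
    obtain ⟨ω, h1, h2⟩ := (hτ.and (measure_eq_zero_iff_ae_notMem.mp h0)).exists
    exact h2 (by simpa using h1)
  have h1 := (h.before 0 h0).1.comp (u := fun z : ℝ≥0 → ℝ × ℝ => (z 0).1) (by fun_prop)
  have := h1.ae_mem_snd (measurableSet_singleton (1 : ℝ)) (ae_of_all _ fun ω => ?_)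
  · exact this
  · simp [future, div_self ((hM.path ω).pos 0).ne']

variable (h : AsymmetricMarkovBranching μ M M' (separationTime M M')) [IsProbabilityMeasure μ]
  (hM : IsPureJumpProcess M) (hM' : IsPureJumpProcess M')

include h hM hM'

theorem setIntegral_lt (t : ℝ≥0) {F : (Iic t → ℝ × ℝ) → ℝ} {G : (ℝ≥0 → ℝ × ℝ) → ℝ}
    (hF : Measurable F) (hG : Measurable G) :
    ∫ ω in {ω | (t : ℝ≥0∞) < separationTime M M' ω}, F (pastPair M M' t ω) *
        G (fun v => (future M t ω v, future M' t ω v)) ∂μ =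
      (∫ ω in {ω | (t : ℝ≥0∞) < separationTime M M' ω}, F (pastPair M M' t ω) ∂μ) *
        ∫ ω, G (fun v => (M v ω, M' v ω)) ∂μ :=
  setIntegral_mul_of_cond (measurable_pastPair hM.measurable hM'.measurable t)
    (Y := fun ω v => (future M t ω v, future M' t ω v))
    (measurable_pi_lambda _ fun v => (measurable_future hM.measurable t v).prodMk
      (measurable_future hM'.measurable t v))
    (measurable_pi_lambda _ fun v => (hM.measurable v).prodMk (hM'.measurable v))
    (fun hA => ⟨(h.before t hA).1.map_eq, (h.before t hA).2⟩) hF hG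

/-- The weight F may involve the future of M as well as the past pair, hence all of M; this is what
later yields independence of M from the evolution of M' after τ. -/
theorem setIntegral_le (t : ℝ≥0) {F : (ℝ≥0 → ℝ) × (Iic t → ℝ × ℝ) → ℝ} {G : (ℝ≥0 → ℝ) → ℝ}
    (hF : Measurable F) (hG : Measurable G) :
    ∫ ω in {ω | separationTime M M' ω ≤ t}, F (future M t ω, pastPair M M' t ω) *
        G (future M' t ω) ∂μ =
      (∫ ω in {ω | separationTime M M' ω ≤ t}, F (future M t ω, pastPair M M' t ω) ∂μ) *
        ∫ ω, G (fun v => M' v ω) ∂μ := by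
  have hp := measurable_pastPair hM.measurable hM'.measurable t
  have hf : Measurable (future M t) := measurable_pi_lambda _ (measurable_future hM.measurable t)
  have hf' : Measurable (future M' t) :=
    measurable_pi_lambda _ (measurable_future hM'.measurable t)
  refine setIntegral_mul_of_cond (X := fun ω => (future M t ω, pastPair M M' t ω))
    (hf.prodMk hp) hf' (measurable_pi_lambda _ hM'.measurable) (fun hA => ?_) hF hG
  obtain ⟨h1, h2, h3, h4⟩ := h.after t hA
  refine ⟨h2.map_eq, IndepFun.symm ?_⟩
  have : IsProbabilityMeasure (cond μ {ω | separationTime M M' ω ≤ t}) :=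
    cond_isProbabilityMeasure hA
  have e1 := (indepFun_iff_map_prod_eq_prod_map_map hf.aemeasurable hf'.aemeasurable).mp h3
  have e2 := (indepFun_iff_map_prod_eq_prod_map_map (hf.prodMk hf').aemeasurable
    hp.aemeasurable).mp h4
  rw [e1] at e2
  have e3 := map_prodMk_right_comm hf hf' hp e2
  have e4 := (indepFun_iff_map_prod_eq_prod_map_map hf.aemeasurable hp.aemeasurable).mp
    (h4.comp (φ := Prod.fst) (ψ := id) measurable_fst measurable_id)
  rw [indepFun_iff_map_prod_eq_prod_map_map (hf.prodMk hp).aemeasurable hf'.aemeasurable, e3, ← e4]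

/-- The first property is (i), τ being a functional of the pair. For the second, (ii) handles the
event τ ≤ t, where τ is a functional of the past, and (i) handles τ > t. -/
theorem isMarkovPair_right (hτ : ∀ᵐ ω ∂μ, 0 < separationTime M M' ω) :
    IsMarkovPair μ M' (separationTime M M') := by
  set τ := separationTime M M' with hτdef
  have hτm : Measurable τ := measurable_separationTime hM hM'
  have h0 : ∀ t, ∀ᵐ ω ∂μ, M' t ω ∈ Icc (0 : ℝ) 1 := fun t => by
    filter_upwards [h.swap.ae_eq_one hM' hτ] with ω hω
    exact ⟨((hM'.path ω).pos t).le, hω ▸ (hM'.path ω).antitone zero_le⟩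
  have hB : ∀ (t r : ℝ≥0) (k l : List ℝ≥0), (∀ s ∈ k, s ≤ t) →
      ∫ ω, (k.map fun s => M' s ω).prod * (l.map (future M' t ω)).prod * alive τ (t + r) ω ∂μ =
      (∫ ω, (k.map fun s => M' s ω).prod * alive τ t ω ∂μ) *
        ∫ ω, (l.map fun s => M' s ω).prod * alive τ r ω ∂μ := by
    intro t r k l hk
    let F : (Iic t → ℝ × ℝ) → ℝ := fun x =>
      (k.map fun s => (x ⟨min s t, min_le_right s t⟩).2).prod
    have hF : Measurable F := measurable_list_prod_map
      (X := fun s (x : Iic t → ℝ × ℝ) => (x ⟨min s t, min_le_right s t⟩).2) fun s _ => by fun_prop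
    let G : (ℝ≥0 → ℝ × ℝ) → ℝ := fun z => (l.map fun v => (z v).2).prod *
      alive (fun z : ℝ≥0 → ℝ × ℝ => ratSeparation (fun v => (z v).1) (fun v => (z v).2)) r z
    have hG : Measurable G := (measurable_list_prod_map
      (X := fun v (z : ℝ≥0 → ℝ × ℝ) => (z v).2) fun s _ => by fun_prop).mul
        (measurable_alive (measurable_ratSeparation (by fun_prop) (by fun_prop)) r)
    have hFe : ∀ ω, F (pastPair M M' t ω) = (k.map fun s => M' s ω).prod := fun ω => by
      refine congrArg List.prod (List.map_congr_left fun s hs => ?_)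
      simp only [pastPair, min_eq_left (hk s hs)]
    have key := h.setIntegral_lt hM hM' t hF hG
    simp only [hFe] at key
    rw [setIntegral_lt_eq hτm, setIntegral_lt_eq hτm] at key
    convert key using 1
    · refine integral_congr_ae (ae_of_all _ fun ω => ?_)
      simp only [G]
      by_cases ht : (t : ℝ≥0∞) < τ ω
      · have e := ratSeparation_future (hM.path ω) (hM'.path ω) ht
        rw [alive_of_lt ht, alive_add, mul_one, mul_assoc]
        congr 2
        exact alive_congr e.symm
      · rw [alive_of_le (not_lt.mp ht),
          alive_of_le ((not_lt.mp ht).trans (by exact_mod_cast le_self_add))]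
        ring
    · congr 1
      refine integral_congr_ae (ae_of_all _ fun ω => ?_)
      simp only [G]
      congr 1
      exact alive_congr (separationTime_eq_ratSeparation
        (hM.path ω).right_continuous (hM'.path ω).right_continuous)
  refine ⟨hB, fun t r k l hr hk => ?_⟩
  let F : (ℝ≥0 → ℝ) × (Iic t → ℝ × ℝ) → ℝ := fun x =>
    (k.map fun s => (x.2 ⟨min s t, min_le_right s t⟩).2).prod *
      alive (fun x : (ℝ≥0 → ℝ) × (Iic t → ℝ × ℝ) => pastTime t x.2) r x
  have hF : Measurable F := (measurable_list_prod_map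
    (X := fun s (x : (ℝ≥0 → ℝ) × (Iic t → ℝ × ℝ)) => (x.2 ⟨min s t, min_le_right s t⟩).2)
      fun s _ => by fun_prop).mul
      (measurable_alive ((measurable_pastTime t).comp measurable_snd) r)
  have hG : Measurable fun z : ℝ≥0 → ℝ => (l.map fun v => z v).prod :=
    measurable_list_prod_map (X := fun v (z : ℝ≥0 → ℝ) => z v) fun s _ => by fun_prop
  have hFe : ∀ ω, τ ω ≤ t → F (future M t ω, pastPair M M' t ω) =
      (k.map fun s => M' s ω).prod * alive τ r ω := fun ω hω => by
    have e := pastTime_pastPair (hM.path ω) (hM'.path ω) hω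
    simp only [F]
    congr 1
    · refine congrArg List.prod (List.map_congr_left fun s hs => ?_)
      simp only [pastPair, min_eq_left (hk s hs)]
    · exact alive_congr e
  have hA : MeasurableSet {ω | τ ω ≤ t} := measurableSet_le hτm measurable_const
  have key := h.setIntegral_le hM hM' t hF hG
  have e1 : ∫ ω in {ω | τ ω ≤ t}, F (future M t ω, pastPair M M' t ω) *
      (l.map fun v => future M' t ω v).prod ∂μ = ∫ ω in {ω | τ ω ≤ t},
        (k.map fun s => M' s ω).prod * (l.map (future M' t ω)).prod * alive τ r ω ∂μ :=
    setIntegral_congr_fun hA fun ω hω => by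
      simp only [hFe ω hω]
      ring
  have e2 : ∫ ω in {ω | τ ω ≤ t}, F (future M t ω, pastPair M M' t ω) ∂μ =
      ∫ ω in {ω | τ ω ≤ t}, (k.map fun s => M' s ω).prod * alive τ r ω ∂μ :=
    setIntegral_congr_fun hA fun ω hω => hFe ω hω
  have hkm : Measurable fun ω => (k.map fun s => M' s ω).prod :=
    measurable_list_prod_map fun s _ => hM'.measurable s
  have hk01 : ∀ᵐ ω ∂μ, (k.map fun s => M' s ω).prod ∈ Icc (0 : ℝ) 1 := by
    have : ∀ᵐ ω ∂μ, ∀ s ∈ k, M' s ω ∈ Icc (0 : ℝ) 1 :=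
      (ae_ball_iff (S := {i | i ∈ k}) k.finite_toSet.countable).mpr fun s _ => h0 s
    filter_upwards [this] with ω hω
    exact list_prod_map_mem_Icc hω
  have i1 : Integrable (fun ω => (k.map fun s => M' s ω).prod * alive τ r ω) μ :=
    integrable_of_mem_Icc (hkm.mul (measurable_alive hτm r)).aestronglyMeasurable
      (hk01.mono fun ω hω => unitInterval.mul_mem hω (alive_mem_Icc _ _ _))
  have i2 : Integrable (fun ω => (k.map fun s => M' s ω).prod * (l.map (future M' t ω)).prod *
      alive τ r ω) μ :=
    integrable_of_mem_Icc ((hkm.mul (measurable_prod_future hM'.measurable t l)).mul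
      (measurable_alive hτm r)).aestronglyMeasurable
      (hk01.mono fun ω hω => unitInterval.mul_mem (unitInterval.mul_mem hω
        (list_prod_map_mem_Icc fun v _ => hM'.future_mem_Icc t v ω)) (alive_mem_Icc _ _ _))
  rw [e1, e2, setIntegral_le_eq hτm t i1, setIntegral_le_eq hτm t i2] at key
  simp only [mul_assoc, alive_mul_alive_of_le τ hr] at key
  -- The remaining part of the integral, over τ > t, is the first property with r = 0, since τ > 0
  -- almost surely.
  have kb := hB t 0 k l hk
  simp only [mul_assoc, add_zero] at kb
  have e3 : ∫ ω, (l.map fun s => M' s ω).prod * alive τ 0 ω ∂μ =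
      ∫ ω, (l.map fun s => M' s ω).prod ∂μ := by
    refine integral_congr_ae (hτ.mono fun ω hω => ?_)
    simp only [alive_of_lt (r := 0) (by simpa using hω), mul_one]
  rw [e3] at kb
  simp only [mul_assoc]
  rw [kb] at key
  linarith [key, sub_mul (∫ ω, (k.map fun s => M' s ω).prod * alive τ r ω ∂μ)
    (∫ ω, (k.map fun s => M' s ω).prod * alive τ t ω ∂μ) (∫ ω, (l.map fun s => M' s ω).prod ∂μ)]

end AsymmetricMarkovBranching

theorem IsMarkovPair.to_top (H : IsMarkovPair μ M τ) (hτ : ∀ᵐ ω ∂μ, 0 < τ ω) :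
    IsMarkovPair μ M fun _ => ∞ := by
  have e : ∀ f : Ω → ℝ, ∫ ω, f ω * alive τ 0 ω ∂μ = ∫ ω, f ω ∂μ := fun f =>
    integral_congr_ae (hτ.mono fun ω hω => by
      simp only [alive_of_lt (r := 0) (by simpa using hω), mul_one])
  constructor
  · intro t r k l hk
    have := H.after t 0 k l zero_le hk
    rw [e, e] at this
    simpa only [alive_top, mul_one] using this
  · intro t r k l _ hk
    have := H.after t 0 k l zero_le hk
    rw [e, e] at this
    simpa only [alive_top, mul_one] using this

end BranchingConsequences

/-! ### Law and independence of the evolution after the separation time -/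

section PostSplit

theorem measurable_gridR (n : ℕ) : Measurable (gridR n) := by
  unfold gridR
  exact (measurable_from_nat (f := fun m : ℕ => ((m + 1 : ℕ) : ℝ≥0))).comp
    (Nat.measurable_floor.comp (measurable_id.const_mul ((n : ℝ≥0) + 1))) |>.div_const _

theorem tendsto_future_gridR {Ω : Type*} {M' : ℝ≥0 → Ω → ℝ} {τ : Ω → ℝ≥0∞} {ω : Ω}
    (hM' : IsPureJumpPath fun t => M' t ω) (v : ℝ≥0) :
    Tendsto (fun n => future M' (gridR n (τ ω).toNNReal) ω v) atTop (𝓝 (postSplit M' τ v ω)) := by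
  have h1 : ∀ v, Tendsto (fun n => M' (gridR n (τ ω).toNNReal + v) ω) atTop
      (𝓝 (M' ((τ ω).toNNReal + v) ω)) := fun v => by
    have hc : ContinuousWithinAt (fun s => M' (s + v) ω) (Ici (τ ω).toNNReal) (τ ω).toNNReal := by
      have := continuousWithinAt_add_left v (τ ω).toNNReal (hM'.right_continuous _)
      simpa only [add_comm v] using this
    exact hc.tendsto.comp (tendsto_gridR _)
  have h2 := h1 0
  simp only [add_zero] at h2
  exact (h1 v).div h2 (hM'.pos _).ne'

namespace AsymmetricMarkovBranching

section

variable {Ω : Type*} [MeasurableSpace Ω] {μ : Measure Ω} {M M' : ℝ≥0 → Ω → ℝ} {τ : Ω → ℝ≥0∞}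
  [IsProbabilityMeasure μ] (h : AsymmetricMarkovBranching μ M M' τ) (hM : IsPureJumpProcess M)
  (hτ : ∀ᵐ ω ∂μ, 0 < τ ω)

include h hM hτ

theorem ae_mem_Icc (t : ℝ≥0) : ∀ᵐ ω ∂μ, M t ω ∈ Icc (0 : ℝ) 1 := by
  filter_upwards [h.ae_eq_one hM hτ] with ω hω
  exact ⟨((hM.path ω).pos t).le, hω ▸ (hM.path ω).antitone zero_le⟩

theorem ae_prod_mem_Icc (k : List ℝ≥0) :
    ∀ᵐ ω ∂μ, (k.map fun s => M s ω).prod ∈ Icc (0 : ℝ) 1 := by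
  have : ∀ᵐ ω ∂μ, ∀ s ∈ k, M s ω ∈ Icc (0 : ℝ) 1 :=
    (ae_ball_iff (S := {i | i ∈ k}) k.finite_toSet.countable).mpr fun s _ => h.ae_mem_Icc hM hτ s
  filter_upwards [this] with ω hω
  exact list_prod_map_mem_Icc hω

end

variable {Ω : Type*} [MeasurableSpace Ω] {μ : Measure Ω} {M M' : ℝ≥0 → Ω → ℝ}
  (h : AsymmetricMarkovBranching μ M M' (separationTime M M')) [IsProbabilityMeasure μ]
  (hM : IsPureJumpProcess M) (hM' : IsPureJumpProcess M')
  (hτ : ∀ᵐ ω ∂μ, 0 < separationTime M M' ω ∧ separationTime M M' ω < ∞)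

include h hM hM' hτ

/-- On this cell τ is almost surely at most the grid time (j+1)/(n+1), so (ii) can be used at that
deterministic time; the cell itself is an event of the past. -/
theorem setIntegral_floor_eq (n j : ℕ) (k l : List ℝ≥0) (r : ℝ≥0) :
    ∫ ω in {ω | ⌊((n : ℝ≥0) + 1) * (separationTime M M' ω).toNNReal⌋₊ = j},
        (k.map fun s => M s ω).prod * alive (separationTime M M') r ω *
          (l.map (future M' (gridR n (separationTime M M' ω).toNNReal) ω)).prod ∂μ =
      (∫ ω in {ω | ⌊((n : ℝ≥0) + 1) * (separationTime M M' ω).toNNReal⌋₊ = j},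
        (k.map fun s => M s ω).prod * alive (separationTime M M') r ω ∂μ) *
          ∫ ω, (l.map fun v => M' v ω).prod ∂μ := by
  set τ := separationTime M M'
  have hτm : Measurable τ := measurable_separationTime hM hM'
  let t : ℝ≥0 := ((j + 1 : ℕ) : ℝ≥0) / ((n : ℝ≥0) + 1)
  -- Reconstructs M_s from the past if s ≤ t, and otherwise as M_t times the normalised future.
  let m : ℝ≥0 → (ℝ≥0 → ℝ) × (Iic t → ℝ × ℝ) → ℝ := fun s x =>
    if hs : s ≤ t then (x.2 ⟨s, hs⟩).1 else (x.2 ⟨t, self_mem_Iic⟩).1 * x.1 (s - t)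
  have hm : ∀ s, Measurable (m s) := fun s => by
    by_cases hs : s ≤ t
    · simp only [m, dif_pos hs]; fun_prop
    · simp only [m, dif_neg hs]; fun_prop
  have hme : ∀ s ω, m s (future M t ω, pastPair M M' t ω) = M s ω := fun s ω => by
    by_cases hs : s ≤ t
    · simp only [m, dif_pos hs, pastPair]
    · simp only [m, dif_neg hs, pastPair, future, add_tsub_cancel_of_le (not_le.mp hs).le]
      exact mul_div_cancel₀ _ ((hM.path ω).pos t).ne'
  let D : Set ((ℝ≥0 → ℝ) × (Iic t → ℝ × ℝ)) :=
    {x | ⌊((n : ℝ≥0) + 1) * (pastTime t x.2).toNNReal⌋₊ = j}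
  have hpt : Measurable fun x : (ℝ≥0 → ℝ) × (Iic t → ℝ × ℝ) => pastTime t x.2 :=
    (measurable_pastTime t).comp measurable_snd
  have hD : MeasurableSet D := measurableSet_eq_fun
    (Nat.measurable_floor.comp (hpt.ennreal_toNNReal.const_mul _)) measurable_const
  let F : (ℝ≥0 → ℝ) × (Iic t → ℝ × ℝ) → ℝ := D.indicator fun x =>
    (k.map fun s => m s x).prod * alive (fun x : (ℝ≥0 → ℝ) × (Iic t → ℝ × ℝ) => pastTime t x.2) r x
  have hF : Measurable F :=
    ((measurable_list_prod_map fun s _ => hm s).mul (measurable_alive hpt r)).indicator hD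
  have hG : Measurable fun z : ℝ≥0 → ℝ => (l.map fun v => z v).prod :=
    measurable_list_prod_map (X := fun v (z : ℝ≥0 → ℝ) => z v) fun s _ => by fun_prop
  have key := h.setIntegral_le hM hM' t hF hG
  have hA : MeasurableSet {ω | τ ω ≤ t} := measurableSet_le hτm measurable_const
  set S : Set Ω := {ω | ⌊((n : ℝ≥0) + 1) * (τ ω).toNNReal⌋₊ = j}
  have hS : MeasurableSet S := measurableSet_eq_fun
    (Nat.measurable_floor.comp (hτm.ennreal_toNNReal.const_mul _)) measurable_const
  have hgrid : ∀ ω ∈ S, gridR n (τ ω).toNNReal = t := fun ω hω => by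
    simp only [gridR, t]
    rw [show ⌊((n : ℝ≥0) + 1) * (τ ω).toNNReal⌋₊ = j from hω]
  have hle : ∀ ω ∈ S, τ ω < ∞ → τ ω ≤ t := fun ω hω hfin => by
    rw [← ENNReal.coe_toNNReal hfin.ne, ← hgrid ω hω]
    exact_mod_cast (lt_gridR n _).le
  have conv : ∀ f g : Ω → ℝ, (∀ ω ∈ S, f ω = g ω) →
      ∫ ω in {ω | τ ω ≤ t}, S.indicator f ω ∂μ = ∫ ω in S, g ω ∂μ := fun f g hfg => by
    rw [← integral_indicator hA, ← integral_indicator hS]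
    refine integral_congr_ae ?_
    filter_upwards [hτ] with ω hω
    by_cases hωS : ω ∈ S
    · rw [indicator_of_mem (s := {ω | τ ω ≤ t}) (hle ω hωS hω.2), indicator_of_mem hωS,
        indicator_of_mem hωS, hfg ω hωS]
    · simp [indicator_of_notMem hωS, indicator_apply]
  have hFe : ∀ ω, τ ω ≤ t → F (future M t ω, pastPair M M' t ω) =
      S.indicator (fun ω => (k.map fun s => M s ω).prod * alive τ r ω) ω := fun ω hω => by
    have e := pastTime_pastPair (hM.path ω) (hM'.path ω) hω
    have hDS : (future M t ω, pastPair M M' t ω) ∈ D ↔ ω ∈ S := by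
      simp only [D, S, Set.mem_ofPred_eq, e]
      rfl
    by_cases hωS : ω ∈ S
    · simp only [F]
      rw [indicator_of_mem (hDS.mpr hωS), indicator_of_mem hωS]
      simp only [hme]
      congr 1
      exact alive_congr e
    · simp only [F]
      rw [indicator_of_notMem (fun hx => hωS (hDS.mp hx)), indicator_of_notMem hωS]
  rw [setIntegral_congr_fun hA (g := S.indicator fun ω => (k.map fun s => M s ω).prod *
      alive τ r ω * (l.map fun v => future M' t ω v).prod) fun ω hω => ?_,
    setIntegral_congr_fun hA (g := S.indicator fun ω => (k.map fun s => M s ω).prod *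
      alive τ r ω) fun ω hω => hFe ω hω] at key
  · rw [conv _ (fun ω => (k.map fun s => M s ω).prod * alive τ r ω *
      (l.map (future M' (gridR n (τ ω).toNNReal) ω)).prod) fun ω hω => by rw [hgrid ω hω],
      conv _ _ fun ω _ => rfl] at key
    exact key
  · simp only [hFe ω hω]
    by_cases hωS : ω ∈ S
    · simp only [indicator_of_mem hωS]
    · simp only [indicator_of_notMem hωS, zero_mul]

/-- The identity on each cell is summed over the cells; as the mesh shrinks, the grid time just
above τ decreases to τ and right continuity of M' gives the limit. -/
theorem integral_mul_postSplit (k l : List ℝ≥0) (r : ℝ≥0) :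
    ∫ ω, (k.map fun s => M s ω).prod * alive (separationTime M M') r ω *
        (l.map fun v => postSplit M' (separationTime M M') v ω).prod ∂μ =
      (∫ ω, (k.map fun s => M s ω).prod * alive (separationTime M M') r ω ∂μ) *
        ∫ ω, (l.map fun v => M' v ω).prod ∂μ := by
  set τ := separationTime M M'
  have hτm : Measurable τ := measurable_separationTime hM hM'
  have hkm : Measurable fun ω => (k.map fun s => M s ω).prod * alive τ r ω :=
    (measurable_list_prod_map fun s _ => hM.measurable s).mul (measurable_alive hτm r)
  have hk01 : ∀ᵐ ω ∂μ, (k.map fun s => M s ω).prod * alive τ r ω ∈ Icc (0 : ℝ) 1 :=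
    (h.ae_prod_mem_Icc hM (hτ.mono fun ω hω => hω.1) k).mono fun ω hω =>
      unitInterval.mul_mem hω (alive_mem_Icc _ _ _)
  have hfm : ∀ (n : ℕ), Measurable fun ω =>
      (l.map (future M' (gridR n (τ ω).toNNReal) ω)).prod := fun n => by
    have hg : Measurable fun ω => gridR n (τ ω).toNNReal :=
      (measurable_gridR n).comp hτm.ennreal_toNNReal
    refine measurable_list_prod_map (X := fun v ω => future M' (gridR n (τ ω).toNNReal) ω v)
      fun v _ => ?_
    exact (measurable_apply_of_rightContinuous hM'.measurable
      (fun ω t => (hM'.path ω).right_continuous t) (hg.add_const v)).div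
      (measurable_apply_of_rightContinuous hM'.measurable
      (fun ω t => (hM'.path ω).right_continuous t) hg)
  have hf01 : ∀ (n : ℕ) ω, (l.map (future M' (gridR n (τ ω).toNNReal) ω)).prod ∈ Icc (0 : ℝ) 1 :=
    fun n ω => list_prod_map_mem_Icc fun v _ => hM'.future_mem_Icc _ v ω
  have h_int : ∀ n : ℕ, Integrable (fun ω => (k.map fun s => M s ω).prod * alive τ r ω *
      (l.map (future M' (gridR n (τ ω).toNNReal) ω)).prod) μ := fun n =>
    integrable_of_mem_Icc (hkm.mul (hfm n)).aestronglyMeasurable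
      (hk01.mono fun ω hω => unitInterval.mul_mem hω (hf01 n ω))
  have hn : ∀ n : ℕ, ∫ ω, (k.map fun s => M s ω).prod * alive τ r ω *
      (l.map (future M' (gridR n (τ ω).toNNReal) ω)).prod ∂μ =
      (∫ ω, (k.map fun s => M s ω).prod * alive τ r ω ∂μ) *
        ∫ ω, (l.map fun v => M' v ω).prod ∂μ := fun n => by
    have hS : ∀ j : ℕ, MeasurableSet {ω | ⌊((n : ℝ≥0) + 1) * (τ ω).toNNReal⌋₊ = j} := fun j =>
      measurableSet_eq_fun (Nat.measurable_floor.comp (hτm.ennreal_toNNReal.const_mul _))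
        measurable_const
    have hU : ⋃ j : ℕ, {ω | ⌊((n : ℝ≥0) + 1) * (τ ω).toNNReal⌋₊ = j} = univ :=
      eq_univ_of_forall fun ω => mem_iUnion.mpr ⟨_, rfl⟩
    have hd : Pairwise (Function.onFun Disjoint
        fun j : ℕ => {ω | ⌊((n : ℝ≥0) + 1) * (τ ω).toNNReal⌋₊ = j}) := fun i j hij =>
      disjoint_left.mpr fun ω (h1 : _ = i) (h2 : _ = j) => hij (h1.symm.trans h2)
    have e : ∀ f : Ω → ℝ, Integrable f μ → ∫ ω, f ω ∂μ =
        ∑' j : ℕ, ∫ ω in {ω | ⌊((n : ℝ≥0) + 1) * (τ ω).toNNReal⌋₊ = j}, f ω ∂μ := fun f hf => by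
      rw [← integral_iUnion hS hd hf.integrableOn, hU, setIntegral_univ]
    rw [e _ (h_int n), e _ (integrable_of_mem_Icc hkm.aestronglyMeasurable hk01), ← tsum_mul_right]
    exact tsum_congr fun j => h.setIntegral_floor_eq hM hM' hτ n j k l r
  have hlim : Tendsto (fun n : ℕ => ∫ ω, (k.map fun s => M s ω).prod * alive τ r ω *
      (l.map (future M' (gridR n (τ ω).toNNReal) ω)).prod ∂μ) atTop
      (𝓝 (∫ ω, (k.map fun s => M s ω).prod * alive τ r ω *
        (l.map fun v => postSplit M' τ v ω).prod ∂μ)) := by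
    refine tendsto_integral_of_dominated_convergence (fun _ => 1)
      (fun n => (h_int n).aestronglyMeasurable) (integrable_const _) (fun n => ?_)
      (ae_of_all _ fun ω => ?_)
    · filter_upwards [hk01] with ω hω
      have := unitInterval.mul_mem hω (hf01 n ω)
      rw [Real.norm_eq_abs, abs_of_nonneg this.1]
      exact this.2
    · refine Tendsto.const_mul _ (tendsto_list_prod l fun v _ => ?_)
      exact tendsto_future_gridR (hM'.path ω) v
  simp_rw [hn] at hlim
  exact (tendsto_nhds_unique hlim tendsto_const_nhds)

/-- The evolution of `M'` after the separation time is a copy of `M'`, independent of `M` and of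
the separation time. -/
theorem postSplit_law :
    μ.map (fun ω v => postSplit M' (separationTime M M') v ω) = μ.map (fun ω v => M' v ω) ∧
      IndepFun (fun ω v => postSplit M' (separationTime M M') v ω)
        (fun ω => ((fun t => M t ω : ℝ≥0 → ℝ), separationTime M M' ω)) μ := by
  set τ := separationTime M M'
  have hτm : Measurable τ := measurable_separationTime hM hM'
  have hτ0 : ∀ᵐ ω ∂μ, 0 < τ ω := hτ.mono fun ω hω => hω.1
  let X : ℝ≥0 ⊕ ℝ≥0 → Ω → ℝ := Sum.elim M (alive τ)
  have hX : ∀ i, Measurable (X i) := by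
    rintro (i | i); exacts [hM.measurable _, measurable_alive hτm _]
  have hX01 : ∀ i, ∀ᵐ ω ∂μ, X i ω ∈ Icc (0 : ℝ) 1 := by
    rintro (i | i)
    exacts [h.ae_mem_Icc hM hτ0 i, ae_of_all _ fun ω => alive_mem_Icc _ _ _]
  have hXe : ∀ (k : List (ℝ≥0 ⊕ ℝ≥0)) (ω : Ω), 0 < τ ω → (k.map fun i => X i ω).prod =
      ((k.filterMap Sum.getLeft?).map fun s => M s ω).prod *
        alive τ ((k.filterMap Sum.getRight?).foldr max 0) ω := fun k ω hω => by
    rw [← prod_map_alive hω, ← prod_map_sumElim]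
    congr 2
    funext i
    cases i <;> rfl
  have key := map_prodMk_eq_prod_of_moments (μ := μ) (μ₁ := μ) (μ₂ := μ) (X := X) (X' := X)
    (Y := postSplit M' τ) (Y' := M') hX (measurable_postSplit hM' hτm) hX hM'.measurable hX01
    (fun v => ae_of_all _ fun ω => Ioc_subset_Icc_self (postSplit_mem_Ioc (hM'.path ω) v)) hX01
    (h.swap.ae_mem_Icc hM' hτ0) fun k l => by
      have e := h.integral_mul_postSplit hM hM' hτ (k.filterMap Sum.getLeft?) l
        ((k.filterMap Sum.getRight?).foldr max 0)
      rw [integral_congr_ae (hτ0.mono fun ω hω => by rw [hXe k ω hω]), e]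
      congr 1
      exact integral_congr_ae (hτ0.mono fun ω hω => (hXe k ω hω).symm)
  let g : (ℝ≥0 ⊕ ℝ≥0 → ℝ) → (ℝ≥0 → ℝ) × ℝ≥0∞ := fun z =>
    (fun t => z (.inl t), lifetime fun r => z (.inr r))
  have hg : Measurable g :=
    (measurable_pi_lambda _ fun t => measurable_pi_apply _).prodMk
      (measurable_lifetime.comp (measurable_pi_lambda _ fun t => measurable_pi_apply _))
  have hR : Measurable fun ω v => postSplit M' τ v ω :=
    measurable_pi_lambda _ (measurable_postSplit hM' hτm)
  have h2 := map_prodMk_comp_of_eq_prod (measurable_pi_lambda _ hX).aemeasurable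
    hR.aemeasurable key hg measurable_id
  have e3 : (fun ω => g fun i => X i ω) = fun ω => ((fun t => M t ω : ℝ≥0 → ℝ), τ ω) :=
    funext fun ω => Prod.ext rfl (lifetime_alive τ ω)
  have e4 : (fun ω => (g fun i => X i ω, id fun v => postSplit M' τ v ω)) =
      fun ω => (((fun t => M t ω : ℝ≥0 → ℝ), τ ω), fun v => postSplit M' τ v ω) :=
    funext fun ω => Prod.ext (congrFun e3 ω) rfl
  rw [Measure.map_id, e3, e4] at h2
  have hM'm : Measurable fun ω v => M' v ω := measurable_pi_lambda _ hM'.measurable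
  have : IsProbabilityMeasure (μ.map fun ω v => M' v ω) :=
    Measure.isProbabilityMeasure_map hM'm.aemeasurable
  have := cond_of_restrict_map_eq_prod (μ := μ) (A := univ) (by simp)
    ((measurable_pi_lambda _ hM.measurable).prodMk hτm) hR (by rw [Measure.restrict_univ]; exact h2)
  rwa [cond_univ] at this

end AsymmetricMarkovBranching

end PostSplit

/-! ### Monotone multiplicative functions are exponentials -/

section Exponential

/-- Cauchy's equation for -log g, where monotonicity replaces continuity. Positivity of g(t) comes
from that of g at a small time, by taking powers. -/
theorem exists_rate_of_multiplicative {g : ℝ≥0 → ℝ} (hmul : ∀ s t, g (s + t) = g s * g t)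
    (hanti : Antitone g) (h1 : Tendsto (fun n : ℕ => g (((n : ℝ≥0) + 1)⁻¹)) atTop (𝓝 1)) :
    ∃ c : ℝ, ∀ t : ℝ≥0, g t = Real.exp (-(t * c)) := by
  have hg0 : g 0 = 1 := by
    have h2 : 1 ≤ g 0 := le_of_tendsto' h1 fun n => hanti zero_le
    have h3 := hmul 0 0
    rw [add_zero] at h3
    nlinarith
  have hpow : ∀ (n : ℕ) (t : ℝ≥0), g (n * t) = g t ^ n := fun n t => by
    induction n with
    | zero => simp [hg0]
    | succ n ih => rw [Nat.cast_succ, add_mul, one_mul, hmul, ih, pow_succ]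
  have hpos : ∀ t, 0 < g t := fun t => by
    obtain ⟨n, hn⟩ := (h1.eventually (lt_mem_nhds zero_lt_one)).exists
    obtain ⟨m, hm⟩ := exists_nat_ge (t * ((n : ℝ≥0) + 1))
    refine lt_of_lt_of_le (pow_pos hn m) ?_
    rw [← hpow]
    refine hanti ?_
    rw [← div_eq_mul_inv, le_div_iff₀ (by positivity)]
    exact hm
  let f : ℝ≥0 → ℝ := fun t => -Real.log (g t)
  have hfmono : Monotone f := fun s t hst =>
    neg_le_neg (Real.log_le_log (hpos t) (hanti hst))
  have hf0 : f 0 = 0 := by simp [f, hg0]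
  have hfmul : ∀ (n : ℕ) (t : ℝ≥0), f (n * t) = n * f t := fun n t => by
    simp only [f, hpow, Real.log_pow]; ring
  have hf1 : 0 ≤ f 1 := by rw [← hf0]; exact hfmono zero_le
  refine ⟨f 1, fun t => ?_⟩
  have key : f t = t * f 1 := by
    -- Comparing n t with its integer part bounds both n f(t) and n t f(1) between consecutive
    -- multiples of f(1); letting n grow forces equality.
    have hb : ∀ n : ℕ, |f t - t * f 1| * n ≤ f 1 := fun n => by
      have l1 : (⌊(n : ℝ≥0) * t⌋₊ : ℝ) * f 1 ≤ n * f t := by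
        rw [← hfmul n t, ← mul_one ((⌊(n : ℝ≥0) * t⌋₊ : ℝ) * f 1), mul_one, ← hfmul]
        refine hfmono ?_
        rw [mul_one]
        exact Nat.floor_le zero_le
      have l2 : n * f t ≤ ((⌊(n : ℝ≥0) * t⌋₊ + 1 : ℕ) : ℝ) * f 1 := by
        rw [← hfmul n t, ← hfmul]
        refine hfmono ?_
        rw [mul_one]
        exact_mod_cast (Nat.lt_floor_add_one _).le
      have l3 : (⌊(n : ℝ≥0) * t⌋₊ : ℝ) ≤ n * t := by
        have := Nat.floor_le (zero_le (a := (n : ℝ≥0) * t))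
        exact_mod_cast this
      have l4 : (n : ℝ) * t ≤ ⌊(n : ℝ≥0) * t⌋₊ + 1 := by
        have := (Nat.lt_floor_add_one ((n : ℝ≥0) * t)).le
        exact_mod_cast this
      push_cast at l2
      rw [← abs_of_nonneg (Nat.cast_nonneg (α := ℝ) n), ← abs_mul, abs_le]
      constructor <;> nlinarith
    by_contra hne
    have hp : 0 < |f t - t * f 1| := abs_pos.mpr (sub_ne_zero.mpr hne)
    obtain ⟨n, hn⟩ := exists_nat_gt (f 1 / |f t - t * f 1|)
    rw [div_lt_iff₀ hp] at hn
    linarith [hb n]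
  rw [← key]
  simp only [f, neg_neg, Real.exp_log (hpos t)]

theorem tendsto_mul_one_sub_exp (c : ℝ) :
    Tendsto (fun n : ℕ => ((n : ℝ) + 1) * (1 - Real.exp (-(((n : ℝ) + 1)⁻¹ * c)))) atTop (𝓝 c) := by
  have hd : HasDerivAt (fun x : ℝ => 1 - Real.exp (-(x * c))) c 0 := by
    have h1 : HasDerivAt (fun x : ℝ => -(x * c)) (-(1 * c)) 0 :=
      ((hasDerivAt_id (0 : ℝ)).mul_const c).neg
    simpa using (h1.exp.const_sub 1)
  have h := hd.tendsto_slope_zero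
  have hn : Tendsto (fun n : ℕ => ((n : ℝ) + 1)⁻¹) atTop (𝓝[≠] 0) := by
    refine tendsto_nhdsWithin_iff.mpr ⟨?_, Eventually.of_forall fun n => ?_⟩
    · simpa using tendsto_one_div_add_atTop_nhds_zero_nat (𝕜 := ℝ)
    · exact inv_ne_zero (by positivity)
  refine (h.comp hn).congr fun n => ?_
  simp

end Exponential

/-! ### Exponential one-time moments -/

section Rates

variable {Ω : Type*} [MeasurableSpace Ω] {μ : Measure Ω} [IsProbabilityMeasure μ]
  {M : ℝ≥0 → Ω → ℝ} {τ : Ω → ℝ≥0∞}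

theorem tendsto_alive_inv {Ω : Type*} {τ : Ω → ℝ≥0∞} {ω : Ω} (h : 0 < τ ω) :
    Tendsto (fun n : ℕ => alive τ (((n : ℝ≥0) + 1)⁻¹) ω) atTop (𝓝 1) := by
  have h2 : Tendsto (fun n : ℕ => ((((n : ℝ≥0) + 1)⁻¹ : ℝ≥0) : ℝ≥0∞)) atTop (𝓝 0) := by
    exact ENNReal.tendsto_coe.mpr tendsto_inv_nat_add_one_nnreal
  refine tendsto_const_nhds.congr' ?_
  filter_upwards [h2.eventually (gt_mem_nhds h)] with n hn
  exact (alive_of_lt hn).symm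

theorem IsPureJumpPath.tendsto_inv {f : ℝ≥0 → ℝ} (hf : IsPureJumpPath f) :
    Tendsto (fun n : ℕ => f (((n : ℝ≥0) + 1)⁻¹)) atTop (𝓝 (f 0)) :=
  (hf.right_continuous 0).tendsto.comp (tendsto_nhdsWithin_iff.mpr
    ⟨tendsto_inv_nat_add_one_nnreal, Eventually.of_forall fun _ => mem_Ici.mpr zero_le⟩)

theorem alive_antitone {Ω : Type*} (τ : Ω → ℝ≥0∞) (ω : Ω) : Antitone fun r => alive τ r ω := by
  intro r s hrs
  beta_reduce
  by_cases h : (s : ℝ≥0∞) < τ ω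
  · rw [alive_of_lt h, alive_of_lt (lt_of_le_of_lt (by exact_mod_cast hrs) h)]
  · rw [alive_of_le (not_lt.mp h)]
    exact (alive_mem_Icc _ _ _).1

/-- The Markov property gives multiplicativity in t; right continuity at 0, with M_0 = 1 and τ > 0,
gives the limit 1 at small times. The case k = 0 is the survival function of τ, and τ = ∞ gives the
plain moments of M. -/
theorem IsMarkovPair.exists_rate (H : IsMarkovPair μ M τ) (hM : IsPureJumpProcess M)
    (hτm : Measurable τ) (h1 : ∀ᵐ ω ∂μ, M 0 ω = 1) (hτ : ∀ᵐ ω ∂μ, 0 < τ ω) (k : ℕ) :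
    ∃ c : ℝ, ∀ t : ℝ≥0, ∫ ω, M t ω ^ k * alive τ t ω ∂μ = Real.exp (-(t * c)) := by
  have hm : ∀ t, Measurable fun ω => M t ω ^ k * alive τ t ω := fun t =>
    ((hM.measurable t).pow_const k).mul (measurable_alive hτm t)
  have h01 : ∀ t, ∀ᵐ ω ∂μ, M t ω ^ k * alive τ t ω ∈ Icc (0 : ℝ) 1 := fun t => by
    filter_upwards [h1] with ω hω
    have hp := (hM.path ω).pos t
    have hle : M t ω ≤ 1 := hω ▸ (hM.path ω).antitone zero_le
    exact unitInterval.mul_mem ⟨by positivity, pow_le_one₀ hp.le hle⟩ (alive_mem_Icc _ _ _)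
  have h_int : ∀ t, Integrable (fun ω => M t ω ^ k * alive τ t ω) μ := fun t =>
    integrable_of_mem_Icc (hm t).aestronglyMeasurable (h01 t)
  refine exists_rate_of_multiplicative (g := fun t => ∫ ω, M t ω ^ k * alive τ t ω ∂μ)
    (fun t s => ?_) (fun s t hst => ?_) ?_
  · have := H.before t s (List.replicate k t) (List.replicate k s) fun x hx =>
      (List.eq_of_mem_replicate hx).le
    simp only [List.map_replicate, List.prod_replicate] at this
    rw [← this]
    refine integral_congr_ae (ae_of_all _ fun ω => ?_)
    simp only [future, div_pow]
    rw [mul_div_cancel₀ _ (pow_ne_zero k ((hM.path ω).pos t).ne')]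
  · refine integral_mono (h_int t) (h_int s) fun ω => ?_
    have hp := ((hM.path ω).pos t).le
    exact mul_le_mul (pow_le_pow_left₀ hp ((hM.path ω).antitone hst) k) (alive_antitone τ ω hst)
      (alive_mem_Icc _ _ _).1 (pow_nonneg ((hM.path ω).pos s).le k)
  · rw [show (𝓝 (1 : ℝ)) = 𝓝 (∫ _, 1 ∂μ) by simp]
    refine tendsto_integral_of_dominated_convergence (fun _ => 1)
      (fun n => (hm _).aestronglyMeasurable) (integrable_const _) (fun n => ?_) ?_
    · filter_upwards [h01 (((n : ℝ≥0) + 1)⁻¹)] with ω hω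
      rw [Real.norm_eq_abs, abs_of_nonneg hω.1]
      exact hω.2
    · filter_upwards [h1, hτ] with ω hω h2
      have h3 := ((hM.path ω).tendsto_inv.pow k).mul (tendsto_alive_inv h2)
      rw [hω] at h3
      simpa using h3

theorem IsMarkovPair.map_past_future_top (H : IsMarkovPair μ M fun _ => ∞)
    (hM : IsPureJumpProcess M) (h01 : ∀ t, ∀ᵐ ω ∂μ, M t ω ∈ Icc (0 : ℝ) 1) (t : ℝ≥0) :
    μ.map (fun ω => ((fun s : Iic t => M s ω), future M t ω)) =
      (μ.map fun ω (s : Iic t) => M s ω).prod (μ.map fun ω t => M t ω) :=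
  map_prodMk_eq_prod_of_moments (X := fun (s : Iic t) ω => M s ω)
    (X' := fun (s : Iic t) ω => M s ω) (Y := fun v ω => future M t ω v) (Y' := M)
    (fun s => hM.measurable s) (measurable_future hM.measurable t) (fun s => hM.measurable s)
    hM.measurable (fun s => h01 s) (fun v => ae_of_all _ fun ω => hM.future_mem_Icc t v ω)
    (fun s => h01 s) h01 fun k l => by
      have := H.top_integral t (k.map Subtype.val) l fun s hs => by
        obtain ⟨s', _, rfl⟩ := List.mem_map.mp hs
        exact s'.2
      simpa only [List.map_map, Function.comp_def] using this

theorem IsMarkovPair.integral_mul_comp_future (H : IsMarkovPair μ M fun _ => ∞)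
    (hM : IsPureJumpProcess M) (h1 : ∀ᵐ ω ∂μ, M 0 ω = 1) (t s : ℝ≥0) {F G : ℝ → ℝ}
    (hF : Measurable F) (hG : Measurable G) :
    ∫ ω, F (M t ω) * G (future M t ω s) ∂μ = (∫ ω, F (M t ω) ∂μ) * ∫ ω, G (M s ω) ∂μ := by
  have h01 : ∀ t, ∀ᵐ ω ∂μ, M t ω ∈ Icc (0 : ℝ) 1 := fun t => by
    filter_upwards [h1] with ω hω
    exact ⟨((hM.path ω).pos t).le, hω ▸ (hM.path ω).antitone zero_le⟩
  have e := H.map_past_future_top hM h01 t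
  have hX : Measurable fun ω (s : Iic t) => M s ω := measurable_pi_lambda _ fun s => hM.measurable s
  have hY : Measurable (future M t) := measurable_pi_lambda _ (measurable_future hM.measurable t)
  have hfm : Measurable fun x : (Iic t → ℝ) × (ℝ≥0 → ℝ) => F (x.1 ⟨t, self_mem_Iic⟩) * G (x.2 s) :=
    (hF.comp (by fun_prop)).mul (hG.comp (by fun_prop))
  have hF1 : Measurable fun x : Iic t → ℝ => F (x ⟨t, self_mem_Iic⟩) :=
    hF.comp (measurable_pi_apply _)
  have hG1 : Measurable fun z : ℝ≥0 → ℝ => G (z s) := hG.comp (measurable_pi_apply _)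
  have e1 := integral_map (μ := μ) (hX.prodMk hY).aemeasurable hfm.aestronglyMeasurable
  rw [e, integral_prod_mul (fun x : Iic t → ℝ => F (x ⟨t, self_mem_Iic⟩))
    (fun z : ℝ≥0 → ℝ => G (z s)), integral_map hX.aemeasurable hF1.aestronglyMeasurable,
    integral_map (measurable_pi_lambda _ hM.measurable).aemeasurable
      hG1.aestronglyMeasurable] at e1
  exact e1.symm

end Rates

/-! ### Weak limits of weighted laws on [0,1] -/

section LimitMeasures

/-- The normalised measures converge along an ultrafilter by compactness; multiplying by the limit
mass gives the limit. If that mass is 0, the choice of normalisation is irrelevant. -/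
theorem exists_tendsto_of_tendsto_mass {E : Type*} [TopologicalSpace E] [MeasurableSpace E]
    [Nonempty E] [OpensMeasurableSpace E] [CompactSpace (ProbabilityMeasure E)]
    {κ : ℕ → FiniteMeasure E} {a : ℝ≥0} (h : Tendsto (fun n => (κ n).mass) atTop (𝓝 a)) :
    ∃ (κ' : FiniteMeasure E) (U : Filter ℕ), U.NeBot ∧ U ≤ atTop ∧
      ∀ f : BoundedContinuousFunction E ℝ,
        Tendsto (fun n => ∫ x, f x ∂(κ n : Measure E)) U (𝓝 (∫ x, f x ∂(κ' : Measure E))) := by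
  let U : Ultrafilter ℕ := hyperfilter ℕ
  have hU : (U : Filter ℕ) ≤ atTop := Nat.hyperfilter_le_atTop
  obtain ⟨ν, -, hν⟩ := isCompact_univ.ultrafilter_le_nhds (U.map fun n => (κ n).normalize) (by simp)
  have hν' : Tendsto (fun n => (κ n).normalize) U (𝓝 ν) := hν
  have e : ∀ (c : ℝ≥0) (ρ : ProbabilityMeasure E) (f : BoundedContinuousFunction E ℝ),
      ∫ x, f x ∂((c • ρ.toFiniteMeasure : FiniteMeasure E) : Measure E) =
        c * ∫ x, f x ∂(ρ : Measure E) := fun c ρ f => by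
    rw [FiniteMeasure.toMeasure_smul, integral_smul_nnreal_measure]
    rfl
  refine ⟨a • ν.toFiniteMeasure, U, inferInstance, hU, fun f => ?_⟩
  have h1 := ProbabilityMeasure.tendsto_iff_forall_integral_tendsto.mp hν' f
  have h2 : Tendsto (fun n => ((κ n).mass : ℝ)) U (𝓝 a) :=
    NNReal.tendsto_coe.mpr (h.mono_left hU)
  rw [e]
  refine (h2.mul h1).congr fun n => ?_
  rw [← e, ← FiniteMeasure.self_eq_mass_smul_normalize]

/-- A weak limit, along some ultrafilter, of weighted laws of `[0,1]`-valued variables. -/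
theorem exists_limit_of_weighted_laws {Ω : Type*} [MeasurableSpace Ω] {μ : Measure Ω}
    {X W : ℕ → Ω → ℝ} (hX : ∀ n, Measurable (X n)) (hX01 : ∀ n, ∀ᵐ ω ∂μ, X n ω ∈ Icc (0 : ℝ) 1)
    (hW : ∀ n, Measurable (W n)) (hW0 : ∀ n, ∀ᵐ ω ∂μ, 0 ≤ W n ω) (hWi : ∀ n, Integrable (W n) μ)
    {a : ℝ} (h : Tendsto (fun n => ∫ ω, W n ω ∂μ) atTop (𝓝 a)) :
    ∃ (κ : Measure ℝ) (U : Filter ℕ), IsFiniteMeasure κ ∧ κ (Icc 0 1)ᶜ = 0 ∧ U.NeBot ∧ U ≤ atTop ∧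
      ∀ f : ℝ → ℝ, Continuous f →
        Tendsto (fun n => ∫ ω, W n ω * f (X n ω) ∂μ) U (𝓝 (∫ u, f u ∂κ)) := by
  have hpX : ∀ n, Measurable fun ω => projIcc (0 : ℝ) 1 zero_le_one (X n ω) := fun n =>
    continuous_projIcc.measurable.comp (hX n)
  have hWm : ∀ n, Measurable fun ω => ENNReal.ofReal (W n ω) := fun n => (hW n).ennreal_ofReal
  have hfin : ∀ n, IsFiniteMeasure (μ.withDensity fun ω => ENNReal.ofReal (W n ω)) := fun n =>
    isFiniteMeasure_withDensity_ofReal (hWi n).2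
  let κ : ℕ → FiniteMeasure unitInterval := fun n =>
    ⟨(μ.withDensity fun ω => ENNReal.ofReal (W n ω)).map
      fun ω => projIcc (0 : ℝ) 1 zero_le_one (X n ω),
      @Measure.isFiniteMeasure_map _ _ _ _ _ (hfin n) _⟩
  have hκ : ∀ n (f : ℝ → ℝ), Continuous f →
      ∫ x, f x ∂(κ n : Measure unitInterval) = ∫ ω, W n ω * f (X n ω) ∂μ := fun n f hf => by
    have e1 : ∫ x, f x ∂(κ n : Measure unitInterval) =
        ∫ ω, f (projIcc (0 : ℝ) 1 zero_le_one (X n ω) : ℝ)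
          ∂(μ.withDensity fun ω => ENNReal.ofReal (W n ω)) :=
      integral_map (f := fun x : unitInterval => f x) (hpX n).aemeasurable
        (hf.comp continuous_subtype_val).measurable.aestronglyMeasurable
    rw [e1, integral_withDensity_eq_integral_toReal_smul (hWm n)
      (ae_of_all _ fun ω => ENNReal.ofReal_lt_top)]
    refine integral_congr_ae ?_
    filter_upwards [hX01 n, hW0 n] with ω h1 h2
    rw [coe_projIcc_zero_one h1, ENNReal.toReal_ofReal h2, smul_eq_mul]
  have ha : 0 ≤ a := ge_of_tendsto' h fun n => integral_nonneg_of_ae (hW0 n)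
  have hmass : Tendsto (fun n => (κ n).mass) atTop (𝓝 a.toNNReal) := by
    rw [← NNReal.tendsto_coe, Real.coe_toNNReal a ha]
    refine h.congr fun n => ?_
    have := hκ n (fun _ => 1) continuous_const
    simp only [mul_one] at this
    rw [← this, integral_const, smul_eq_mul, mul_one]
    rfl
  obtain ⟨κ', U, hU, hle, hlim⟩ := exists_tendsto_of_tendsto_mass hmass
  refine ⟨(κ' : Measure unitInterval).map Subtype.val, U, inferInstance, ?_, hU, hle,
    fun f hf => ?_⟩
  · rw [Measure.map_apply measurable_subtype_coe measurableSet_Icc.compl]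
    convert measure_empty (μ := (κ' : Measure unitInterval))
    ext x
    simp
  · rw [integral_map measurable_subtype_coe.aemeasurable hf.measurable.aestronglyMeasurable]
    refine (hlim (BoundedContinuousFunction.mkOfCompact
      ⟨fun x : unitInterval => f x, hf.comp continuous_subtype_val⟩)).congr fun n => ?_
    exact hκ n f hf

end LimitMeasures

/-! ### Pathwise bounds for sums over grid cells -/

section PathSums

variable {f : ℝ≥0 → ℝ}

/-- The sum over the jump times `s ≤ t` of the jumps, weighted by powers of the jump ratios. -/
noncomputable def jumpSum (f : ℝ≥0 → ℝ) (m : ℕ) (t : ℝ≥0) : ℝ :=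
  ∑' s : ℝ≥0, (Iic t).indicator
    (fun s => (Function.leftLim f s - f s) * (f s / Function.leftLim f s) ^ m) s

namespace IsPureJumpPath

variable (hf : IsPureJumpPath f)

include hf

theorem le_leftLim (s : ℝ≥0) : f s ≤ Function.leftLim f s := hf.antitone.le_leftLim le_rfl

theorem leftLim_pos (s : ℝ≥0) : 0 < Function.leftLim f s := (hf.pos s).trans_le (hf.le_leftLim s)

theorem ratio_mem (s : ℝ≥0) : f s / Function.leftLim f s ∈ Icc (0 : ℝ) 1 :=
  ⟨div_nonneg (hf.pos s).le (hf.leftLim_pos s).le,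
    (div_le_one (hf.leftLim_pos s)).mpr (hf.le_leftLim s)⟩

theorem hasSum_indicator (t : ℝ≥0) :
    HasSum ((Iic t).indicator fun s => Function.leftLim f s - f s) (f 0 - f t) :=
  hasSum_subtype_iff_indicator.mp (hf.hasSum_jumps t)

theorem jump_mul_pow_le (m : ℕ) (s : ℝ≥0) :
    (Function.leftLim f s - f s) * (f s / Function.leftLim f s) ^ m ≤ Function.leftLim f s - f s :=
  mul_le_of_le_one_right (sub_nonneg.mpr (hf.le_leftLim s))
    (pow_le_one₀ (hf.ratio_mem s).1 (hf.ratio_mem s).2)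

theorem jump_mul_pow_nonneg (m : ℕ) (s : ℝ≥0) :
    0 ≤ (Function.leftLim f s - f s) * (f s / Function.leftLim f s) ^ m :=
  mul_nonneg (sub_nonneg.mpr (hf.le_leftLim s)) (pow_nonneg (hf.ratio_mem s).1 m)

theorem hasSum_jumpSum (m : ℕ) (t : ℝ≥0) :
    HasSum ((Iic t).indicator
      fun s => (Function.leftLim f s - f s) * (f s / Function.leftLim f s) ^ m)
      (jumpSum f m t) := by
  refine (Summable.of_nonneg_of_le (fun s => indicator_nonneg
    (fun s _ => hf.jump_mul_pow_nonneg m s) s) (fun s => ?_) (hf.hasSum_indicator t).summable).hasSum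
  exact indicator_le_indicator (hf.jump_mul_pow_le m s)

/-- Every genuine jump has ratio below 1, so each term tends to 0; the terms are dominated by the
jumps, which are summable. -/
theorem tendsto_jumpSum (t : ℝ≥0) : Tendsto (fun m => jumpSum f m t) atTop (𝓝 0) := by
  have := tendsto_tsum_of_dominated_convergence (𝓕 := atTop)
    (f := fun (m : ℕ) (s : ℝ≥0) => (Iic t).indicator
      (fun s => (Function.leftLim f s - f s) * (f s / Function.leftLim f s) ^ m) s)
    (g := fun _ => (0 : ℝ)) (bound := (Iic t).indicator fun s => Function.leftLim f s - f s)
    (hf.hasSum_indicator t).summable (fun s => ?_) (Eventually.of_forall fun m s => ?_)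
  · simpa [jumpSum] using this
  · by_cases hs : s ∈ Iic t
    · simp only [indicator_of_mem hs]
      rcases (hf.le_leftLim s).eq_or_lt with h | h
      · simp [h]
      · have hq : f s / Function.leftLim f s < 1 := (div_lt_one (hf.leftLim_pos s)).mpr h
        simpa using (tendsto_pow_atTop_nhds_zero_of_lt_one (hf.ratio_mem s).1 hq).const_mul
          (Function.leftLim f s - f s)
    · simp only [indicator_of_notMem hs]
      exact tendsto_const_nhds
  · rw [Real.norm_eq_abs, abs_of_nonneg (indicator_nonneg
      (fun s _ => hf.jump_mul_pow_nonneg m s) s)]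
    exact indicator_le_indicator (hf.jump_mul_pow_le m s)

/-- The pure-jump property writes f(a) - f(b) as the sum of the jumps in (a, b], and each of these
has ratio at least f(b)/f(a). A continuous decrease would violate the bound for large m. -/
theorem sub_mul_ratio_pow_le (m : ℕ) {a b : ℝ≥0} (hab : a ≤ b) :
    (f a - f b) * (f b / f a) ^ m ≤ jumpSum f m b - jumpSum f m a := by
  have h1 := ((hf.hasSum_indicator b).sub (hf.hasSum_indicator a)).mul_right ((f b / f a) ^ m)
  have h2 := (hf.hasSum_jumpSum m b).sub (hf.hasSum_jumpSum m a)
  have e : f 0 - f b - (f 0 - f a) = f a - f b := by ring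
  rw [e] at h1
  refine hasSum_le (fun s => ?_) h1 h2
  by_cases hsa : s ≤ a
  · rw [indicator_of_mem (s := Iic b) (hsa.trans hab), indicator_of_mem (s := Iic a) hsa,
      indicator_of_mem (s := Iic b) (hsa.trans hab), indicator_of_mem (s := Iic a) hsa]
    simp
  · rw [indicator_of_notMem (s := Iic a) hsa, indicator_of_notMem (s := Iic a) hsa]
    by_cases hsb : s ≤ b
    · rw [indicator_of_mem (s := Iic b) hsb, indicator_of_mem (s := Iic b) hsb, sub_zero, sub_zero]
      refine mul_le_mul_of_nonneg_left (pow_le_pow_left₀ (div_nonneg (hf.pos b).le (hf.pos a).le)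
        ?_ m) (sub_nonneg.mpr (hf.le_leftLim s))
      exact div_le_div₀ (hf.pos s).le (hf.antitone hsb) (hf.leftLim_pos s)
        (hf.antitone.leftLim_le (not_le.mp hsa))
    · rw [indicator_of_notMem (s := Iic b) hsb, indicator_of_notMem (s := Iic b) hsb]
      simp

theorem jumpSum_nonneg (m : ℕ) (t : ℝ≥0) : 0 ≤ jumpSum f m t :=
  (hf.hasSum_jumpSum m t).nonneg fun s => indicator_nonneg (fun s _ => hf.jump_mul_pow_nonneg m s) s

end IsPureJumpPath

/-- The sum, over the cells of the grid of mesh `1 / (n + 1)` on `[0, 1]`, of the decrements of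
`f` weighted by `g` of the ratios. -/
noncomputable def gridSum (f : ℝ≥0 → ℝ) (g : ℝ → ℝ) (n : ℕ) : ℝ :=
  ∑ k ∈ Finset.range (n + 1), f (k * ((n : ℝ≥0) + 1)⁻¹) *
    ((1 - f (k * ((n : ℝ≥0) + 1)⁻¹ + ((n : ℝ≥0) + 1)⁻¹) / f (k * ((n : ℝ≥0) + 1)⁻¹)) *
      g (f (k * ((n : ℝ≥0) + 1)⁻¹ + ((n : ℝ≥0) + 1)⁻¹) / f (k * ((n : ℝ≥0) + 1)⁻¹)))

theorem grid_last (n : ℕ) : ((n + 1 : ℕ) : ℝ≥0) * ((n : ℝ≥0) + 1)⁻¹ = 1 := by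
  push_cast
  exact mul_inv_cancel₀ (by positivity)

theorem grid_succ (n k : ℕ) : ((k + 1 : ℕ) : ℝ≥0) * ((n : ℝ≥0) + 1)⁻¹ =
    k * ((n : ℝ≥0) + 1)⁻¹ + ((n : ℝ≥0) + 1)⁻¹ := by
  push_cast
  ring

theorem grid_le_one {n k : ℕ} (hk : k < n + 1) :
    (k : ℝ≥0) * ((n : ℝ≥0) + 1)⁻¹ + ((n : ℝ≥0) + 1)⁻¹ ≤ 1 := by
  rw [← grid_succ]
  refine le_of_le_of_eq (mul_le_mul_left ?_ _) (grid_last n)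
  exact_mod_cast hk

theorem gridSum_eq (hf : ∀ t, 0 < f t) (g : ℝ → ℝ) (n : ℕ) : gridSum f g n =
    ∑ k ∈ Finset.range (n + 1), (f (k * ((n : ℝ≥0) + 1)⁻¹) - f ((k + 1 : ℕ) * ((n : ℝ≥0) + 1)⁻¹)) *
      g (f ((k + 1 : ℕ) * ((n : ℝ≥0) + 1)⁻¹) / f (k * ((n : ℝ≥0) + 1)⁻¹)) := by
  refine Finset.sum_congr rfl fun k _ => ?_
  rw [grid_succ, ← mul_assoc, mul_sub, mul_one, mul_div_cancel₀ _ (hf _).ne']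

theorem IsPureJumpPath.gridSum_pow_le (hf : IsPureJumpPath f) (m n : ℕ) :
    gridSum f (fun u => u ^ m) n ≤ jumpSum f m 1 := by
  rw [gridSum_eq hf.pos]
  calc _ ≤ ∑ k ∈ Finset.range (n + 1), (jumpSum f m ((k + 1 : ℕ) * ((n : ℝ≥0) + 1)⁻¹) -
        jumpSum f m (k * ((n : ℝ≥0) + 1)⁻¹)) := by
        refine Finset.sum_le_sum fun k _ => hf.sub_mul_ratio_pow_le m ?_
        gcongr
        exact_mod_cast Nat.le_succ k
    _ = jumpSum f m 1 - jumpSum f m 0 := by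
        rw [Finset.sum_range_sub (fun k : ℕ => jumpSum f m (k * ((n : ℝ≥0) + 1)⁻¹)), grid_last]
        simp
    _ ≤ _ := sub_le_self _ (hf.jumpSum_nonneg m 0)

theorem gridSum_le_mul (hf : ∀ t, 0 < f t) (hanti : Antitone f) {g : ℝ → ℝ} {C : ℝ} (n : ℕ)
    (hg : ∀ k < n + 1, g (f ((k + 1 : ℕ) * ((n : ℝ≥0) + 1)⁻¹) / f (k * ((n : ℝ≥0) + 1)⁻¹)) ≤ C) :
    gridSum f g n ≤ (f 0 - f 1) * C := by
  rw [gridSum_eq hf]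
  calc _ ≤ ∑ k ∈ Finset.range (n + 1),
        (f (k * ((n : ℝ≥0) + 1)⁻¹) - f ((k + 1 : ℕ) * ((n : ℝ≥0) + 1)⁻¹)) * C := by
        refine Finset.sum_le_sum fun k hk => mul_le_mul_of_nonneg_left
          (hg k (Finset.mem_range.mp hk)) (sub_nonneg.mpr (hanti ?_))
        gcongr
        exact_mod_cast Nat.le_succ k
    _ = (f 0 - f 1) * C := by
        rw [← Finset.sum_mul,
          Finset.sum_range_sub' (fun k : ℕ => f (k * ((n : ℝ≥0) + 1)⁻¹)), grid_last]
        simp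

theorem IsPureJumpPath.grid_ratio_mem (hf : IsPureJumpPath f) (n k : ℕ) :
    f ((k + 1 : ℕ) * ((n : ℝ≥0) + 1)⁻¹) / f (k * ((n : ℝ≥0) + 1)⁻¹) ∈ Icc (0 : ℝ) 1 := by
  rw [grid_succ]
  exact Ioc_subset_Icc_self (hf.future_mem_Ioc _ _)

/-- As f(0) = 1, every cell ratio on [0,1] is at least f(1), which is positive; the bound therefore
tends to 0 as m grows, uniformly in the mesh. -/
theorem IsPureJumpPath.gridSum_one_sub_pow_le (hf : IsPureJumpPath f) (h0 : f 0 = 1) (m n : ℕ) :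
    gridSum f (fun u => (1 - u) ^ m) n ≤ (1 - f 1) ^ m := by
  have h1 : f 1 ≤ 1 := h0 ▸ hf.antitone zero_le
  refine (gridSum_le_mul hf.pos hf.antitone (C := (1 - f 1) ^ m) n fun k hk => ?_).trans
    (mul_le_of_le_one_left (pow_nonneg (by linarith) m) (by linarith [hf.pos 1]))
  refine pow_le_pow_left₀ (by linarith [(hf.grid_ratio_mem n k).2]) (sub_le_sub_left ?_ 1) m
  rw [le_div_iff₀ (hf.pos _)]
  calc f 1 * f (k * ((n : ℝ≥0) + 1)⁻¹) ≤ f 1 * 1 :=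
        mul_le_mul_of_nonneg_left (h0 ▸ hf.antitone zero_le) (hf.pos 1).le
    _ ≤ _ := by
        rw [mul_one, grid_succ]
        exact hf.antitone (grid_le_one hk)

end PathSums

/-! ### The measure of the jumps before the separation time -/

section SmallJumps

variable {Ω : Type*} [MeasurableSpace Ω] {μ : Measure Ω} [IsProbabilityMeasure μ]
  {M : ℝ≥0 → Ω → ℝ} {τ : Ω → ℝ≥0∞}

/-- Dominated convergence for the supremum over n. The bounds b are not assumed measurable, whence
the detour through the measurable supremum. -/
theorem exists_tendsto_zero_integral_le {S : ℕ → ℕ → Ω → ℝ} (hS : ∀ m n, Measurable (S m n))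
    (h1 : ∀ m n, ∀ᵐ ω ∂μ, S m n ω ∈ Icc (0 : ℝ) 1) {b : ℕ → Ω → ℝ}
    (hb : ∀ᵐ ω ∂μ, ∀ m n, S m n ω ≤ b m ω)
    (hb0 : ∀ᵐ ω ∂μ, Tendsto (fun m => b m ω) atTop (𝓝 0)) :
    ∃ β : ℕ → ℝ, Tendsto β atTop (𝓝 0) ∧ ∀ m n, ∫ ω, S m n ω ∂μ ≤ β m := by
  let B : ℕ → Ω → ℝ≥0∞ := fun m ω => ⨆ n, ENNReal.ofReal (S m n ω)
  have hB : ∀ m, Measurable (B m) := fun m => Measurable.iSup fun n => (hS m n).ennreal_ofReal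
  have hB1 : ∀ m, ∀ᵐ ω ∂μ, B m ω ≤ 1 := fun m => by
    filter_upwards [ae_all_iff.mpr (h1 m)] with ω hω
    refine iSup_le fun n => ?_
    rw [← ENNReal.ofReal_one]
    exact ENNReal.ofReal_le_ofReal (hω n).2
  have hlim : Tendsto (fun m => ∫⁻ ω, B m ω ∂μ) atTop (𝓝 0) := by
    have := tendsto_lintegral_of_dominated_convergence (μ := μ) (F := B) (f := fun _ => 0)
      (fun _ => 1) hB hB1 (by simp) ?_
    · simpa using this
    · filter_upwards [hb, hb0] with ω hω h0
      refine tendsto_of_tendsto_of_tendsto_of_le_of_le tendsto_const_nhds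
        (h := fun m => ENNReal.ofReal (b m ω)) ?_ (fun m => zero_le)
        fun m => iSup_le fun n => ENNReal.ofReal_le_ofReal (hω m n)
      simpa using ENNReal.tendsto_ofReal h0
  have hfin : ∀ m, ∫⁻ ω, B m ω ∂μ ≠ ∞ := fun m =>
    ((lintegral_mono_ae (hB1 m)).trans_lt (by simp)).ne
  refine ⟨fun m => (∫⁻ ω, B m ω ∂μ).toReal, ?_, fun m n => ?_⟩
  · simpa [Function.comp_def] using (ENNReal.tendsto_toReal ENNReal.zero_ne_top).comp hlim
  · rw [integral_eq_lintegral_of_nonneg_ae ((h1 m n).mono fun ω hω => hω.1)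
      (hS m n).aestronglyMeasurable]
    exact ENNReal.toReal_mono (hfin m) (lintegral_mono fun ω => le_iSup
      (fun n => ENNReal.ofReal (S m n ω)) n)

theorem measurable_gridSum (hM : IsPureJumpProcess M) {g : ℝ → ℝ} (hg : Measurable g) (n : ℕ) :
    Measurable fun ω => gridSum (fun t => M t ω) g n := by
  refine Finset.measurable_sum _ fun k _ => (hM.measurable _).mul ?_
  exact (measurable_const.sub (measurable_future hM.measurable _ _)).mul
    (hg.comp (measurable_future hM.measurable _ _))

theorem IsPureJumpPath.gridSum_mem_Icc {f : ℝ≥0 → ℝ} (hf : IsPureJumpPath f) (h0 : f 0 = 1)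
    {g : ℝ → ℝ} (hg : ∀ u ∈ Icc (0 : ℝ) 1, g u ∈ Icc (0 : ℝ) 1) (n : ℕ) :
    gridSum f g n ∈ Icc (0 : ℝ) 1 := by
  constructor
  · refine Finset.sum_nonneg fun k _ => mul_nonneg (hf.pos _).le (mul_nonneg ?_ (hg _ ?_).1)
    · linarith [(hf.future_mem_Ioc (k * ((n : ℝ≥0) + 1)⁻¹) ((n : ℝ≥0) + 1)⁻¹).2]
    · exact Ioc_subset_Icc_self (hf.future_mem_Ioc _ _)
  · refine (gridSum_le_mul hf.pos hf.antitone (C := 1) n fun k _ =>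
      (hg _ (hf.grid_ratio_mem n k)).2).trans ?_
    linarith [hf.pos 1]

/-- By independent increments each cell contributes E[M at its left end] times a common factor, and
the former is at least E[M_1]. Pathwise bounds on grid sums thus control the rescaled one-step
expectation. -/
theorem IsMarkovPair.mul_integral_le_integral_gridSum (H : IsMarkovPair μ M fun _ => ∞)
    (hM : IsPureJumpProcess M) (h1 : ∀ᵐ ω ∂μ, M 0 ω = 1) {g : ℝ → ℝ} (hg : Measurable g)
    (hg01 : ∀ u ∈ Icc (0 : ℝ) 1, g u ∈ Icc (0 : ℝ) 1) (n : ℕ) :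
    (∫ ω, M 1 ω ∂μ) * (((n : ℝ) + 1) *
      ∫ ω, (1 - M (((n : ℝ≥0) + 1)⁻¹) ω) * g (M (((n : ℝ≥0) + 1)⁻¹) ω) ∂μ) ≤
      ∫ ω, gridSum (fun t => M t ω) g n ∂μ := by
  have h01 : ∀ t, ∀ᵐ ω ∂μ, M t ω ∈ Icc (0 : ℝ) 1 := fun t => by
    filter_upwards [h1] with ω hω
    exact ⟨((hM.path ω).pos t).le, hω ▸ (hM.path ω).antitone zero_le⟩
  have hMi : ∀ t, Integrable (M t) μ := fun t =>
    integrable_of_mem_Icc (hM.measurable t).aestronglyMeasurable (h01 t)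
  have hG : Measurable fun u => (1 - u) * g u := (measurable_const.sub measurable_id).mul hg
  have hG01 : ∀ u ∈ Icc (0 : ℝ) 1, (1 - u) * g u ∈ Icc (0 : ℝ) 1 := fun u hu =>
    unitInterval.mul_mem ⟨by linarith [hu.2], by linarith [hu.1]⟩ (hg01 u hu)
  have e : ∫ ω, gridSum (fun t => M t ω) g n ∂μ = ∑ k ∈ Finset.range (n + 1),
      (∫ ω, M (k * ((n : ℝ≥0) + 1)⁻¹) ω ∂μ) *
        ∫ ω, (1 - M (((n : ℝ≥0) + 1)⁻¹) ω) * g (M (((n : ℝ≥0) + 1)⁻¹) ω) ∂μ := by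
    unfold gridSum
    rw [integral_finsetSum]
    · exact Finset.sum_congr rfl fun k _ =>
        H.integral_mul_comp_future hM h1 _ _ measurable_id hG
    · intro k _
      refine integrable_of_mem_Icc ((hM.measurable _).mul
        (hG.comp (measurable_future hM.measurable _ _))).aestronglyMeasurable ?_
      filter_upwards [h01 (k * ((n : ℝ≥0) + 1)⁻¹)] with ω hω
      exact unitInterval.mul_mem hω (hG01 _ (hM.future_mem_Icc _ _ ω))
  have hI : 0 ≤ ∫ ω, (1 - M (((n : ℝ≥0) + 1)⁻¹) ω) * g (M (((n : ℝ≥0) + 1)⁻¹) ω) ∂μ :=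
    integral_nonneg_of_ae ((h01 _).mono fun ω hω => (hG01 _ hω).1)
  rw [e, ← Finset.sum_mul, ← mul_assoc]
  refine mul_le_mul_of_nonneg_right ?_ hI
  calc (∫ ω, M 1 ω ∂μ) * ((n : ℝ) + 1) = ∑ k ∈ Finset.range (n + 1), ∫ ω, M 1 ω ∂μ := by
        simp [mul_comm]
    _ ≤ _ := Finset.sum_le_sum fun k hk => integral_mono (hMi _) (hMi _) fun ω =>
        (hM.path ω).antitone (le_self_add.trans (grid_le_one (Finset.mem_range.mp hk)))

theorem measureReal_singleton_le_integral {κ : Measure ℝ} [IsFiniteMeasure κ]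
    (hκ : κ (Icc 0 1)ᶜ = 0) {g : ℝ → ℝ} (hg : Measurable g)
    (hg01 : ∀ u ∈ Icc (0 : ℝ) 1, g u ∈ Icc (0 : ℝ) 1) {x : ℝ} (hx : g x = 1) :
    κ.real {x} ≤ ∫ u, g u ∂κ := by
  have hae : ∀ᵐ u ∂κ, u ∈ Icc (0 : ℝ) 1 := hκ
  rw [← integral_indicator_one (measurableSet_singleton x)]
  refine integral_mono_ae ((integrable_const (1 : ℝ)).indicator (measurableSet_singleton x))
    (integrable_of_mem_Icc hg.aestronglyMeasurable (hae.mono fun u hu => hg01 u hu)) ?_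
  filter_upwards [hae] with u hu
  by_cases h : u = x
  · simp [h, hx]
  · simpa [h] using (hg01 u hu).1

variable (H : IsMarkovPair μ M τ) (hM : IsPureJumpProcess M) (hτm : Measurable τ)
  (h1 : ∀ᵐ ω ∂μ, M 0 ω = 1) (hτ : ∀ᵐ ω ∂μ, 0 < τ ω) {c : ℕ → ℝ}
  (hc : ∀ k (t : ℝ≥0), ∫ ω, M t ω ^ k * alive τ t ω ∂μ = Real.exp (-(t * c k)))

include H hM hτm h1 hτ hc

/-- The measure `(1 - u) Λ(du)`, for the jumps before the time `τ`. -/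
theorem IsMarkovPair.exists_weighted_jump_measure :
    ∃ κ : Measure ℝ, IsFiniteMeasure κ ∧ κ (Ioo 0 1)ᶜ = 0 ∧
      ∀ m : ℕ, ∫ u, u ^ m ∂κ = c (m + 1) - c m := by
  have h01 : ∀ t, ∀ᵐ ω ∂μ, M t ω ∈ Icc (0 : ℝ) 1 := fun t => by
    filter_upwards [h1] with ω hω
    exact ⟨((hM.path ω).pos t).le, hω ▸ (hM.path ω).antitone zero_le⟩
  have hd : ∀ n : ℕ, (0 : ℝ) < (n : ℝ) + 1 := fun n => by positivity
  let X : ℕ → Ω → ℝ := fun n => M (((n : ℝ≥0) + 1)⁻¹)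
  let W : ℕ → Ω → ℝ := fun n ω =>
    ((n : ℝ) + 1) * ((1 - X n ω) * alive τ (((n : ℝ≥0) + 1)⁻¹) ω)
  have hX : ∀ n, Measurable (X n) := fun n => hM.measurable _
  have hX01 : ∀ n, ∀ᵐ ω ∂μ, X n ω ∈ Icc (0 : ℝ) 1 := fun n => h01 _
  have hW : ∀ n, Measurable (W n) := fun n =>
    ((measurable_const.sub (hX n)).mul (measurable_alive hτm _)).const_mul _
  have hW01 : ∀ n, ∀ᵐ ω ∂μ, (1 - X n ω) * alive τ (((n : ℝ≥0) + 1)⁻¹) ω ∈ Icc (0 : ℝ) 1 := fun n => by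
    filter_upwards [hX01 n] with ω hω
    exact unitInterval.mul_mem ⟨by linarith [hω.2], by linarith [hω.1]⟩ (alive_mem_Icc _ _ _)
  have hW0 : ∀ n, ∀ᵐ ω ∂μ, 0 ≤ W n ω := fun n =>
    (hW01 n).mono fun ω hω => mul_nonneg (hd n).le hω.1
  have hWi : ∀ n, Integrable (W n) μ := fun n =>
    (integrable_of_mem_Icc ((measurable_const.sub (hX n)).mul
      (measurable_alive hτm _)).aestronglyMeasurable (hW01 n)).const_mul _
  -- (1 - X) X^m is a difference of two powers, so the exponential formula yields a difference of
  -- two derivatives at 0, namely of the rates c(m+1) and c(m).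
  have hpow : ∀ m, Tendsto (fun n => ∫ ω, W n ω * X n ω ^ m ∂μ) atTop (𝓝 (c (m + 1) - c m)) := by
    intro m
    refine ((tendsto_mul_one_sub_exp (c (m + 1))).sub (tendsto_mul_one_sub_exp (c m))).congr
      fun n => ?_
    have hi : ∀ k, Integrable (fun ω => X n ω ^ k * alive τ (((n : ℝ≥0) + 1)⁻¹) ω) μ := fun k =>
      integrable_of_mem_Icc (((hX n).pow_const k).mul
        (measurable_alive hτm _)).aestronglyMeasurable ((hX01 n).mono fun ω hω =>
          unitInterval.mul_mem ⟨pow_nonneg hω.1 k, pow_le_one₀ hω.1 hω.2⟩ (alive_mem_Icc _ _ _))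
    have e : ∀ ω, W n ω * X n ω ^ m = ((n : ℝ) + 1) * (X n ω ^ m * alive τ (((n : ℝ≥0) + 1)⁻¹) ω -
        X n ω ^ (m + 1) * alive τ (((n : ℝ≥0) + 1)⁻¹) ω) := fun ω => by
      simp only [W]; ring
    simp_rw [e]
    rw [integral_const_mul, integral_sub (hi _) (hi _), hc, hc]
    push_cast
    ring
  have hmass : Tendsto (fun n => ∫ ω, W n ω ∂μ) atTop (𝓝 (c 1 - c 0)) := by
    simpa using hpow 0
  obtain ⟨κ, U, hκf, hκ, hU, hle, hlim⟩ := exists_limit_of_weighted_laws hX hX01 hW hW0 hWi hmass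
  have hM1 : 0 < ∫ ω, M 1 ω ∂μ := by
    refine (integral_pos_iff_support_of_nonneg (fun ω => ((hM.path ω).pos 1).le)
      (integrable_of_mem_Icc (hM.measurable 1).aestronglyMeasurable (h01 1))).mpr ?_
    have : Function.support (M 1) = univ := eq_univ_of_forall fun ω => ((hM.path ω).pos 1).ne'
    rw [this, measure_univ]
    exact one_pos
  -- Functions g_m with g_m(x) = 1 dominate the indicator of {x}, so the atom at x is at most ∫ g_m
  -- dκ. This is bounded by an expected grid sum over E[M_1], uniformly in the mesh and vanishing as
  -- m grows.
  have hatom : ∀ (g : ℕ → ℝ → ℝ) (b : ℕ → Ω → ℝ) (x : ℝ), (∀ m, Continuous (g m)) →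
      (∀ m, ∀ u ∈ Icc (0 : ℝ) 1, g m u ∈ Icc (0 : ℝ) 1) → (∀ m, g m x = 1) →
      (∀ᵐ ω ∂μ, ∀ m n, gridSum (fun t => M t ω) (g m) n ≤ b m ω) →
      (∀ᵐ ω ∂μ, Tendsto (fun m => b m ω) atTop (𝓝 0)) → κ {x} = 0 := by
    intro g b x hg hg01 hx hb hb0
    obtain ⟨β, hβ, hβle⟩ := exists_tendsto_zero_integral_le
      (S := fun m n ω => gridSum (fun t => M t ω) (g m) n)
      (fun m n => measurable_gridSum hM (hg m).measurable n)
      (fun m n => h1.mono fun ω hω => (hM.path ω).gridSum_mem_Icc hω (hg01 m) n) hb hb0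
    have hle2 : ∀ m, κ.real {x} ≤ β m / ∫ ω, M 1 ω ∂μ := fun m => by
      refine (measureReal_singleton_le_integral hκ (hg m).measurable (hg01 m) (hx m)).trans ?_
      refine le_of_tendsto (hlim (g m) (hg m)) (Eventually.of_forall fun n => ?_)
      rw [le_div_iff₀ hM1, mul_comm]
      refine le_trans (mul_le_mul_of_nonneg_left ?_ hM1.le)
        (((H.to_top hτ).mul_integral_le_integral_gridSum hM h1 (hg m).measurable (hg01 m) n).trans
          (hβle m n))
      rw [← integral_const_mul]
      refine integral_mono_ae ?_ ?_ ?_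
      · have : Integrable (fun ω => ((n : ℝ) + 1) * ((1 - X n ω) *
            alive τ (((n : ℝ≥0) + 1)⁻¹) ω * g m (X n ω))) μ :=
          (integrable_of_mem_Icc (((measurable_const.sub (hX n)).mul (measurable_alive hτm _)).mul
            ((hg m).measurable.comp (hX n))).aestronglyMeasurable (by
              filter_upwards [hW01 n, hX01 n] with ω h2 h3
              exact unitInterval.mul_mem h2 (hg01 m _ h3))).const_mul _
        simpa only [W, mul_assoc] using this
      · exact (integrable_of_mem_Icc ((measurable_const.sub (hX n)).mul
          ((hg m).measurable.comp (hX n))).aestronglyMeasurable ((hX01 n).mono fun ω hω =>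
            unitInterval.mul_mem ⟨sub_nonneg.mpr hω.2, sub_le_self 1 hω.1⟩ (hg01 m _ hω))).const_mul _
      · filter_upwards [hX01 n] with ω hω
        simp only [W, mul_assoc]
        refine mul_le_mul_of_nonneg_left (mul_le_mul_of_nonneg_left ?_ ?_) (hd n).le
        · exact mul_le_of_le_one_left (hg01 m _ hω).1 (alive_mem_Icc _ _ _).2
        · linarith [hω.2]
    have h0 : κ.real {x} ≤ 0 := ge_of_tendsto' (by simpa using hβ.div_const _) hle2
    exact (measureReal_eq_zero_iff (by finiteness)).mp (le_antisymm h0 measureReal_nonneg)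
  -- An atom at 1 would be a drift; the pure-jump property enters here, through `jumpSum`.
  have hone : κ {1} = 0 := by
    refine hatom (fun m u => u ^ m) (fun m ω => jumpSum (fun t => M t ω) m 1) 1
      (fun m => continuous_pow m) (fun m u hu => ⟨pow_nonneg hu.1 m, pow_le_one₀ hu.1 hu.2⟩)
      (fun m => one_pow m) (ae_of_all _ fun ω m n => (hM.path ω).gridSum_pow_le m n)
      (ae_of_all _ fun ω => (hM.path ω).tendsto_jumpSum 1)
  -- An atom at 0 would be killing; it is excluded by M_1 > 0.
  have hzero : κ {0} = 0 := by
    refine hatom (fun m u => (1 - u) ^ m) (fun m ω => (1 - M 1 ω) ^ m) 0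
      (fun m => by fun_prop) (fun m u hu => ⟨pow_nonneg (by linarith [hu.2]) m,
        pow_le_one₀ (by linarith [hu.2]) (by linarith [hu.1])⟩)
      (fun m => by simp) (h1.mono fun ω hω m n => (hM.path ω).gridSum_one_sub_pow_le hω m n) ?_
    filter_upwards [h01 1] with ω hω
    exact tendsto_pow_atTop_nhds_zero_of_lt_one (by linarith [hω.2]) (by linarith [(hM.path ω).pos 1])
  refine ⟨κ, hκf, ?_, fun m => ?_⟩
  · have hsub : (Ioo (0 : ℝ) 1)ᶜ ⊆ (Icc 0 1)ᶜ ∪ ({1} ∪ {0}) := fun u hu => by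
      by_cases h : u ∈ Icc (0 : ℝ) 1
      · right
        by_contra hne
        simp only [mem_union, mem_singleton_iff, not_or] at hne
        exact hu ⟨lt_of_le_of_ne h.1 (Ne.symm hne.2), lt_of_le_of_ne h.2 hne.1⟩
      · exact Or.inl h
    exact measure_mono_null hsub (measure_union_null hκ (measure_union_null hone hzero))
  · exact tendsto_nhds_unique (hlim _ (continuous_pow m)) ((hpow m).mono_left hle)

/-- Dividing κ by 1-u turns 1 - u^k into the geometric sum of u^i over i < k, and the moments c(i+1)
- c(i) of κ telescope. -/
theorem IsMarkovPair.exists_splittingMeasure_before :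
    ∃ Λ₀ : Measure ℝ, IsSplittingMeasure Λ₀ ∧
      ∀ k : ℕ, 0 ≤ c k - c 0 ∧ ∫⁻ u, ENNReal.ofReal (1 - u ^ k) ∂Λ₀ = ENNReal.ofReal (c k - c 0) := by
  obtain ⟨κ, hκf, hκ, hmom⟩ := H.exists_weighted_jump_measure hM hτm h1 hτ hc
  have hae : ∀ᵐ u ∂κ, u ∈ Ioo (0 : ℝ) 1 := hκ
  have hi : ∀ m : ℕ, Integrable (fun u : ℝ => u ^ m) κ := fun m =>
    integrable_of_mem_Icc (by fun_prop) (hae.mono fun u hu =>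
      ⟨pow_nonneg hu.1.le m, pow_le_one₀ hu.1.le hu.2.le⟩)
  have hm : Measurable fun u : ℝ => ENNReal.ofReal (1 - u)⁻¹ := by fun_prop
  have key : ∀ k : ℕ, 0 ≤ c k - c 0 ∧
      ∫⁻ u, ENNReal.ofReal (1 - u ^ k) ∂(κ.withDensity fun u => ENNReal.ofReal (1 - u)⁻¹) =
        ENNReal.ofReal (c k - c 0) := fun k => by
    have hs : ∫ u, ∑ i ∈ Finset.range k, u ^ i ∂κ = c k - c 0 := by
      rw [integral_finsetSum _ fun i _ => hi i]
      simp_rw [hmom]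
      exact Finset.sum_range_sub c k
    have hnn : 0 ≤ᵐ[κ] fun u : ℝ => ∑ i ∈ Finset.range k, u ^ i :=
      hae.mono fun u hu => Finset.sum_nonneg fun i _ => pow_nonneg hu.1.le i
    refine ⟨hs ▸ integral_nonneg_of_ae hnn, ?_⟩
    rw [lintegral_withDensity_eq_lintegral_mul _ hm (by fun_prop), ← hs,
      ofReal_integral_eq_lintegral_ofReal (integrable_finsetSum _ fun i _ => hi i) hnn]
    refine lintegral_congr_ae (hae.mono fun u hu => ?_)
    have hu1 : 0 < 1 - u := by linarith [hu.2]
    simp only [Pi.mul_apply]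
    rw [← ENNReal.ofReal_mul (inv_nonneg.mpr hu1.le)]
    congr 1
    rw [← mul_neg_geom_sum u k, ← mul_assoc, inv_mul_cancel₀ hu1.ne', one_mul]
  refine ⟨_, ⟨withDensity_absolutelyContinuous κ _ hκ, ?_⟩, key⟩
  have := (key 1).2
  simp only [pow_one] at this
  rw [this]
  exact ENNReal.ofReal_lt_top

end SmallJumps

/-! ### The ratio at the separation time, and its rate -/

section SplitRatio

/-- The ratio of the values of `M` at and just before the time `τ`. -/
noncomputable def splitRatio {Ω : Type*} (M : ℝ≥0 → Ω → ℝ) (τ : Ω → ℝ≥0∞) (ω : Ω) : ℝ :=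
  M (τ ω).toNNReal ω / evalL (fun t => M t ω) (τ ω).toNNReal

theorem measurable_splitRatio {Ω : Type*} [MeasurableSpace Ω] {M : ℝ≥0 → Ω → ℝ} {τ : Ω → ℝ≥0∞}
    (hM : IsPureJumpProcess M) (hτ : Measurable τ) : Measurable (splitRatio M τ) :=
  (measurable_apply_of_rightContinuous hM.measurable (fun ω t => (hM.path ω).right_continuous t)
    hτ.ennreal_toNNReal).div
    (measurable_evalL (measurable_pi_lambda _ hM.measurable) hτ.ennreal_toNNReal)

theorem splitRatio_eq {Ω : Type*} {M : ℝ≥0 → Ω → ℝ} {τ : Ω → ℝ≥0∞} {ω : Ω}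
    (hM : IsPureJumpPath fun t => M t ω) (hτ : 0 < (τ ω).toNNReal) :
    splitRatio M τ ω = M (τ ω).toNNReal ω / Function.leftLim (fun t => M t ω) (τ ω).toNNReal := by
  rw [splitRatio, evalL_eq hM.antitone hτ]

/-- The grid cell has its left end strictly before τ and its right end at or after τ; the ends give
the left limit and the value at τ. -/
theorem tendsto_future_gridL {Ω : Type*} {M : ℝ≥0 → Ω → ℝ} {τ : Ω → ℝ≥0∞} {ω : Ω}
    (hM : IsPureJumpPath fun t => M t ω) (hτ : 0 < (τ ω).toNNReal) :
    Tendsto (fun n : ℕ => future M (gridL n (τ ω).toNNReal) ω ((n : ℝ≥0) + 1)⁻¹) atTop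
      (𝓝 (splitRatio M τ ω)) := by
  rw [splitRatio_eq hM hτ]
  have hL := tendsto_gridL hτ
  refine Tendsto.div ?_ ((hM.antitone.tendsto_leftLim _).comp hL) (hM.leftLim_pos _).ne'
  refine (hM.right_continuous (τ ω).toNNReal).tendsto.comp
    (tendsto_nhdsWithin_iff.mpr ⟨?_, Eventually.of_forall fun n => le_gridL_add n _⟩)
  simpa using (hL.mono_right nhdsWithin_le_nhds).add tendsto_inv_nat_add_one_nnreal

theorem gridL_eq (n : ℕ) (t : ℝ≥0) :
    ((⌈((n : ℝ≥0) + 1) * t⌉₊ - 1 : ℕ) : ℝ≥0) * ((n : ℝ≥0) + 1)⁻¹ = gridL n t := by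
  rw [gridL, div_eq_mul_inv]

/-- The cells are open on the left and closed on the right: if τ ≤ 1, exactly one contains τ, and
its left end is the grid point just below τ; otherwise every term vanishes. -/
theorem sum_alive_cells {Ω : Type*} {τ : Ω → ℝ≥0∞} {ω : Ω} (hτ : 0 < τ ω ∧ τ ω < ∞) (n : ℕ)
    (x : ℝ≥0 → ℝ) :
    ∑ k ∈ Finset.range (n + 1), alive τ (k * ((n : ℝ≥0) + 1)⁻¹) ω *
        (x (k * ((n : ℝ≥0) + 1)⁻¹) *
          (1 - alive τ (k * ((n : ℝ≥0) + 1)⁻¹ + ((n : ℝ≥0) + 1)⁻¹) ω)) =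
      x (gridL n (τ ω).toNNReal) * (1 - alive τ 1 ω) := by
  have hσ0 : 0 < (τ ω).toNNReal := ENNReal.toNNReal_pos hτ.1.ne' hτ.2.ne
  have hσ : ((τ ω).toNNReal : ℝ≥0∞) = τ ω := ENNReal.coe_toNNReal hτ.2.ne
  set σ := (τ ω).toNNReal
  have hlt : ∀ {r : ℝ≥0}, r < σ → alive τ r ω = 1 := fun h =>
    alive_of_lt (by rw [← hσ]; exact_mod_cast h)
  have hge : ∀ {r : ℝ≥0}, σ ≤ r → alive τ r ω = 0 := fun h =>
    alive_of_le (by rw [← hσ]; exact_mod_cast h)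
  have hN : (0 : ℝ≥0) < (n : ℝ≥0) + 1 := by positivity
  rcases le_or_gt σ 1 with h1 | h1
  · have hk : ⌈((n : ℝ≥0) + 1) * σ⌉₊ - 1 < n + 1 := by
      have : ⌈((n : ℝ≥0) + 1) * σ⌉₊ ≤ n + 1 := by
        refine Nat.ceil_le.mpr ?_
        push_cast
        exact mul_le_of_le_one_right' h1
      omega
    rw [Finset.sum_eq_single (⌈((n : ℝ≥0) + 1) * σ⌉₊ - 1)]
    · rw [gridL_eq, hlt (gridL_lt hσ0), hge (le_gridL_add n σ), hge h1]
      ring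
    · intro k _ hne
      rcases lt_or_gt_of_ne hne with h | h
      · have : (k : ℝ≥0) * ((n : ℝ≥0) + 1)⁻¹ + ((n : ℝ≥0) + 1)⁻¹ ≤ gridL n σ := by
          rw [← grid_succ, ← gridL_eq]
          refine mul_le_mul_left ?_ _
          exact_mod_cast h
        rw [hlt (this.trans_lt (gridL_lt hσ0))]
        ring
      · have : σ ≤ (k : ℝ≥0) * ((n : ℝ≥0) + 1)⁻¹ := by
          refine (le_gridL_add n σ).trans ?_
          rw [← gridL_eq, ← grid_succ]
          refine mul_le_mul_left ?_ _
          exact_mod_cast h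
        rw [hge this, zero_mul]
    · intro h
      exact absurd (Finset.mem_range.mpr hk) h
  · rw [hlt h1]
    simp only [sub_self, mul_zero]
    refine Finset.sum_eq_zero fun k hk => ?_
    rw [hlt ((grid_le_one (Finset.mem_range.mp hk)).trans_lt h1)]
    simp

namespace AsymmetricMarkovBranching

variable {Ω : Type*} [MeasurableSpace Ω] {μ : Measure Ω} {M M' : ℝ≥0 → Ω → ℝ}
  (h : AsymmetricMarkovBranching μ M M' (separationTime M M')) [IsProbabilityMeasure μ]
  (hM : IsPureJumpProcess M) (hM' : IsPureJumpProcess M')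
  (hτ : ∀ᵐ ω ∂μ, 0 < separationTime M M' ω ∧ separationTime M M' ω < ∞)

include h hM hM'

theorem integral_cell (t s : ℝ≥0) {g : ℝ → ℝ} (hg : Measurable g) :
    ∫ ω, alive (separationTime M M') t ω *
        (g (future M t ω s) * (1 - alive (separationTime M M') (t + s) ω)) ∂μ =
      (∫ ω, alive (separationTime M M') t ω ∂μ) *
        ∫ ω, g (M s ω) * (1 - alive (separationTime M M') s ω) ∂μ := by
  set τ := separationTime M M'
  have hτm : Measurable τ := measurable_separationTime hM hM'
  let G : (ℝ≥0 → ℝ × ℝ) → ℝ := fun z => g (z s).1 * (1 -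
    alive (fun z : ℝ≥0 → ℝ × ℝ => ratSeparation (fun v => (z v).1) (fun v => (z v).2)) s z)
  have hG : Measurable G := (hg.comp (by fun_prop)).mul
    (measurable_const.sub (measurable_alive (measurable_ratSeparation (by fun_prop) (by fun_prop)) s))
  have key := h.setIntegral_lt hM hM' t (F := fun _ => 1) measurable_const hG
  rw [setIntegral_lt_eq hτm, setIntegral_lt_eq hτm] at key
  simp only [one_mul] at key
  convert key using 1
  · refine integral_congr_ae (ae_of_all _ fun ω => ?_)
    simp only [G]
    by_cases ht : (t : ℝ≥0∞) < τ ω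
    · rw [alive_of_lt ht, one_mul, mul_one, alive_add]
      congr 2
      exact alive_congr (ratSeparation_future (hM.path ω) (hM'.path ω) ht).symm
    · rw [alive_of_le (not_lt.mp ht), zero_mul, mul_zero]
  · congr 1
    refine integral_congr_ae (ae_of_all _ fun ω => ?_)
    simp only [G]
    congr 2
    exact alive_congr (separationTime_eq_ratSeparation
      (hM.path ω).right_continuous (hM'.path ω).right_continuous)

include hτ

/-- By (i) at the left end of each cell, E[g(ratio over the cell of τ); τ ≤ 1] is the one-step
expectation at time 1/(n+1) times a sum of survival probabilities. The cell ratio converges to the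
ratio at τ. -/
theorem tendsto_mul_integral_before {g : ℝ → ℝ} (hg : Continuous g)
    (hg01 : ∀ u ∈ Icc (0 : ℝ) 1, g u ∈ Icc (0 : ℝ) 1) {lam : ℝ} (hlam : 0 < lam)
    (hrate : ∀ t : ℝ≥0, ∫ ω, alive (separationTime M M') t ω ∂μ = Real.exp (-(t * lam))) :
    Tendsto (fun n : ℕ => ((n : ℝ) + 1) * ∫ ω, g (M (((n : ℝ≥0) + 1)⁻¹) ω) *
        (1 - alive (separationTime M M') (((n : ℝ≥0) + 1)⁻¹) ω) ∂μ) atTop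
      (𝓝 (lam / (1 - Real.exp (-lam)) *
        ∫ ω in {ω | separationTime M M' ω ≤ 1}, g (splitRatio M (separationTime M M') ω) ∂μ)) := by
  set τ := separationTime M M'
  have hτm : Measurable τ := measurable_separationTime hM hM'
  have hpi : 0 < 1 - Real.exp (-lam) := by
    have : Real.exp (-lam) < 1 := by rw [Real.exp_lt_one_iff]; linarith
    linarith
  have hd01 : ∀ r ω, 1 - alive τ r ω ∈ Icc (0 : ℝ) 1 := fun r ω =>
    ⟨sub_nonneg.mpr (alive_mem_Icc _ _ _).2, sub_le_self 1 (alive_mem_Icc _ _ _).1⟩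
  have hdm : ∀ r, Measurable fun ω => 1 - alive τ r ω := fun r =>
    measurable_const.sub (measurable_alive hτm r)
  have hcell : ∀ (f : ℝ → ℝ), Continuous f → (∀ u ∈ Icc (0 : ℝ) 1, f u ∈ Icc (0 : ℝ) 1) → ∀ n : ℕ,
      ∫ ω, f (future M (gridL n (τ ω).toNNReal) ω ((n : ℝ≥0) + 1)⁻¹) * (1 - alive τ 1 ω) ∂μ =
      (∑ k ∈ Finset.range (n + 1), ∫ ω, alive τ (k * ((n : ℝ≥0) + 1)⁻¹) ω ∂μ) *
        ∫ ω, f (M (((n : ℝ≥0) + 1)⁻¹) ω) * (1 - alive τ (((n : ℝ≥0) + 1)⁻¹) ω) ∂μ := by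
    intro f hf hf01 n
    have e : ∀ k : ℕ, (∫ ω, alive τ (k * ((n : ℝ≥0) + 1)⁻¹) ω ∂μ) *
        (∫ ω, f (M (((n : ℝ≥0) + 1)⁻¹) ω) * (1 - alive τ (((n : ℝ≥0) + 1)⁻¹) ω) ∂μ) = _ :=
      fun k => (h.integral_cell hM hM' _ _ hf.measurable).symm
    rw [Finset.sum_mul, Finset.sum_congr rfl fun k _ => e k, ← integral_finsetSum]
    · refine integral_congr_ae (hτ.mono fun ω hω => ?_)
      exact (sum_alive_cells hω n fun t => f (future M t ω ((n : ℝ≥0) + 1)⁻¹)).symm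
    · intro k _
      refine integrable_of_mem_Icc ((measurable_alive hτm _).mul ((hf.measurable.comp
        (measurable_future hM.measurable _ _)).mul (hdm _))).aestronglyMeasurable
        (ae_of_all _ fun ω => unitInterval.mul_mem (alive_mem_Icc _ _ _)
          (unitInterval.mul_mem (hf01 _ (hM.future_mem_Icc _ _ ω)) (hd01 _ ω)))
  have hint1 : ∀ r, ∫ ω, (1 - alive τ r ω) ∂μ = 1 - Real.exp (-(r * lam)) := fun r => by
    rw [integral_sub (integrable_const _) (integrable_of_mem_Icc
      (measurable_alive hτm r).aestronglyMeasurable (ae_of_all _ fun ω => alive_mem_Icc _ _ _)),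
      hrate]
    simp
  have hJ : Tendsto (fun n : ℕ => ∫ ω, g (future M (gridL n (τ ω).toNNReal) ω ((n : ℝ≥0) + 1)⁻¹) *
      (1 - alive τ 1 ω) ∂μ) atTop (𝓝 (∫ ω, g (splitRatio M τ ω) * (1 - alive τ 1 ω) ∂μ)) := by
    refine tendsto_integral_of_dominated_convergence (fun _ => 1) (fun n => ?_)
      (integrable_const _) (fun n => ae_of_all _ fun ω => ?_) (hτ.mono fun ω hω => ?_)
    · have hgl : Measurable fun ω => gridL n (τ ω).toNNReal := by
        unfold gridL
        exact (measurable_from_nat (f := fun m : ℕ => ((m - 1 : ℕ) : ℝ≥0))).comp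
          (Nat.measurable_ceil.comp (hτm.ennreal_toNNReal.const_mul ((n : ℝ≥0) + 1)))
          |>.div_const _
      refine ((hg.measurable.comp ?_).mul (hdm 1)).aestronglyMeasurable
      exact (measurable_apply_of_rightContinuous hM.measurable
        (fun ω t => (hM.path ω).right_continuous t) (hgl.add_const _)).div
        (measurable_apply_of_rightContinuous hM.measurable
        (fun ω t => (hM.path ω).right_continuous t) hgl)
    · have := unitInterval.mul_mem (hg01 _ (hM.future_mem_Icc (gridL n (τ ω).toNNReal)
        ((n : ℝ≥0) + 1)⁻¹ ω)) (hd01 1 ω)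
      rw [Real.norm_eq_abs, abs_of_nonneg this.1]
      exact this.2
    · exact ((hg.tendsto _).comp (tendsto_future_gridL (hM.path ω)
        (ENNReal.toNNReal_pos hω.1.ne' hω.2.ne))).mul_const _
  have hset : ∫ ω in {ω | τ ω ≤ 1}, g (splitRatio M τ ω) ∂μ =
      ∫ ω, g (splitRatio M τ ω) * (1 - alive τ 1 ω) ∂μ := by
    rw [← integral_indicator (measurableSet_le hτm measurable_const)]
    refine integral_congr_ae (ae_of_all _ fun ω => ?_)
    beta_reduce
    by_cases hω : τ ω ≤ 1
    · rw [indicator_of_mem (s := {ω | τ ω ≤ 1}) hω, alive_of_le (by simpa using hω)]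
      ring
    · rw [indicator_of_notMem (s := {ω | τ ω ≤ 1}) hω, alive_of_lt (by simpa using hω)]
      ring
  rw [hset]
  have hlim := ((tendsto_mul_one_sub_exp lam).div_const (1 - Real.exp (-lam))).mul hJ
  refine hlim.congr fun n => ?_
  -- The case g = 1 evaluates the sum of survival probabilities in terms of lam, so that it can be
  -- eliminated.
  have e1 := hcell (fun _ => 1) continuous_const (fun _ _ => by simp) n
  have e2 := hcell g hg hg01 n
  simp only [one_mul, hint1] at e1
  rw [e2, div_mul_eq_mul_div, div_eq_iff hpi.ne']
  have e3 : 1 - Real.exp (-lam) = (∑ k ∈ Finset.range (n + 1),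
      ∫ ω, alive τ (k * ((n : ℝ≥0) + 1)⁻¹) ω ∂μ) * (1 - Real.exp (-(((n : ℝ) + 1)⁻¹ * lam))) := by
    simpa using e1
  rw [e3]
  ring

end AsymmetricMarkovBranching

end SplitRatio

/-! ### The measure of the splits at the separation time, and the switching density -/

section SplittingAt

/-- Both processes have the same left limit at τ, and the junction conditions divide it between
their two positive values at τ. -/
theorem BinaryJunction.ae_splitRatio {Ω : Type*} [MeasurableSpace Ω] {μ : Measure Ω}
    {M M' : ℝ≥0 → Ω → ℝ} {τ : Ω → ℝ≥0∞} (hJ : BinaryJunction μ M M' τ)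
    (hM : IsPureJumpProcess M) (hM' : IsPureJumpProcess M')
    (hτ : ∀ᵐ ω ∂μ, 0 < τ ω ∧ τ ω < ∞) :
    ∀ᵐ ω ∂μ, splitRatio M τ ω ∈ Ioo (0 : ℝ) 1 ∧ splitRatio M' τ ω = 1 - splitRatio M τ ω := by
  filter_upwards [hJ.identification, hJ.splitting, hτ] with ω h1 h2 h3
  have hσ := ENNReal.toNNReal_pos h3.1.ne' h3.2.ne
  have hL := leftLim_eq_of_eq_before (hM.path ω).antitone (hM'.path ω).antitone hσ
    fun t ht => h1 t (by rw [← ENNReal.coe_toNNReal h3.2.ne]; exact_mod_cast ht)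
  rw [splitRatio_eq (hM.path ω) hσ, splitRatio_eq (hM'.path ω) hσ, ← hL]
  have hpos := (hM.path ω).leftLim_pos (τ ω).toNNReal
  have h4 := (hM.path ω).pos (τ ω).toNNReal
  have h5 := (hM'.path ω).pos (τ ω).toNNReal
  refine ⟨⟨div_pos h4 hpos, (div_lt_one hpos).mpr (by linarith [h2.1])⟩, ?_⟩
  rw [← h2.1, sub_div, div_self hpos.ne']

namespace AsymmetricMarkovBranching

variable {Ω : Type*} [MeasurableSpace Ω] {μ : Measure Ω} {M M' : ℝ≥0 → Ω → ℝ}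
  (h : AsymmetricMarkovBranching μ M M' (separationTime M M')) [IsProbabilityMeasure μ]
  (hM : IsPureJumpProcess M) (hM' : IsPureJumpProcess M')
  (hτ : ∀ᵐ ω ∂μ, 0 < separationTime M M' ω ∧ separationTime M M' ω < ∞)

include h hM hM' hτ

/-- The rescaled expectation of M^k on τ ≤ 1/(n+1) is also a difference of exponentials with rates b
and a, hence tends to a - b. -/
theorem integral_splitRatio_pow {lam : ℝ} (hlam : 0 < lam)
    (hrate : ∀ t : ℝ≥0, ∫ ω, alive (separationTime M M') t ω ∂μ = Real.exp (-(t * lam)))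
    {k : ℕ} {a b : ℝ}
    (ha : ∀ t : ℝ≥0, ∫ ω, M t ω ^ k * alive (separationTime M M') t ω ∂μ = Real.exp (-(t * a)))
    (hb : ∀ t : ℝ≥0, ∫ ω, M t ω ^ k ∂μ = Real.exp (-(t * b))) :
    lam / (1 - Real.exp (-lam)) *
        ∫ ω in {ω | separationTime M M' ω ≤ 1}, splitRatio M (separationTime M M') ω ^ k ∂μ =
      a - b := by
  have hτm := measurable_separationTime hM hM'
  refine tendsto_nhds_unique (h.tendsto_mul_integral_before hM hM' hτ (g := fun u => u ^ k)
    (by fun_prop) (fun u hu => ⟨pow_nonneg hu.1 k, pow_le_one₀ hu.1 hu.2⟩) hlam hrate) ?_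
  refine ((tendsto_mul_one_sub_exp a).sub (tendsto_mul_one_sub_exp b)).congr fun n => ?_
  have hp : ∀ t, ∀ᵐ ω ∂μ, M t ω ^ k ∈ Icc (0 : ℝ) 1 := fun t =>
    (h.ae_mem_Icc hM (hτ.mono fun ω hω => hω.1) t).mono fun ω hω =>
      ⟨pow_nonneg hω.1 k, pow_le_one₀ hω.1 hω.2⟩
  have e : ∀ t : ℝ≥0, ∫ ω, M t ω ^ k * (1 - alive (separationTime M M') t ω) ∂μ =
      Real.exp (-(t * b)) - Real.exp (-(t * a)) := fun t => by
    rw [← ha, ← hb, ← integral_sub]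
    · simp only [mul_sub, mul_one]
    · exact integrable_of_mem_Icc ((hM.measurable t).pow_const k).aestronglyMeasurable (hp t)
    · exact integrable_of_mem_Icc (((hM.measurable t).pow_const k).mul
        (measurable_alive hτm t)).aestronglyMeasurable
        ((hp t).mono fun ω hω => unitInterval.mul_mem hω (alive_mem_Icc _ _ _))
  rw [e]
  push_cast
  ring

/-- The measure governing the splits which separate `M` from `M'`. -/
theorem exists_splittingMeasure_at (hJ : BinaryJunction μ M M' (separationTime M M'))
    {a b b' : ℕ → ℝ}
    (ha : ∀ (k : ℕ) (t : ℝ≥0),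
      ∫ ω, M t ω ^ k * alive (separationTime M M') t ω ∂μ = Real.exp (-(t * a k)))
    (hb : ∀ (k : ℕ) (t : ℝ≥0), ∫ ω, M t ω ^ k ∂μ = Real.exp (-(t * b k)))
    (hb' : ∀ (k : ℕ) (t : ℝ≥0), ∫ ω, M' t ω ^ k ∂μ = Real.exp (-(t * b' k))) :
    ∃ Λ : Measure ℝ, IsFiniteMeasure Λ ∧ Λ (Ioo 0 1)ᶜ = 0 ∧
      ∀ k, ∫ u, u ^ k ∂Λ = a k - b k ∧ ∫ u, (1 - u) ^ k ∂Λ = a k - b' k := by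
  set τ := separationTime M M'
  have hτm : Measurable τ := measurable_separationTime hM hM'
  have hrate : ∀ t : ℝ≥0, ∫ ω, alive τ t ω ∂μ = Real.exp (-(t * a 0)) := fun t => by
    simpa using ha 0 t
  -- Otherwise P(τ > n) would not tend to 0, contrary to τ < ∞.
  have hlam : 0 < a 0 := by
    by_contra hneg
    have h0 := tendsto_integral_alive hτm (hτ.mono fun ω hω => hω.2)
    refine absurd (ge_of_tendsto' h0 (b := 1) fun n => ?_) (by norm_num)
    rw [hrate]
    refine Real.one_le_exp ?_
    have : (0 : ℝ) ≤ n := n.cast_nonneg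
    push_cast
    nlinarith
  have hpi : 0 < 1 - Real.exp (-a 0) := by
    have : Real.exp (-a 0) < 1 := by rw [Real.exp_lt_one_iff]; linarith
    linarith
  have hq : 0 ≤ a 0 / (1 - Real.exp (-a 0)) := by positivity
  have hr := measurable_splitRatio hM hτm
  have hae := hJ.ae_splitRatio hM hM' hτ
  have h_int : ∀ g : ℝ → ℝ, Measurable g →
      ∫ u, g u ∂(ENNReal.ofReal (a 0 / (1 - Real.exp (-a 0))) •
        (μ.restrict {ω | τ ω ≤ 1}).map (splitRatio M τ)) =
      a 0 / (1 - Real.exp (-a 0)) * ∫ ω in {ω | τ ω ≤ 1}, g (splitRatio M τ ω) ∂μ := fun g hg => by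
    rw [integral_smul_measure, integral_map hr.aemeasurable hg.aestronglyMeasurable,
      ENNReal.toReal_ofReal hq, smul_eq_mul]
  refine ⟨ENNReal.ofReal (a 0 / (1 - Real.exp (-a 0))) •
    (μ.restrict {ω | τ ω ≤ 1}).map (splitRatio M τ), Measure.smul_finite _ ENNReal.ofReal_ne_top,
    ?_, fun k => ⟨?_, ?_⟩⟩
  · rw [Measure.smul_apply, Measure.map_apply hr measurableSet_Ioo.compl, smul_eq_mul]
    refine mul_eq_zero_of_right _ (ae_iff.mp (ae_restrict_of_ae (hae.mono fun ω hω => hω.1)))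
  · rw [h_int _ (by fun_prop)]
    exact h.integral_splitRatio_pow hM hM' hτ hlam hrate (ha k) (hb k)
  · rw [h_int (fun u => (1 - u) ^ k) (by fun_prop)]
    -- The same computation for M': its moments on τ > t are those of M, so the rates `a` are
    -- shared, and its ratio at τ is one minus that of M.
    have hc : separationTime M' M = τ := separationTime_comm M M'
    have h' := h.swap
    rw [← hc] at h'
    have key := h'.integral_splitRatio_pow hM' hM (by rwa [hc]) hlam (by rwa [hc])
      (k := k) (a := a k) (fun t => by
        rw [hc, ← ha k t]
        refine integral_congr_ae (ae_of_all _ fun ω => ?_)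
        beta_reduce
        by_cases ht : (t : ℝ≥0∞) < τ ω
        · rw [eq_of_lt_separationTime ht]
        · rw [alive_of_le (not_lt.mp ht), mul_zero, mul_zero]) (hb' k)
    rw [hc] at key
    rw [← key]
    congr 1
    refine integral_congr_ae (ae_restrict_of_ae (hae.mono fun ω hω => ?_))
    beta_reduce
    rw [hω.2]

end AsymmetricMarkovBranching

/-- A σ-finite measure and a finite measure can be recovered from their sum by means of
complementary densities. -/
theorem exists_switching_density (Λ₀ Λ₁ : Measure ℝ) [SigmaFinite Λ₀] [IsFiniteMeasure Λ₁] :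
    ∃ p : ℝ → ℝ, Measurable p ∧ (∀ u, p u ∈ Icc (0 : ℝ) 1) ∧
      ((Λ₀ + Λ₁).withDensity fun u => ENNReal.ofReal (p u)) = Λ₁ ∧
      ((Λ₀ + Λ₁).withDensity fun u => ENNReal.ofReal (1 - p u)) = Λ₀ := by
  have hle : Λ₁ ≤ Λ₀ + Λ₁ := Measure.le_add_left le_rfl
  -- The density is at most 1 only almost everywhere; the minimum makes the bound hold everywhere.
  let p : ℝ → ℝ := fun u => (min 1 (Λ₁.rnDeriv (Λ₀ + Λ₁) u)).toReal
  have hmin : ∀ u, min 1 (Λ₁.rnDeriv (Λ₀ + Λ₁) u) ≠ ∞ := fun u =>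
    ne_top_of_le_ne_top ENNReal.one_ne_top (min_le_left _ _)
  have hp : Measurable p := (measurable_const.min (Measure.measurable_rnDeriv _ _)).ennreal_toReal
  have hp01 : ∀ u, p u ∈ Icc (0 : ℝ) 1 := fun u => ⟨ENNReal.toReal_nonneg,
    ENNReal.toReal_le_of_le_ofReal zero_le_one (by simp)⟩
  have h1 : ((Λ₀ + Λ₁).withDensity fun u => ENNReal.ofReal (p u)) = Λ₁ := by
    conv_rhs => rw [← Measure.withDensity_rnDeriv_eq Λ₁ (Λ₀ + Λ₁) hle.absolutelyContinuous]
    refine withDensity_congr_ae ?_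
    filter_upwards [Measure.rnDeriv_le_one_of_le hle] with u hu
    rw [ENNReal.ofReal_toReal (hmin u)]
    exact min_eq_right hu
  refine ⟨p, hp, hp01, h1, ?_⟩
  have h2 := withDensity_add_withDensity (Λ := Λ₀ + Λ₁) hp hp01
  rw [h1, add_comm] at h2
  ext A hA
  have h3 := congrArg (fun ν : Measure ℝ => ν A) h2
  simp only [Measure.add_apply] at h3
  -- Cancellation in [0, ∞] is legitimate because Λ₁ is finite.
  exact (ENNReal.add_left_inj (measure_ne_top Λ₁ A)).mp h3

end SplittingAt

/-! ### From the branching property to the bifurcator -/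

section Construction

theorem toReal_lintegral_one_sub {Λ : Measure ℝ} [IsFiniteMeasure Λ] {f : ℝ → ℝ} (hf : Measurable f)
    (h01 : ∀ᵐ u ∂Λ, f u ∈ Icc (0 : ℝ) 1) :
    (∫⁻ u, ENNReal.ofReal (1 - f u) ∂Λ).toReal = Λ.real univ - ∫ u, f u ∂Λ := by
  rw [← integral_eq_lintegral_of_nonneg_ae (h01.mono fun u hu => sub_nonneg.mpr hu.2)
    (by fun_prop), integral_sub (integrable_const _)
    (integrable_of_mem_Icc hf.aestronglyMeasurable h01)]
  simp

theorem lintegral_one_sub_ne_top {Λ : Measure ℝ} [IsFiniteMeasure Λ] {f : ℝ → ℝ}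
    (h01 : ∀ᵐ u ∂Λ, f u ∈ Icc (0 : ℝ) 1) : ∫⁻ u, ENNReal.ofReal (1 - f u) ∂Λ ≠ ∞ := by
  refine ne_top_of_le_ne_top (b := ∫⁻ _, 1 ∂Λ) (by simp) (lintegral_mono_ae (h01.mono fun u hu => ?_))
  rw [← ENNReal.ofReal_one]
  exact ENNReal.ofReal_le_ofReal (by linarith [hu.1])

namespace AsymmetricMarkovBranching

variable {Ω : Type*} [MeasurableSpace Ω] {μ : Measure Ω} {M M' : ℝ≥0 → Ω → ℝ}
  (h : AsymmetricMarkovBranching μ M M' (separationTime M M')) [IsProbabilityMeasure μ]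
  (hM : IsPureJumpProcess M) (hM' : IsPureJumpProcess M')

include h hM hM'

theorem isMarkovPair_left (hτ : ∀ᵐ ω ∂μ, 0 < separationTime M M' ω) :
    IsMarkovPair μ M (separationTime M M') := by
  have h' := h.swap
  rw [← separationTime_comm M M'] at h' hτ ⊢
  exact h'.isMarkovPair_right hM' hM hτ

variable (hτ : ∀ᵐ ω ∂μ, 0 < separationTime M M' ω ∧ separationTime M M' ω < ∞)

include hτ

/-- The splitting measure and the switching probabilities, described through the exponents of the
moments of the two processes. -/
theorem exists_splittingMeasure_switching (hJ : BinaryJunction μ M M' (separationTime M M')) :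
    ∃ (Λ : Measure ℝ) (p : ℝ → ℝ), IsSplittingMeasure Λ ∧ Measurable p ∧
      (∀ u, p u ∈ Icc (0 : ℝ) 1) ∧ ∫⁻ u, ENNReal.ofReal (p u) ∂Λ < ∞ ∧
      ∀ (k : ℕ) (t : ℝ≥0),
        ∫ ω, M t ω ^ k ∂μ =
          Real.exp (-(t * (∫⁻ u, ENNReal.ofReal (1 - u ^ k) ∂Λ).toReal)) ∧
        ∫ ω, M t ω ^ k * alive (separationTime M M') t ω ∂μ =
          Real.exp (-(t * ((∫⁻ u, ENNReal.ofReal (1 - u ^ k)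
            ∂(Λ.withDensity fun u => ENNReal.ofReal (1 - p u))).toReal +
              (∫⁻ u, ENNReal.ofReal (p u) ∂Λ).toReal))) ∧
        ∫ ω, M' t ω ^ k ∂μ =
          Real.exp (-(t * (∫⁻ u, ENNReal.ofReal (1 - u ^ k)
            ∂((markedMeasure Λ p).map switchSize)).toReal)) := by
  have hτm := measurable_separationTime hM hM'
  have hτ0 : ∀ᵐ ω ∂μ, 0 < separationTime M M' ω := hτ.mono fun ω hω => hω.1
  have h1 := h.ae_eq_one hM hτ0
  have h1' := h.swap.ae_eq_one hM' hτ0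
  have H' := h.isMarkovPair_right hM hM' hτ0
  have H := h.isMarkovPair_left hM hM' hτ0
  have htop : ∀ᵐ ω ∂μ, (0 : ℝ≥0∞) < (fun _ : Ω => ∞) ω := ae_of_all _ fun _ => ENNReal.coe_lt_top
  choose a ha using H.exists_rate hM hτm h1 hτ0
  choose b hb using (H.to_top hτ0).exists_rate hM measurable_const h1 htop
  choose b' hb' using (H'.to_top hτ0).exists_rate hM' measurable_const h1' htop
  simp only [alive_top, mul_one] at hb hb'
  have hb0 : b 0 = 0 := by simpa using (hb 0 1).symm
  have hb0' : b' 0 = 0 := by simpa using (hb' 0 1).symm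
  obtain ⟨Λ₀, hΛ₀, hΛ₀k⟩ := H.exists_splittingMeasure_before hM hτm h1 hτ0 ha
  obtain ⟨Λ₁, hfin, hΛ₁, hΛ₁k⟩ := h.exists_splittingMeasure_at hM hM' hτ hJ ha hb hb'
  have := hΛ₀.sigmaFinite
  obtain ⟨p, hp, hp01, hp1, hp0⟩ := exists_switching_density Λ₀ Λ₁
  have hae : ∀ᵐ u ∂Λ₁, u ∈ Ioo (0 : ℝ) 1 := hΛ₁
  have hpow : ∀ k : ℕ, ∀ᵐ u ∂Λ₁, u ^ k ∈ Icc (0 : ℝ) 1 := fun k =>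
    hae.mono fun u hu => ⟨pow_nonneg hu.1.le k, pow_le_one₀ hu.1.le hu.2.le⟩
  have hpow' : ∀ k : ℕ, ∀ᵐ u ∂Λ₁, (1 - u) ^ k ∈ Icc (0 : ℝ) 1 := fun k =>
    hae.mono fun u hu => ⟨pow_nonneg (by linarith [hu.2]) k,
      pow_le_one₀ (by linarith [hu.2]) (by linarith [hu.1])⟩
  have hmass : Λ₁.real univ = a 0 := by simpa [hb0] using (hΛ₁k 0).1
  have hpint : ∫⁻ u, ENNReal.ofReal (p u) ∂(Λ₀ + Λ₁) = Λ₁ univ := by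
    rw [← setLIntegral_univ, ← withDensity_apply _ MeasurableSet.univ, hp1]
  have e0 : ∀ k, (∫⁻ u, ENNReal.ofReal (1 - u ^ k) ∂Λ₀).toReal = a k - a 0 := fun k => by
    rw [(hΛ₀k k).2, ENNReal.toReal_ofReal (hΛ₀k k).1]
  have f0 : ∀ k, ∫⁻ u, ENNReal.ofReal (1 - u ^ k) ∂Λ₀ ≠ ∞ := fun k =>
    (hΛ₀.lintegral_one_sub_pow_lt_top k).ne
  refine ⟨Λ₀ + Λ₁, p, ⟨?_, ?_⟩, hp, hp01, ?_, fun k t => ⟨?_, ?_, ?_⟩⟩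
  · rw [Measure.add_apply, hΛ₀.support, hΛ₁, add_zero]
  · rw [lintegral_add_measure]
    refine ENNReal.add_lt_top.mpr ⟨hΛ₀.integrable, ?_⟩
    simpa using (lintegral_one_sub_ne_top (hpow 1)).lt_top
  · rw [hpint]
    exact measure_lt_top _ _
  -- The exponent is (a_k - a_0) + a_0 - (a_k - b_k) = b_k, the mass of Λ₁ being a_0.
  · rw [lintegral_add_measure, ENNReal.toReal_add (f0 k) (lintegral_one_sub_ne_top (hpow k)), e0,
      toReal_lintegral_one_sub (by fun_prop) (hpow k), (hΛ₁k k).1, hmass, hb]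
    congr 1
    ring
  · rw [hp0, e0, hpint, ha]
    change _ = Real.exp (-(t * (a k - a 0 + Λ₁.real univ)))
    rw [hmass]
    congr 1
    ring
  -- Switching replaces u by 1-u under Λ₁, whose moments in 1-u are a_k - b'_k, so the exponent
  -- becomes b'_k.
  · rw [lintegral_map_switchSize (by fun_prop), hp0, hp1,
      ENNReal.toReal_add (lintegral_one_sub_ne_top (hpow' k)) (f0 k), e0,
      toReal_lintegral_one_sub (by fun_prop) (hpow' k), (hΛ₁k k).2, hmass, hb']
    congr 1
    ring

/-- Both (M, τ) and M' are Markov pairs with the one-time moments of the Poisson construction, hence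
have its laws; the evolution after τ is then a copy of M' by (ii). -/
theorem isBifurcator (hJ : BinaryJunction μ M M' (separationTime M M')) :
    IsBifurcator μ M M' (separationTime M M') := by
  have hτm := measurable_separationTime hM hM'
  have hτ0 : ∀ᵐ ω ∂μ, 0 < separationTime M M' ω := hτ.mono fun ω hω => hω.1
  have H' := h.isMarkovPair_right hM hM' hτ0
  have H := h.isMarkovPair_left hM hM' hτ0
  obtain ⟨Λ, p, hΛ, hp, hp01, hpfin, hmom⟩ := h.exists_splittingMeasure_switching hM hM' hτ hJ
  have := hΛ.sigmaFinite_markedMeasure hp hp01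
  obtain ⟨Ω', _, P, _, N, hN⟩ := exists_isPoissonRandomMeasure
    ((volume.restrict (Ioi (0 : ℝ))).prod (markedMeasure Λ p))
  have hF := hN.factors hΛ hp hp01
  have hS := hN.switchedFactors hΛ hp hp01
  have hΛ' := hΛ.switch hp hp01 hpfin
  have hFm : ∀ t, Measurable fun ω => factorProduct (factors (N ω)) t := fun t =>
    (measurable_factorProduct t).comp hF.measurable
  have hSm : ∀ t, Measurable fun ω => factorProduct (switchedFactors (N ω)) t := fun t =>
    (measurable_factorProduct t).comp hS.measurable
  have hfsm : Measurable fun ω => firstSwitch (N ω) := measurable_firstSwitch.comp hN.measurable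
  -- The moment formula at k = 0, t = 0 gives probability one to a positive switching time.
  have hfs : ∀ᵐ ω ∂P, 0 < firstSwitch (N ω) := by
    have e := integral_factorProduct_pow_alive hΛ hp hp01 hN hpfin 0 0
    simp only [pow_zero, one_mul, NNReal.coe_zero, zero_mul, neg_zero, Real.exp_zero] at e
    have hi := integrable_of_mem_Icc (μ := P) (measurable_alive hfsm 0).aestronglyMeasurable
      (ae_of_all _ fun ω => alive_mem_Icc _ _ _)
    have e2 : ∫ ω, (1 - alive (fun ω => firstSwitch (N ω)) 0 ω) ∂P = 0 := by
      rw [integral_sub (integrable_const _) hi, e]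
      simp
    rw [integral_eq_zero_iff_of_nonneg
      (fun ω => sub_nonneg.mpr (alive_mem_Icc _ _ _).2) ((integrable_const _).sub hi)] at e2
    filter_upwards [e2] with ω hω
    by_contra hle
    rw [alive_of_le (by simpa using hle)] at hω
    simp at hω
  have hlaw := identDistrib_of_moments hM.measurable hFm hτm.aemeasurable hfsm.aemeasurable
    (h.ae_mem_Icc hM hτ0) (fun t => ae_of_all _ fun ω => Ioc_subset_Icc_self
      (factorProduct_mem_Ioc _ t)) hτ0 hfs
    (H.moments_eq (isMarkovPair_poisson hΛ hp hp01 hN hpfin)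
      (fun t => ae_of_all _ fun ω => (hM.path ω).pos t)
      (fun t => ae_of_all _ fun ω => (factorProduct_mem_Ioc _ t).1) hτ0 hfs
      (fun t k => by rw [(hmom k t).1, integral_factorProduct_pow hΛ hp hp01 hN])
      fun t k => by rw [(hmom k t).2.1, integral_factorProduct_pow_alive hΛ hp hp01 hN hpfin])
  have hpow' : ∀ (t : ℝ≥0) (k : ℕ), ∫ ω, M' t ω ^ k ∂μ =
      ∫ ω, factorProduct (switchedFactors (N ω)) t ^ k ∂P := fun t k => by
    rw [(hmom k t).2.2, integral_factorProduct_pow_eq hΛ' hS]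
  have hlaw' := (identDistrib_of_moments (τ := fun _ => ∞) (τ' := fun _ => ∞) hM'.measurable hSm
    aemeasurable_const aemeasurable_const (h.swap.ae_mem_Icc hM' hτ0)
    (fun t => ae_of_all _ fun ω => Ioc_subset_Icc_self (factorProduct_mem_Ioc _ t))
    (ae_of_all _ fun _ => ENNReal.coe_lt_top) (ae_of_all _ fun _ => ENNReal.coe_lt_top)
    ((H'.to_top hτ0).moments_eq (isMarkovPair_factorProduct hΛ' hS)
      (fun t => ae_of_all _ fun ω => (hM'.path ω).pos t)
      (fun t => ae_of_all _ fun ω => (factorProduct_mem_Ioc _ t).1)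
      (ae_of_all _ fun _ => ENNReal.coe_lt_top) (ae_of_all _ fun _ => ENNReal.coe_lt_top) hpow'
      fun t k => by simpa only [alive_top, mul_one] using hpow' t k)).comp measurable_fst
  obtain ⟨hpost, hind⟩ := h.postSplit_law hM hM' hτ
  refine ⟨Λ, p, ⟨hΛ, ae_of_all _ hM.path, Ω', _, P, inferInstance, _, hF,
    hlaw.comp measurable_fst⟩, ⟨_, hΛ', ae_of_all _ hM'.path, Ω', _, P, inferInstance, _, hS, hlaw'⟩,
    hp, hp01, hpfin, Ω', _, P, inferInstance, N, hN, hlaw,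
    hJ.identification.mono fun ω hω t ht => (hω t ht).symm,
    hJ.splitting.mono fun ω hω => hω.1.symm, ?_, hind⟩
  refine ⟨?_, (measurable_pi_lambda _ hSm).aemeasurable, ?_⟩
  · exact (measurable_pi_lambda _ (measurable_postSplit hM' hτm)).aemeasurable
  · exact hpost.trans hlaw'.map_eq

end AsymmetricMarkovBranching

end Construction

theorem mainTheorem6 {Ω : Type*} [MeasurableSpace Ω] (μ : Measure Ω) [IsProbabilityMeasure μ]
    (M Mhat : ℝ≥0 → Ω → ℝ) (hM : IsPureJumpProcess M) (hMhat : IsPureJumpProcess Mhat)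
    (hτ : ∀ᵐ ω ∂μ, 0 < separationTime M Mhat ω ∧ separationTime M Mhat ω < ∞) :
    IsBifurcator μ M Mhat (separationTime M Mhat) ↔
      AsymmetricMarkovBranching μ M Mhat (separationTime M Mhat) ∧
        BinaryJunction μ M Mhat (separationTime M Mhat) := by
  have hτm : Measurable (separationTime M Mhat) := measurable_separationTime hM hMhat
  refine ⟨fun hB => ?_, fun h => ?_⟩
  · have h := hB.isSplitOff hM hMhat hτm hτ
    exact ⟨h.asymmetricMarkovBranching, h.binaryJunction⟩
  · exact h.1.isBifurcator hM hMhat hτ h.2
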